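/- **Setting.** All CR manifolds here are real hypersurfaces $M^7\subset\mathbb C^4$, with $D=TM\cap iTM$, complex structure $J$ on $D$ (multiplication by $i$), and CR bundle $H\subset\mathbb C D$ (the $i$-eigenbundle of $J$). The Levi form is $\mathcal L(X,Y)=i[X,\overline Y]\bmod\mathbb C D$ for $X,Y\in\Gamma(H)$, its kernel is $K\subset H$, and the cubic form is $\mathcal C(X,Y,Z)=i[[X,\overline Y],\overline Z]\bmod\mathbb C D$ for $X\in\Gamma(K)$, $Y,Z\in\Gamma(H)$. For $X\in K$ let $\mathrm{ad}_X:H/K\to H/K\cong\mathbb C D/(K\oplus\overline H)$ be $\mathrm{ad}_X(\underline Y)=[X,\overline Y]\bmod K\oplus\overline H$. We say that $M$ *satisfies the hypotheses in the definite case* if its CR structure is integrable, $K$ is a smooth subbundle of complex rank $1$, $\mathcal L$ is definite on $H/K$ (signature $(2,0)$ for the appropriate sign of the contact form), $M$ is 2-nondegenerate (the kernel of $\mathcal C$ in $K$ is trivial), and $\mathcal C$ is of conformal unitary type: for nonvanishing $X\in\Gamma(K)$ there is a nonvanishing function $\lambda$ with $\mathcal L(\mathrm{ad}_X\underline Y,\mathrm{ad}_X\underline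 Z)=\lambda\,\overline{\mathcal L(\underline Y,\underline Z)}$ for all $Y,Z\in H$. A *4-adapted coframing* of such an $M$ consists of smooth 1-forms $\eta^0,\dots,\eta^3$ with $\eta^0$ real and annihilating $D$, all $\eta^j$ annihilating $\overline H$, $\eta^1,\eta^2$ annihilating $K$, $(\eta^0,\eta^1,\eta^2,\eta^3):T_xM\to\mathbb R\oplus\mathbb C^3$ an isomorphism for each $x$, and for which there are smooth real 1-forms $\tau,\varrho,\varsigma$, smooth complex 1-forms $\gamma^1,\gamma^2$, real functions $f^3,t^3$ and complex functions $F^1,F^2,T^3_{\bar1},T^3_{\bar2},F^3_1,F^3_2$ on $M$ with $$\begin{aligned} d\eta^0&=-2\tau\wedge\eta^0+i\eta^1\wedge\eta^{\bar1}+i\eta^2\wedge\eta^{\bar2},\\ d\eta^1&=-\gamma^1\wedge\eta^0-(\tau+i\varrho)\wedge\eta^1+\eta^3\wedge\eta^{\bar2}+F^1\eta^{\bar1}\wedge\eta^2,\\ d\eta^2&=-\gamma^2\wedge\eta^0-(\tau+i\varsigma)\wedge\eta^2+\eta^3\wedge\eta^{\bar1}+F^2\eta^{\bar2}\wedge\eta^1,\\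 d\eta^3&=-i\gamma^2\wedge\eta^1-i\gamma^1\wedge\eta^2-(i\varrho+i\varsigma)\wedge\eta^3+f^3\eta^3\wedge\eta^0+it^3\eta^1\wedge\eta^2\\ &\quad+T^3_{\bar1}\eta^{\bar1}\wedge\eta^0+T^3_{\bar2}\eta^{\bar2}\wedge\eta^0+F^3_1\eta^{\bar2}\wedge\eta^1+F^3_2\eta^{\bar1}\wedge\eta^2, \end{aligned}$$ where $\eta^{\bar j}=\overline{\eta^j}$. The functions $F^1,F^2$ are then the *coefficients of the fundamental invariants* $|F^1|^2\eta^0$, $|F^2|^2\eta^0$ relative to the coframing. The *homogeneous model* $M_\star$ is the orbit of the plane $\langle e_1,e_2\rangle$ in the complex Grassmannian $Gr(2,4)$ under the group $SU(2,2)$ of the Hermitian form $h(z,w)=z^1\overline w^4+z^4\overline w^1-z^2\overline w^2+z^3\overline w^3$ on $\mathbb C^4$, with the CR structure induced from $Gr(2,4)$. A local CR equivalence is a diffeomorphism between open sets whose differential maps $D$ to $D$ and commutes with $J$. **Theorem.** Put $x_j=z^j+\overline{z^j}$, $L=\ln\!\big(x_1x_2/x_3^2\big)$, and let $$M=\{z\in\mathbb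 C^4:\ x_1,x_2,x_3>0,\ \ z^4+\overline{z^4}+x_3L=0\}.$$ 1. $M$ is a smooth real hypersurface which satisfies the hypotheses in the definite case. 2. The forms $$\begin{aligned} \eta^0&=2i\tfrac{x_3}{x_1}dz^1+2i\tfrac{x_3}{x_2}dz^2+2i(L-2)dz^3+2i\,dz^4,\\ \eta^1&=\tfrac{(1-i)\sqrt{x_3}}{2x_1}dz^1-\tfrac{(1-i)\sqrt{x_3}}{2x_2}dz^2-\tfrac{1+i}{2\sqrt{x_3}}L\,dz^3-\tfrac{1+i}{2\sqrt{x_3}}dz^4,\\ \eta^2&=\tfrac{(1+i)\sqrt{x_3}}{2x_1}dz^1-\tfrac{(1+i)\sqrt{x_3}}{2x_2}dz^2-\tfrac{1-i}{2\sqrt{x_3}}L\,dz^3-\tfrac{1-i}{2\sqrt{x_3}}dz^4,\\ \eta^3&=\tfrac1{8x_1}dz^1+\tfrac1{8x_2}dz^2+\tfrac{6+L}{8x_3}dz^3+\tfrac1{8x_3}dz^4 \end{aligned}$$ restrict to a 4-adapted coframing of $M$, and the coefficients of the fundamental invariants relative to it are uniquely determined and equal $$F^1=-\frac{1-i}{4\sqrt{z^3+\overline{z^3}}},\qquad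 F^2=-\frac{1+i}{4\sqrt{z^3+\overline{z^3}}}.$$ 3. $F^1$ and $F^2$ vanish nowhere on $M$. 4. $M$ is not locally CR equivalent to $M_\star$: for no $p\in M$ is there a local CR equivalence from a neighbourhood of $p$ in $M$ onto an open subset of $M_\star$. -/

import Mathlib

open scoped ContDiff Topology

noncomputable section

namespace CR7

/-! ### Real hypersurfaces of `ℂ⁴` and their CR structure -/

/-- The complex vector space `ℂ⁴`; the coordinate `z^j` of the text is `z (j - 1)`. -/
abbrev C4 := Fin 4 → ℂ

/-- Complexified tangent vectors `ℂ ⊗ T_z ℂ⁴`. The pair `(a, b)` stands for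
`∑ a^j ∂/∂z^j + b^j ∂/∂z̄^j`. -/
abbrev CVec := C4 × C4

/-- Complex conjugation of complexified tangent vectors. -/
def cConj (X : CVec) : CVec := (star X.2, star X.1)

/-- The real part of a complexified tangent vector, as a real tangent vector.
A real tangent vector `v ∈ ℂ⁴` is identified with `(v, v̄)`, so `X = cRe X + i cIm X`. -/
def cRe (X : CVec) : C4 := (1 / 2 : ℂ) • (X.1 + star X.2)

/-- The imaginary part of a complexified tangent vector, as a real tangent vector. -/
def cIm (X : CVec) : C4 := (-Complex.I / 2) • (X.1 - star X.2)

/-- Derivative of a vector valued function along the complexified tangent vector `X` at `x`. -/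
def cderiv (X : CVec) (G : C4 → CVec) (x : C4) : CVec :=
  fderiv ℝ G x (cRe X) + Complex.I • fderiv ℝ G x (cIm X)

/-- The Lie bracket `[X, Y]` of complex vector fields. -/
def bracket (X Y : C4 → CVec) (x : C4) : CVec :=
  cderiv (X x) Y x - cderiv (Y x) X x

/-- Complex conjugate of a complex vector field. -/
def conjField (X : C4 → CVec) : C4 → CVec := fun y => cConj (X y)

/-- The complex-linear extension of a complex valued covector to complexified vectors. -/
def evalC (α : C4 →L[ℝ] ℂ) (X : CVec) : ℂ := α (cRe X) + Complex.I * α (cIm X)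

/-- A real valued covector, regarded as a complex valued one. -/
def ofRealForm (α : C4 →L[ℝ] ℝ) : C4 →L[ℝ] ℂ := Complex.ofRealCLM.comp α

/-- The complex conjugate of a complex valued covector. -/
def conjForm (α : C4 →L[ℝ] ℂ) : C4 →L[ℝ] ℂ := (Complex.conjCLE : ℂ →L[ℝ] ℂ).comp α

/-- `S` is a smooth (embedded, not necessarily closed) real hypersurface of `ℂ⁴`;
in particular it is a manifold of real dimension 7. -/
def IsRealHypersurface (S : Set C4) : Prop :=
  ∀ x ∈ S, ∃ U : Set C4, IsOpen U ∧ x ∈ U ∧ ∃ ρ : C4 → ℝ, ContDiffOn ℝ ∞ ρ U ∧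
    (∀ y ∈ U, fderiv ℝ ρ y ≠ 0) ∧ ∀ y ∈ U, (y ∈ S ↔ ρ y = 0)

/-- The real tangent space `T_x S`: velocities at `x` of smooth curves in `S`. -/
def tangentSpace (S : Set C4) (x : C4) : Set C4 :=
  {v | ∃ δ > (0 : ℝ), ∃ c : ℝ → C4, ContDiffOn ℝ ∞ c (Set.Ioo (-δ) δ) ∧ c 0 = x ∧
    (∀ t ∈ Set.Ioo (-δ) δ, c t ∈ S) ∧ deriv c 0 = v}

/-- The maximal complex subspace `D_x = T_x S ∩ i T_x S` of the tangent space. The complex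
structure `J` of `D_x` is multiplication by `i`. -/
def D (S : Set C4) (x : C4) : Set C4 :=
  {v | v ∈ tangentSpace S x ∧ Complex.I • v ∈ tangentSpace S x}

/-- The complexification `ℂD_x`. -/
def CD (S : Set C4) (x : C4) : Set CVec := {X | cRe X ∈ D S x ∧ cIm X ∈ D S x}

/-- The fibre `H_x` of the CR bundle, the `i`-eigenspace of `J` on `ℂD_x` (the `(1,0)`-vectors). -/
def H (S : Set C4) (x : C4) : Set CVec := {X | X ∈ CD S x ∧ X.2 = 0}

/-- The fibre of the conjugate CR bundle, the `(-i)`-eigenspace of `J` on `ℂD_x`. -/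
def Hbar (S : Set C4) (x : C4) : Set CVec := {X | X ∈ CD S x ∧ X.1 = 0}

/-- `X` is (a smooth extension to an open subset of `ℂ⁴` of) a CR vector field of `S` defined
near `x`. -/
def IsCRField (S : Set C4) (x : C4) (X : C4 → CVec) : Prop :=
  ∃ U : Set C4, IsOpen U ∧ x ∈ U ∧ ContDiffOn ℝ ∞ X U ∧ ∀ y ∈ S ∩ U, X y ∈ H S y

/-- Integrability of the CR structure: `[H, H] ⊆ H`. -/
def IsIntegrableCR (S : Set C4) : Prop :=
  ∀ x ∈ S, ∀ X Y, IsCRField S x X → IsCRField S x Y → bracket X Y x ∈ H S x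

/-! ### Levi form, Levi kernel and cubic form -/

/-- The Levi kernel `K_x`: those vectors of `H_x` for which the Levi form
`i [X, Ȳ]` modulo `ℂD` vanishes for all CR vector fields `Y`. -/
def leviKernel (S : Set C4) (x : C4) : Set CVec :=
  {u | u ∈ H S x ∧ ∀ X Y, IsCRField S x X → IsCRField S x Y → X x = u →
    Complex.I • bracket X (conjField Y) x ∈ CD S x}

/-- `X` is a CR vector field near `x` with values in the Levi kernel. -/
def IsKernelField (S : Set C4) (x : C4) (X : C4 → CVec) : Prop :=
  IsCRField S x X ∧ ∃ U : Set C4, IsOpen U ∧ x ∈ U ∧ ∀ y ∈ S ∩ U, X y ∈ leviKernel S y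

/-- The Levi kernel is a smooth subbundle of `H` of complex rank 1. -/
def HasRankOneLeviKernel (S : Set C4) : Prop :=
  ∀ x ∈ S, ∃ X, IsKernelField S x X ∧ ∃ U : Set C4, IsOpen U ∧ x ∈ U ∧
    ∀ y ∈ S ∩ U, X y ≠ 0 ∧ ∀ u, u ∈ leviKernel S y ↔ ∃ c : ℂ, u = c • X y

/-- A nonzero real covector on `T_x S` annihilating `D_x`. -/
def IsContactCovector (S : Set C4) (x : C4) (θ : C4 →L[ℝ] ℝ) : Prop :=
  (∀ v ∈ D S x, θ v = 0) ∧ ∃ v ∈ tangentSpace S x, θ v ≠ 0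

/-- The Hermitian form `L₀(X, Y) = i θ([X, Ȳ])` at `x` representing the Levi form. -/
def levi (θ : C4 →L[ℝ] ℝ) (X Y : C4 → CVec) (x : C4) : ℂ :=
  Complex.I * evalC (ofRealForm θ) (bracket X (conjField Y) x)

/-- For a suitable choice of sign of the contact covector, the Levi form is positive definite
on `H/K`. -/
def IsLeviDefinite (S : Set C4) : Prop :=
  ∀ x ∈ S, ∃ θ, IsContactCovector S x θ ∧
    ∀ X, IsCRField S x X → X x ∉ leviKernel S x → ∃ r : ℝ, 0 < r ∧ levi θ X X x = r

/-- The kernel of the cubic form `C(X, Y, Z) = i [[X, Ȳ], Z̄]` modulo `ℂD`,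
`X` in `K`, `Y` and `Z` in `H`. -/
def cubicKernel (S : Set C4) (x : C4) : Set CVec :=
  {u | u ∈ leviKernel S x ∧ ∀ X Y Z, IsKernelField S x X → IsCRField S x Y → IsCRField S x Z →
    X x = u → Complex.I • bracket (bracket X (conjField Y)) (conjField Z) x ∈ CD S x}

/-- 2-nondegeneracy: the kernel of the cubic form is trivial. -/
def IsTwoNondegenerate (S : Set C4) : Prop := ∀ x ∈ S, ∀ u ∈ cubicKernel S x, u = 0

/-- The value at `x` of the CR vector field `W` represents `ad_X(Y)`, the class of `[X, Ȳ]` in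
`ℂD_x / (K_x ⊕ H̄_x) ≅ H_x / K_x`. -/
def RepresentsAd (S : Set C4) (x : C4) (X Y W : C4 → CVec) : Prop :=
  IsCRField S x W ∧ ∃ k ∈ leviKernel S x, ∃ w ∈ Hbar S x,
    bracket X (conjField Y) x = W x + k + w

/-- The cubic form is of conformal unitary type: for `X` in `K` nonvanishing there is a nonzero
factor `c` (at each point) with `L(ad_X Y, ad_X Z) = c · conj L(Y, Z)` for all `Y`, `Z` in `H`. -/
def IsConformalUnitaryType (S : Set C4) : Prop :=
  ∀ x ∈ S, ∀ X, IsKernelField S x X → X x ≠ 0 → ∃ c : ℂ, c ≠ 0 ∧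
    ∀ θ, IsContactCovector S x θ → ∀ Y Z Y' Z', IsCRField S x Y → IsCRField S x Z →
      RepresentsAd S x X Y Y' → RepresentsAd S x X Z Z' →
      levi θ Y' Z' x = c * star (levi θ Y Z x)

/-- 7-dimensional, integrable, 2-nondegenerate hypersurface-type CR manifolds (embedded in `ℂ⁴`)
with Levi kernel of rank 1, Levi form definite on `H/K`, and cubic form of conformal unitary type. -/
structure IsDefiniteConformalUnitaryCR (S : Set C4) : Prop where
  hypersurface : IsRealHypersurface S
  integrable : IsIntegrableCR S
  kernel_rank_one : HasRankOneLeviKernel S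
  definite : IsLeviDefinite S
  two_nondegenerate : IsTwoNondegenerate S
  conformal_unitary : IsConformalUnitaryType S

/-! ### Adapted coframings and the coefficients `F¹`, `F²` -/

/-- Wedge product of two covectors. -/
def wedge (α β : C4 →L[ℝ] ℂ) (u v : C4) : ℂ := α u * β v - α v * β u

/-- Exterior derivative of a complex valued 1-form. -/
def extd (α : C4 → C4 →L[ℝ] ℂ) (x u v : C4) : ℂ := fderiv ℝ α x u v - fderiv ℝ α x v u

/-- The function is smooth on an open neighbourhood of `S`. -/
def SmoothNear {V : Type} [NormedAddCommGroup V] [NormedSpace ℝ V] (S : Set C4) (α : C4 → V) :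
    Prop :=
  ∃ U : Set C4, IsOpen U ∧ S ⊆ U ∧ ContDiffOn ℝ ∞ α U

/-- The 1-forms `η⁰, η¹, η², η³` restrict to a 0-adapted coframing of `S`. -/
structure IsZeroAdapted (S : Set C4) (η : Fin 4 → C4 → C4 →L[ℝ] ℂ) : Prop where
  smooth : ∀ j, SmoothNear S (η j)
  real : ∀ x ∈ S, ∀ v ∈ tangentSpace S x, (η 0 x v).im = 0
  coframe : ∀ x ∈ S, ∀ (r : ℝ) (c : Fin 3 → ℂ), ∃! v, v ∈ tangentSpace S x ∧
    η 0 x v = r ∧ ∀ j : Fin 3, η j.succ x v = c j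
  ann_D : ∀ x ∈ S, ∀ v ∈ D S x, η 0 x v = 0
  ann_Hbar : ∀ x ∈ S, ∀ X ∈ Hbar S x, ∀ j, evalC (η j x) X = 0
  ann_K : ∀ x ∈ S, ∀ X ∈ leviKernel S x, evalC (η 1 x) X = 0 ∧ evalC (η 2 x) X = 0

/-- The coframing `η` of `S` is 4-adapted (in the definite case `ε = 1`) and `F1`, `F2` are the
coefficients of its fundamental invariants `|F¹|²η⁰` and `|F²|²η⁰`: there are real 1-forms
`τ, ϱ, ς`, complex 1-forms `γ¹, γ²` and torsion coefficients for which the normalized structure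
equations hold on `S`. -/
def HasFundamentalCoefficients (S : Set C4) (η : Fin 4 → C4 → C4 →L[ℝ] ℂ) (F1 F2 : C4 → ℂ) :
    Prop :=
  IsZeroAdapted S η ∧
  ∃ (τ ϱ ς : C4 → C4 →L[ℝ] ℝ) (γ1 γ2 : C4 → C4 →L[ℝ] ℂ) (f3 t3 : C4 → ℝ)
    (T1 T2 F31 F32 : C4 → ℂ),
    SmoothNear S τ ∧ SmoothNear S ϱ ∧ SmoothNear S ς ∧ SmoothNear S γ1 ∧ SmoothNear S γ2 ∧
    ∀ x ∈ S, ∀ u ∈ tangentSpace S x, ∀ v ∈ tangentSpace S x,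
      extd (η 0) x u v =
        -2 * wedge (ofRealForm (τ x)) (η 0 x) u v
        + Complex.I * wedge (η 1 x) (conjForm (η 1 x)) u v
        + Complex.I * wedge (η 2 x) (conjForm (η 2 x)) u v ∧
      extd (η 1) x u v =
        -wedge (γ1 x) (η 0 x) u v
        - wedge (ofRealForm (τ x) + Complex.I • ofRealForm (ϱ x)) (η 1 x) u v
        + wedge (η 3 x) (conjForm (η 2 x)) u v
        + F1 x * wedge (conjForm (η 1 x)) (η 2 x) u v ∧
      extd (η 2) x u v =
        -wedge (γ2 x) (η 0 x) u v
        - wedge (ofRealForm (τ x) + Complex.I • ofRealForm (ς x)) (η 2 x) u v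
        + wedge (η 3 x) (conjForm (η 1 x)) u v
        + F2 x * wedge (conjForm (η 2 x)) (η 1 x) u v ∧
      extd (η 3) x u v =
        -Complex.I * wedge (γ2 x) (η 1 x) u v
        - Complex.I * wedge (γ1 x) (η 2 x) u v
        - wedge (Complex.I • ofRealForm (ϱ x) + Complex.I • ofRealForm (ς x)) (η 3 x) u v
        + f3 x * wedge (η 3 x) (η 0 x) u v
        + Complex.I * t3 x * wedge (η 1 x) (η 2 x) u v
        + T1 x * wedge (conjForm (η 1 x)) (η 0 x) u v
        + T2 x * wedge (conjForm (η 2 x)) (η 0 x) u v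
        + F31 x * wedge (conjForm (η 2 x)) (η 1 x) u v
        + F32 x * wedge (conjForm (η 1 x)) (η 2 x) u v

/-! ### Local CR equivalence and the homogeneous model -/

/-- There is a local CR equivalence between the real hypersurfaces `S` and `S'` of `ℂ⁴` taking `p`
to `p'`: a diffeomorphism between neighbourhoods in `S` and `S'` (given with its inverse by
smooth maps of open subsets of `ℂ⁴`) whose differential maps `D` to `D'` and commutes with `J`. -/
def LocallyCREquivalentAt (S : Set C4) (p : C4) (S' : Set C4) (p' : C4) : Prop :=
  ∃ (U U' : Set C4) (Φ Ψ : C4 → C4), IsOpen U ∧ IsOpen U' ∧ p ∈ S ∩ U ∧ p' ∈ S' ∩ U' ∧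
    ContDiffOn ℝ ∞ Φ U ∧ ContDiffOn ℝ ∞ Ψ U' ∧ Φ p = p' ∧
    (∀ x ∈ S ∩ U, Φ x ∈ S' ∩ U' ∧ Ψ (Φ x) = x) ∧
    (∀ y ∈ S' ∩ U', Ψ y ∈ S ∩ U ∧ Φ (Ψ y) = y) ∧
    ∀ x ∈ S ∩ U, ∀ v ∈ D S x, fderiv ℝ Φ x v ∈ D S' (Φ x) ∧
      fderiv ℝ Φ x (Complex.I • v) = Complex.I • fderiv ℝ Φ x v

/-- The Hermitian form
`h(z, w) = z¹ w̄⁴ + z⁴ w̄¹ - z² w̄² + z³ w̄³` of signature `(2,2)` on `ℂ⁴`. -/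
def herm (z w : C4) : ℂ := z 0 * star (w 3) + z 3 * star (w 0) - z 1 * star (w 1) + z 2 * star (w 2)

/-- The group `SU(2,2)` of the Hermitian form `herm`. -/
def SU22 : Set (Matrix (Fin 4) (Fin 4) ℂ) :=
  {A | A.det = 1 ∧ ∀ z w : C4, herm (A.mulVec z) (A.mulVec w) = herm z w}

/-- The homogeneous model `M_⋆`: the `SU(2,2)`-orbit in the Grassmannian `Gr(2,4)` of the plane
spanned by the first two standard basis vectors. -/
def model : Set (Submodule ℂ C4) :=
  {P | ∃ A ∈ SU22, P = Submodule.span ℂ {A.mulVec ![1, 0, 0, 0], A.mulVec ![0, 1, 0, 0]}}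

/-- The standard affine holomorphic chart of `Gr(2,4)` associated with `A ∈ GL₄(ℂ)`:
the plane spanned by `A(e₁ + w¹e₃ + w²e₄)` and `A(e₂ + w³e₃ + w⁴e₄)`. -/
def grChart (A : GL (Fin 4) ℂ) (w : C4) : Submodule ℂ C4 :=
  Submodule.span ℂ {(A : Matrix (Fin 4) (Fin 4) ℂ).mulVec ![1, 0, w 0, w 1],
    (A : Matrix (Fin 4) (Fin 4) ℂ).mulVec ![0, 1, w 2, w 3]}

/-- Near `p`, the real hypersurface `S` is CR equivalent to an open piece of the homogeneous model
`M_⋆ ⊆ Gr(2,4)`, read in one of the standard charts of the Grassmannian. -/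
def LocallyCREquivalentToModelAt (S : Set C4) (p : C4) : Prop :=
  ∃ (A : GL (Fin 4) ℂ) (w : C4), grChart A w ∈ model ∧
    LocallyCREquivalentAt S p {w' | grChart A w' ∈ model} w

/-! ### The example -/

/-- `x_{j+1} = z^{j+1} + z̄^{j+1}`. -/
def x (j : Fin 4) (z : C4) : ℝ := 2 * (z j).re

/-- `ln (x₁ x₂ / x₃²)`. -/
def logTerm (z : C4) : ℝ := Real.log (x 0 z * x 1 z / x 2 z ^ 2)

/-- The hypersurface `z⁴ + z̄⁴ + (z³ + z̄³) ln ((z¹ + z̄¹)(z² + z̄²)/(z³ + z̄³)²) = 0`, where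
`z¹, z², z³` have positive real parts. -/
def exampleM : Set C4 :=
  {z | 0 < x 0 z ∧ 0 < x 1 z ∧ 0 < x 2 z ∧ x 3 z + x 2 z * logTerm z = 0}

/-- The coordinate 1-form `dz^{j+1}`. -/
def dz (j : Fin 4) : C4 →L[ℝ] ℂ := ContinuousLinearMap.proj j

/-- `√(z³ + z̄³)` as a complex number. -/
def sqrt3 (z : C4) : ℂ := (Real.sqrt (x 2 z) : ℂ)

/-- The explicit coframing `η⁰, η¹, η², η³` of the example. -/
def exampleCoframe : Fin 4 → C4 → C4 →L[ℝ] ℂ :=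
  ![fun z =>
      (2 * Complex.I * (x 2 z / x 0 z : ℂ)) • dz 0
      + (2 * Complex.I * (x 2 z / x 1 z : ℂ)) • dz 1
      + (2 * Complex.I * ((logTerm z : ℂ) - 2)) • dz 2
      + (2 * Complex.I) • dz 3,
    fun z =>
      ((1 - Complex.I) * sqrt3 z / (2 * x 0 z)) • dz 0
      - ((1 - Complex.I) * sqrt3 z / (2 * x 1 z)) • dz 1
      - ((1 + Complex.I) / (2 * sqrt3 z) * logTerm z) • dz 2
      - ((1 + Complex.I) / (2 * sqrt3 z)) • dz 3,
    fun z =>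
      ((1 + Complex.I) * sqrt3 z / (2 * x 0 z)) • dz 0
      - ((1 + Complex.I) * sqrt3 z / (2 * x 1 z)) • dz 1
      - ((1 - Complex.I) / (2 * sqrt3 z) * logTerm z) • dz 2
      - ((1 - Complex.I) / (2 * sqrt3 z)) • dz 3,
    fun z =>
      (1 / (8 * x 0 z) : ℂ) • dz 0
      + (1 / (8 * x 1 z) : ℂ) • dz 1
      + ((6 + (logTerm z : ℂ)) / (8 * x 2 z)) • dz 2
      + (1 / (8 * x 2 z) : ℂ) • dz 3]

/-- `F¹ = -(1 - i) / (4 √(z³ + z̄³))`. -/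
def exampleF1 (z : C4) : ℂ := -(1 - Complex.I) / (4 * sqrt3 z)

/-- `F² = -(1 + i) / (4 √(z³ + z̄³))`. -/
def exampleF2 (z : C4) : ℂ := -(1 + Complex.I) / (4 * sqrt3 z)

end CR7

end

/-!
The example is the tube `ρ = 0` over the graph of a function homogeneous of degree one in
`x₁, x₂, x₃`. Its CR structure is read off the holomorphic differential `p = ∑ ρ_j dz^j` and the
Hessian `hessC` of `ρ`, which is `-x₃` times the sum of the squares of the forms
`th1 = dz¹/x₁ - dz³/x₃` and `th2 = dz²/x₂ - dz³/x₃`.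

*The CR structure.* A complexified vector is in `ℂD` when `p` kills both its components, and
differentiating `p(B) = 0` expresses the bracket of two fields in `ℂD`, modulo `ℂD`, through the
Hessian (`pC_bracket`). Hence the structure is integrable, the Levi form is a multiple of
`|th1|² + |th2|²`, and its kernel is spanned by the Euler field `E = ∑ x_j ∂/∂z^j`. As
`[E, Ȳ] = Ȳ - Y` for the fields `Y` of a suitable frame, `ad_E` is minus complex conjugation on
`H/K` (`th_of_representsAd`): this gives 2-nondegeneracy and conformal unitarity.

*The coframing.* In terms of `th1`, `th2`, `kap = dz³/x₃` and `p` the forms `η^j` and their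
differentials are short expressions, and the structure equations hold with explicit connection
forms (`structure_equation0` to `structure_equation3`). The coefficients `F¹`, `F²` are unique
because they are the parts of `dη¹(u, v)` and `dη²(v, u)` that are conjugate linear in the first
vector, for `u`, `v` dual to `η¹`, `η²` (`eq_of_hasFundamentalCoefficients`).

*Inequivalence to the model.* A local CR equivalence provides CR maps `u₁`, `u₂` on a piece of `M`
such that `u₁(z)`, `u₂(z)` is a basis of a plane of the model (`IsModelFrame`). The Hermitian form
restricted to such a plane is degenerate, with radical spanned by `N = u₁ + t u₂` if `u₂` is not
null, and `V ↦ h(V N, N)` annihilates `ℂD`, so that it gives the Levi form (`herm_bracket_radVec`).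
The fields `Y₁`, `Y₂` of the frame are Levi orthogonal and of equal length. Together with
definiteness and `[E, Ȳⱼ] = Ȳⱼ - Yⱼ` this implies `(Ȳ₁t)² + (Ȳ₂t)² = 0`, and `Ȳ₁t` does not vanish
since the map to the Grassmannian is immersive. So `Ȳ₁t + w Ȳ₂t = 0` with `w = ±i`. One more
differentiation and the brackets `[Yᵢ, Ȳⱼ]` give `Ȳ₁t = Ȳ₂t`, a contradiction
(`IsModelFrame.not_mem`).
-/

open scoped ContDiff Topology

namespace CR7

/-! ### Differential calculus along complexified tangent vectors -/

/-- The derivative of a complex valued function along a complexified tangent vector. -/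
noncomputable def dC (X : CVec) (f : C4 → ℂ) (z : C4) : ℂ := evalC (fderiv ℝ f z) X

/-- The componentwise derivative of a `ℂ⁴`-valued function along a complexified tangent vector. -/
noncomputable def dV (X : CVec) (F : C4 → C4) (z : C4) : C4 := fun i => dC X (fun y => F y i) z

lemma cRe_apply (X : CVec) (j : Fin 4) : cRe X j = (1 / 2 : ℂ) * (X.1 j + star (X.2 j)) := rfl

lemma cIm_apply (X : CVec) (j : Fin 4) : cIm X j = (-Complex.I / 2) * (X.1 j - star (X.2 j)) := rfl

lemma cRe_add (X Y : CVec) : cRe (X + Y) = cRe X + cRe Y := by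
  ext j; simp [cRe_apply]; ring

lemma cIm_add (X Y : CVec) : cIm (X + Y) = cIm X + cIm Y := by
  ext j; simp [cIm_apply]; ring

lemma cRe_real_smul (r : ℝ) (X : CVec) : cRe ((r : ℂ) • X) = r • cRe X := by
  ext j; simp [cRe_apply]; ring

lemma cIm_real_smul (r : ℝ) (X : CVec) : cIm ((r : ℂ) • X) = r • cIm X := by
  ext j; simp [cIm_apply]; ring

lemma cRe_I_smul (X : CVec) : cRe (Complex.I • X) = -cIm X := by
  ext j; simp [cRe_apply, cIm_apply]; ring

lemma cIm_I_smul (X : CVec) : cIm (Complex.I • X) = cRe X := by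
  ext j; simp only [cRe_apply, cIm_apply]; simp; ring_nf; simp; ring

lemma cRe_cConj (X : CVec) : cRe (cConj X) = cRe X := by
  ext j; simp [cRe_apply, cConj]; ring

lemma cIm_cConj (X : CVec) : cIm (cConj X) = -cIm X := by
  ext j; simp [cIm_apply, cConj]; ring

lemma cConj_cConj (X : CVec) : cConj (cConj X) = X := by
  simp [cConj]

lemma evalC_add (α : C4 →L[ℝ] ℂ) (X Y : CVec) : evalC α (X + Y) = evalC α X + evalC α Y := by
  simp only [evalC, cRe_add, cIm_add, map_add]; ring

lemma evalC_smul (α : C4 →L[ℝ] ℂ) (c : ℂ) (X : CVec) : evalC α (c • X) = c * evalC α X := by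
  have h1 : ∀ r : ℝ, evalC α ((r : ℂ) • X) = r * evalC α X := by
    intro r
    simp only [evalC, cRe_real_smul, cIm_real_smul, map_smul, Complex.real_smul]; ring
  have h2 : ∀ Z, evalC α (Complex.I • Z) = Complex.I * evalC α Z := by
    intro Z
    simp only [evalC, cRe_I_smul, cIm_I_smul, map_neg]
    linear_combination -(α (cIm Z)) * Complex.I_mul_I
  have h3 : evalC α (Complex.I • (c.im : ℂ) • X) = Complex.I * ((c.im : ℂ) * evalC α X) := by
    rw [h2, h1]
  have h4 : c • X = (c.re : ℂ) • X + Complex.I • (c.im : ℂ) • X := by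
    rw [smul_smul, ← add_smul, mul_comm Complex.I, Complex.re_add_im]
  rw [h4, evalC_add, h1, h3]
  conv_rhs => rw [← Complex.re_add_im c]
  ring

lemma evalC_form_add (α β : C4 →L[ℝ] ℂ) (X : CVec) :
    evalC (α + β) X = evalC α X + evalC β X := by
  simp only [evalC, add_apply]; ring

lemma evalC_form_smul (c : ℂ) (α : C4 →L[ℝ] ℂ) (X : CVec) : evalC (c • α) X = c * evalC α X := by
  simp only [evalC, smul_apply, smul_eq_mul]; ring

lemma dC_add_vec (X Y : CVec) (f : C4 → ℂ) (z : C4) : dC (X + Y) f z = dC X f z + dC Y f z :=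
  evalC_add _ _ _

lemma dC_smul_vec (c : ℂ) (X : CVec) (f : C4 → ℂ) (z : C4) : dC (c • X) f z = c * dC X f z :=
  evalC_smul _ _ _

lemma dC_neg_vec (X : CVec) (f : C4 → ℂ) (z : C4) : dC (-X) f z = -dC X f z := by
  have := dC_smul_vec (-1) X f z
  simpa using this

lemma dC_sub_vec (X Y : CVec) (f : C4 → ℂ) (z : C4) : dC (X - Y) f z = dC X f z - dC Y f z := by
  rw [sub_eq_add_neg, dC_add_vec, dC_neg_vec, sub_eq_add_neg]

lemma dC_zero_vec (f : C4 → ℂ) (z : C4) : dC 0 f z = 0 := by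
  have := dC_smul_vec 0 0 f z
  simpa using this

lemma dV_add_vec (X Y : CVec) (F : C4 → C4) (z : C4) : dV (X + Y) F z = dV X F z + dV Y F z := by
  ext i; exact dC_add_vec _ _ _ _

lemma dV_smul_vec (c : ℂ) (X : CVec) (F : C4 → C4) (z : C4) : dV (c • X) F z = c • dV X F z := by
  ext i; exact dC_smul_vec _ _ _ _

lemma dV_sub_vec (X Y : CVec) (F : C4 → C4) (z : C4) : dV (X - Y) F z = dV X F z - dV Y F z := by
  ext i; exact dC_sub_vec _ _ _ _

lemma dC_const (X : CVec) (c : ℂ) (z : C4) : dC X (fun _ => c) z = 0 := by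
  simp [dC, evalC]

section Rules

variable {f g : C4 → ℂ} {z : C4}

lemma dC_add (X : CVec) (hf : DifferentiableAt ℝ f z) (hg : DifferentiableAt ℝ g z) :
    dC X (fun y => f y + g y) z = dC X f z + dC X g z := by
  unfold dC
  rw [fderiv_fun_add hf hg, evalC_form_add]

lemma dC_sub (X : CVec) (hf : DifferentiableAt ℝ f z) (hg : DifferentiableAt ℝ g z) :
    dC X (fun y => f y - g y) z = dC X f z - dC X g z := by
  unfold dC
  rw [fderiv_fun_sub hf hg]
  simp only [evalC, sub_apply]; ring

lemma dC_neg (X : CVec) : dC X (fun y => -f y) z = -dC X f z := by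
  unfold dC
  rw [fderiv_fun_neg]
  simp only [evalC, neg_apply]; ring

lemma dC_mul (X : CVec) (hf : DifferentiableAt ℝ f z) (hg : DifferentiableAt ℝ g z) :
    dC X (fun y => f y * g y) z = dC X f z * g z + f z * dC X g z := by
  unfold dC
  rw [fderiv_fun_mul hf hg, evalC_form_add, evalC_form_smul, evalC_form_smul]; ring

lemma dC_const_mul (X : CVec) (c : ℂ) (hf : DifferentiableAt ℝ f z) :
    dC X (fun y => c * f y) z = c * dC X f z := by
  rw [dC_mul X (differentiableAt_const c) hf, dC_const]; ring

lemma dC_inv (X : CVec) (hf : DifferentiableAt ℝ f z) (h0 : f z ≠ 0) :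
    dC X (fun y => (f y)⁻¹) z = -dC X f z / f z ^ 2 := by
  have h1 : dC X (fun y => (f y)⁻¹ * f y) z = 0 := by
    rw [← dC_const X 1 z]
    unfold dC
    rw [Filter.EventuallyEq.fderiv_eq]
    filter_upwards [hf.continuousAt.eventually_ne h0] with y hy
    exact inv_mul_cancel₀ hy
  rw [dC_mul (f := fun y => (f y)⁻¹) X (hf.inv h0) hf] at h1
  field_simp
  field_simp at h1
  linear_combination h1

lemma differentiableAt_star (hf : DifferentiableAt ℝ f z) :
    DifferentiableAt ℝ (fun y => star (f y)) z :=
  (Complex.conjCLE : ℂ →L[ℝ] ℂ).differentiableAt.comp z hf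

lemma dC_star (X : CVec) (hf : DifferentiableAt ℝ f z) :
    dC X (fun y => star (f y)) z = star (dC (cConj X) f z) := by
  have h : fderiv ℝ (fun y => star (f y)) z = (Complex.conjCLE : ℂ →L[ℝ] ℂ).comp (fderiv ℝ f z) :=
    ((Complex.conjCLE : ℂ →L[ℝ] ℂ).hasFDerivAt.comp z hf.hasFDerivAt).fderiv
  unfold dC
  rw [h]
  simp [evalC, cRe_cConj, cIm_cConj]

end Rules

/-- The coordinate function `z^{j+1}` as a real linear form. -/
noncomputable def coordR (j : Fin 4) : C4 →L[ℝ] ℂ := ContinuousLinearMap.proj j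

lemma hasFDerivAt_coord (j : Fin 4) (z : C4) :
    HasFDerivAt (fun y : C4 => y j) (coordR j) z := (coordR j).hasFDerivAt

lemma dC_coord (X : CVec) (j : Fin 4) (z : C4) : dC X (fun y => y j) z = X.1 j := by
  unfold dC
  rw [(hasFDerivAt_coord j z).fderiv]
  simp only [evalC, coordR, ContinuousLinearMap.proj_apply, cRe_apply, cIm_apply]
  linear_combination (-1 / 2 : ℂ) * (X.1 j - star (X.2 j)) * Complex.I_mul_I

lemma differentiableAt_coord (j : Fin 4) (z : C4) : DifferentiableAt ℝ (fun y : C4 => y j) z :=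
  (hasFDerivAt_coord j z).differentiableAt

lemma ofReal_x (j : Fin 4) (z : C4) : (x j z : ℂ) = z j + star (z j) := by
  apply Complex.ext
  · simp [x]; ring
  · simp [x]

lemma differentiableAt_x (j : Fin 4) (z : C4) :
    DifferentiableAt ℝ (fun y : C4 => (x j y : ℂ)) z := by
  simp only [ofReal_x]
  exact (differentiableAt_coord j z).add (differentiableAt_star (differentiableAt_coord j z))

lemma dC_x (X : CVec) (j : Fin 4) (z : C4) : dC X (fun y => (x j y : ℂ)) z = X.1 j + X.2 j := by
  simp only [ofReal_x]
  rw [dC_add X (differentiableAt_coord j z) (differentiableAt_star (differentiableAt_coord j z)),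
    dC_star X (differentiableAt_coord j z), dC_coord, dC_coord]
  simp [cConj]

lemma differentiableAt_fst_apply {X : C4 → CVec} {z : C4} (hX : DifferentiableAt ℝ X z)
    (j : Fin 4) :
    DifferentiableAt ℝ (fun y => (X y).1 j) z :=
  differentiableAt_pi.1 hX.fst j

lemma differentiableAt_snd_apply {X : C4 → CVec} {z : C4} (hX : DifferentiableAt ℝ X z)
    (j : Fin 4) :
    DifferentiableAt ℝ (fun y => (X y).2 j) z :=
  differentiableAt_pi.1 hX.snd j

lemma differentiableAt_conjField {X : C4 → CVec} {z : C4} (hX : DifferentiableAt ℝ X z) :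
    DifferentiableAt ℝ (conjField X) z := by
  refine DifferentiableAt.prodMk ?_ ?_
  · exact differentiableAt_pi.2 fun j => differentiableAt_star (differentiableAt_snd_apply hX j)
  · exact differentiableAt_pi.2 fun j => differentiableAt_star (differentiableAt_fst_apply hX j)

lemma cderiv_fst {X : C4 → CVec} {z : C4} (hX : DifferentiableAt ℝ X z) (V : CVec) (j : Fin 4) :
    (cderiv V X z).1 j = dC V (fun y => (X y).1 j) z := by
  have h : ∀ v, fderiv ℝ (fun y => (X y).1 j) z v = (fderiv ℝ X z v).1 j := by
    intro v
    have := (hasFDerivAt_pi'.1 hX.hasFDerivAt.fst j).fderiv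
    rw [this]; rfl
  simp [cderiv, dC, evalC, h]

lemma cderiv_snd {X : C4 → CVec} {z : C4} (hX : DifferentiableAt ℝ X z) (V : CVec) (j : Fin 4) :
    (cderiv V X z).2 j = dC V (fun y => (X y).2 j) z := by
  have h : ∀ v, fderiv ℝ (fun y => (X y).2 j) z v = (fderiv ℝ X z v).2 j := by
    intro v
    have := (hasFDerivAt_pi'.1 hX.hasFDerivAt.snd j).fderiv
    rw [this]; rfl
  simp [cderiv, dC, evalC, h]

lemma bracket_fst {X Y : C4 → CVec} {z : C4} (hX : DifferentiableAt ℝ X z)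
    (hY : DifferentiableAt ℝ Y z) (j : Fin 4) :
    (bracket X Y z).1 j =
      dC (X z) (fun y => (Y y).1 j) z - dC (Y z) (fun y => (X y).1 j) z := by
  simp [bracket, cderiv_fst hX, cderiv_fst hY]

lemma bracket_snd {X Y : C4 → CVec} {z : C4} (hX : DifferentiableAt ℝ X z)
    (hY : DifferentiableAt ℝ Y z) (j : Fin 4) :
    (bracket X Y z).2 j =
      dC (X z) (fun y => (Y y).2 j) z - dC (Y z) (fun y => (X y).2 j) z := by
  simp [bracket, cderiv_snd hX, cderiv_snd hY]

/-- `f` is differentiable at `z` and its derivative along the complexified vector `X` is `d`. -/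
def HasDC (X : CVec) (f : C4 → ℂ) (z : C4) (d : ℂ) : Prop :=
  DifferentiableAt ℝ f z ∧ dC X f z = d

namespace HasDC

variable {X : CVec} {f g : C4 → ℂ} {z : C4} {a b : ℂ}

lemma of_differentiableAt (hf : DifferentiableAt ℝ f z) : HasDC X f z (dC X f z) := ⟨hf, rfl⟩

lemma const (c : ℂ) : HasDC X (fun _ => c) z 0 := ⟨differentiableAt_const c, dC_const X c z⟩

lemma add (hf : HasDC X f z a) (hg : HasDC X g z b) : HasDC X (fun y => f y + g y) z (a + b) :=
  ⟨hf.1.fun_add hg.1, by rw [dC_add X hf.1 hg.1, hf.2, hg.2]⟩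

lemma sub (hf : HasDC X f z a) (hg : HasDC X g z b) : HasDC X (fun y => f y - g y) z (a - b) :=
  ⟨hf.1.fun_sub hg.1, by rw [dC_sub X hf.1 hg.1, hf.2, hg.2]⟩

lemma mul (hf : HasDC X f z a) (hg : HasDC X g z b) :
    HasDC X (fun y => f y * g y) z (a * g z + f z * b) :=
  ⟨hf.1.fun_mul hg.1, by rw [dC_mul X hf.1 hg.1, hf.2, hg.2]⟩

lemma const_mul (c : ℂ) (hf : HasDC X f z a) : HasDC X (fun y => c * f y) z (c * a) :=
  ⟨hf.1.const_mul c, by rw [dC_const_mul X c hf.1, hf.2]⟩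

lemma inv (hf : HasDC X f z a) (h0 : f z ≠ 0) :
    HasDC X (fun y => (f y)⁻¹) z (-a / f z ^ 2) :=
  ⟨hf.1.fun_inv h0, by rw [dC_inv X hf.1 h0, hf.2]⟩

lemma div (hf : HasDC X f z a) (hg : HasDC X g z b) (h0 : g z ≠ 0) :
    HasDC X (fun y => f y / g y) z ((a * g z - f z * b) / g z ^ 2) := by
  simp only [div_eq_mul_inv (f _) (g _)]
  obtain ⟨h1, h2⟩ := hf.mul (hg.inv h0)
  refine ⟨h1, h2.trans ?_⟩
  field_simp
  ring

lemma star (hf : HasDC (cConj X) f z a) : HasDC X (fun y => star (f y)) z (star a) :=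
  ⟨differentiableAt_star hf.1, by rw [dC_star X hf.1, hf.2]⟩

lemma x (j : Fin 4) : HasDC X (fun y => (CR7.x j y : ℂ)) z (X.1 j + X.2 j) :=
  ⟨differentiableAt_x j z, dC_x X j z⟩

end HasDC

/-- The product rule for the real derivative of the function `X f`, where `X` is a vector field:
a second derivative of `f` plus the derivative of `f` along the derivative of `X`. -/
lemma fderiv_dC_apply {f : C4 → ℂ} {X : C4 → CVec} {z : C4}
    (hf : DifferentiableAt ℝ (fderiv ℝ f) z) (hX : DifferentiableAt ℝ X z) (v : C4) :
    fderiv ℝ (fun y => dC (X y) f y) z v =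
      evalC (fderiv ℝ (fderiv ℝ f) z v) (X z) + evalC (fderiv ℝ f z) (fderiv ℝ X z v) := by
  have hRe : HasFDerivAt (fun y => cRe (X y))
      ((1 / 2 : ℂ) • ((ContinuousLinearMap.fst ℝ C4 C4).comp (fderiv ℝ X z) +
        ((starL' ℝ : C4 ≃L[ℝ] C4) : C4 →L[ℝ] C4).comp
          ((ContinuousLinearMap.snd ℝ C4 C4).comp (fderiv ℝ X z)))) z := by
    have h2 := ((starL' ℝ : C4 ≃L[ℝ] C4) : C4 →L[ℝ] C4).hasFDerivAt.comp z hX.hasFDerivAt.snd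
    exact (hX.hasFDerivAt.fst.add h2).const_smul (1 / 2 : ℂ)
  have hIm : HasFDerivAt (fun y => cIm (X y))
      ((-Complex.I / 2 : ℂ) • ((ContinuousLinearMap.fst ℝ C4 C4).comp (fderiv ℝ X z) -
        ((starL' ℝ : C4 ≃L[ℝ] C4) : C4 →L[ℝ] C4).comp
          ((ContinuousLinearMap.snd ℝ C4 C4).comp (fderiv ℝ X z)))) z := by
    have h2 := ((starL' ℝ : C4 ≃L[ℝ] C4) : C4 →L[ℝ] C4).hasFDerivAt.comp z hX.hasFDerivAt.snd
    exact (hX.hasFDerivAt.fst.sub h2).const_smul (-Complex.I / 2 : ℂ)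
  have h := (hf.hasFDerivAt.clm_apply hRe).add
    ((hf.hasFDerivAt.clm_apply hIm).const_mul Complex.I)
  have h' : (fun y => dC (X y) f y) =
      fun y => fderiv ℝ f y (cRe (X y)) + Complex.I * fderiv ℝ f y (cIm (X y)) := rfl
  rw [h']
  erw [h.fderiv]
  simp [evalC, cRe, cIm]
  ring

lemma differentiableAt_dC {f : C4 → ℂ} {X : C4 → CVec} {z : C4}
    (hf : DifferentiableAt ℝ (fderiv ℝ f) z) (hX : DifferentiableAt ℝ X z) :
    DifferentiableAt ℝ (fun y => dC (X y) f y) z := by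
  have hs : DifferentiableAt ℝ (fun y => star (X y).2) z :=
    ((starL' ℝ : C4 ≃L[ℝ] C4) : C4 →L[ℝ] C4).differentiableAt.comp z hX.snd
  have hRe : DifferentiableAt ℝ (fun y => cRe (X y)) z := (hX.fst.add hs).const_smul (1 / 2 : ℂ)
  have hIm : DifferentiableAt ℝ (fun y => cIm (X y)) z :=
    (hX.fst.sub hs).const_smul (-Complex.I / 2 : ℂ)
  exact (hf.clm_apply hRe).add ((hf.clm_apply hIm).const_mul Complex.I)

/-- The bracket of vector fields is the commutator of the corresponding derivations. -/
lemma dC_bracket {f : C4 → ℂ} {X Y : C4 → CVec} {z : C4} (hf : ContDiffAt ℝ ∞ f z)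
    (hX : DifferentiableAt ℝ X z) (hY : DifferentiableAt ℝ Y z) :
    dC (bracket X Y z) f z =
      dC (X z) (fun y => dC (Y y) f y) z - dC (Y z) (fun y => dC (X y) f y) z := by
  have hf' : DifferentiableAt ℝ (fderiv ℝ f) z :=
    (hf.fderiv_right (m := ∞) (by simp)).differentiableAt (by simp)
  have hsymm : IsSymmSndFDerivAt ℝ f z :=
    (hf.of_le (m := 2)
      (show ((2 : ℕ∞) : ℕ∞ω) ≤ ∞ from WithTop.coe_le_coe.2 le_top)).isSymmSndFDerivAt (by simp)
  have hs : ∀ v w, fderiv ℝ (fderiv ℝ f) z v w = fderiv ℝ (fderiv ℝ f) z w v := fun v w => hsymm v w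
  have e : ∀ (W : CVec) (Z : C4 → CVec), DifferentiableAt ℝ Z z →
      dC W (fun y => dC (Z y) f y) z =
        evalC (fderiv ℝ (fderiv ℝ f) z (cRe W)) (Z z) +
        Complex.I * evalC (fderiv ℝ (fderiv ℝ f) z (cIm W)) (Z z) +
        evalC (fderiv ℝ f z) (cderiv W Z z) := by
    intro W Z hZ
    rw [dC, evalC, fderiv_dC_apply hf' hZ, fderiv_dC_apply hf' hZ, cderiv, evalC_add, evalC_smul]
    ring
  rw [e _ _ hY, e _ _ hX]
  have : evalC (fderiv ℝ f z) (bracket X Y z) =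
      evalC (fderiv ℝ f z) (cderiv (X z) Y z) - evalC (fderiv ℝ f z) (cderiv (Y z) X z) := by
    rw [← dC, ← dC, ← dC, ← dC_sub_vec]; rfl
  rw [dC, this]
  simp only [evalC]
  rw [hs (cRe (X z)) (cRe (Y z)), hs (cRe (X z)) (cIm (Y z)), hs (cIm (X z)) (cRe (Y z)),
    hs (cIm (X z)) (cIm (Y z))]
  ring

/-! ### Tangent vectors and functions vanishing on a set -/

lemma fderiv_eq_zero_of_tangent {V : Type*} [NormedAddCommGroup V] [NormedSpace ℝ V] {S U : Set C4}
    {f : C4 → V} {z v : C4} (hf : DifferentiableAt ℝ f z) (hU : IsOpen U) (hz : z ∈ U)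
    (h0 : ∀ y ∈ S ∩ U, f y = 0) (hv : v ∈ tangentSpace S z) : fderiv ℝ f z v = 0 := by
  obtain ⟨δ, hδ, c, hc, hc0, hcS, hcv⟩ := hv
  have hmem : Set.Ioo (-δ) δ ∈ 𝓝 (0 : ℝ) := Ioo_mem_nhds (by linarith) hδ
  have hcd : DifferentiableAt ℝ c 0 := (hc.contDiffAt hmem).differentiableAt (by simp)
  have h1 : HasDerivAt (fun t => f (c t)) (fderiv ℝ f z v) 0 := by
    have h2 : HasFDerivAt f (fderiv ℝ f z) (c 0) := by rw [hc0]; exact hf.hasFDerivAt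
    have := h2.comp_hasDerivAt 0 hcd.hasDerivAt
    rwa [hcv] at this
  have h3 : (fun t => f (c t)) =ᶠ[𝓝 0] fun _ => 0 := by
    have h4 : ∀ᶠ t in 𝓝 (0 : ℝ), c t ∈ U :=
      hcd.continuousAt.eventually (by rw [hc0]; exact hU.mem_nhds hz)
    filter_upwards [hmem, h4] with t ht htU using h0 _ ⟨hcS t ht, htU⟩
  exact h1.unique ((hasDerivAt_const (0 : ℝ) (0 : V)).congr_of_eventuallyEq h3)

/-- A function vanishing along `S` near `z` is annihilated by `ℂD`. -/
lemma dC_eq_zero_of_tangent {S U : Set C4} {f : C4 → ℂ} {z : C4} {X : CVec}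
    (hf : DifferentiableAt ℝ f z) (hU : IsOpen U) (hz : z ∈ U) (h0 : ∀ y ∈ S ∩ U, f y = 0)
    (hX : X ∈ CD S z) : dC X f z = 0 := by
  rw [dC, evalC, fderiv_eq_zero_of_tangent hf hU hz h0 hX.1.1,
    fderiv_eq_zero_of_tangent hf hU hz h0 hX.2.1]
  simp

lemma dC_congr_of_tangent {S U : Set C4} {f g : C4 → ℂ} {z : C4} {X : CVec}
    (hf : DifferentiableAt ℝ f z) (hg : DifferentiableAt ℝ g z) (hU : IsOpen U) (hz : z ∈ U)
    (h0 : ∀ y ∈ S ∩ U, f y = g y) (hX : X ∈ CD S z) : dC X f z = dC X g z := by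
  have := dC_eq_zero_of_tangent (f := fun y => f y - g y) (hf.sub hg) hU hz
    (fun y hy => sub_eq_zero.2 (h0 y hy)) hX
  rw [dC_sub X hf hg] at this
  exact sub_eq_zero.1 this

/-! ### The defining function of the example -/

/-- The open set where `x₁, x₂, x₃` are positive. -/
def octant : Set C4 := {z | 0 < x 0 z ∧ 0 < x 1 z ∧ 0 < x 2 z}

/-- The defining function `x₄ + x₃ L` of the example. -/
noncomputable def rho (z : C4) : ℝ := x 3 z + x 2 z * logTerm z

/-- The complex linear form `∑ ρ_j v^j`, where `ρ_j = ∂ρ/∂x_j`; the real differential of `ρ`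
is twice its real part. -/
noncomputable def pC (z v : C4) : ℂ :=
  (x 2 z / x 0 z : ℂ) * v 0 + (x 2 z / x 1 z : ℂ) * v 1 + ((logTerm z : ℂ) - 2) * v 2 + v 3

/-- The form `dz¹/x₁ - dz³/x₃`. -/
noncomputable def th1 (z a : C4) : ℂ := a 0 / x 0 z - a 2 / x 2 z

/-- The form `dz²/x₂ - dz³/x₃`. -/
noncomputable def th2 (z a : C4) : ℂ := a 1 / x 1 z - a 2 / x 2 z

/-- The complex bilinear Hessian `∑ ρ_{jk} a^j b^k` of the defining function. -/
noncomputable def hessC (z a b : C4) : ℂ := -(x 2 z : ℂ) * (th1 z a * th1 z b + th2 z a * th2 z b)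

lemma continuous_x (j : Fin 4) : Continuous (x j) := by
  unfold x; fun_prop

lemma isOpen_octant : IsOpen octant :=
  (isOpen_lt continuous_const (continuous_x 0)).inter
    ((isOpen_lt continuous_const (continuous_x 1)).inter
      (isOpen_lt continuous_const (continuous_x 2)))

lemma mem_exampleM_iff (z : C4) : z ∈ exampleM ↔ z ∈ octant ∧ rho z = 0 := by
  simp [exampleM, octant, rho, and_assoc]

lemma octant_of_mem {z : C4} (hz : z ∈ exampleM) : z ∈ octant := ((mem_exampleM_iff z).1 hz).1

lemma x_ne_zero {z : C4} (hz : z ∈ octant) :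
    (x 0 z : ℂ) ≠ 0 ∧ (x 1 z : ℂ) ≠ 0 ∧ (x 2 z : ℂ) ≠ 0 :=
  ⟨by exact_mod_cast hz.1.ne', by exact_mod_cast hz.2.1.ne', by exact_mod_cast hz.2.2.ne'⟩

/-- The coordinate `x_{j+1}` as a real linear form. -/
noncomputable def xR (j : Fin 4) : C4 →L[ℝ] ℝ :=
  (2 : ℝ) • Complex.reCLM.comp (coordR j)

lemma xR_apply (j : Fin 4) (v : C4) : xR j v = 2 * (v j).re := by simp [xR, coordR]

lemma hasFDerivAt_x (j : Fin 4) (z : C4) : HasFDerivAt (x j) (xR j) z := by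
  have h : x j = xR j := by ext v; rw [xR_apply]; rfl
  rw [h]; exact (xR j).hasFDerivAt

lemma contDiff_x (j : Fin 4) : ContDiff ℝ ∞ (x j) := by
  have h : x j = xR j := by ext v; rw [xR_apply]; rfl
  rw [h]; exact (xR j).contDiff

lemma logTerm_eq {z : C4} (hz : z ∈ octant) :
    logTerm z = Real.log (x 0 z) + Real.log (x 1 z) - 2 * Real.log (x 2 z) := by
  obtain ⟨h0, h1, h2⟩ := hz
  unfold logTerm
  rw [Real.log_div (mul_pos h0 h1).ne' (pow_pos h2 2).ne', Real.log_mul h0.ne' h1.ne', Real.log_pow]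
  push_cast; ring

lemma logTerm_eventuallyEq {z : C4} (hz : z ∈ octant) : logTerm =ᶠ[𝓝 z]
    fun z => Real.log (x 0 z) + Real.log (x 1 z) - 2 * Real.log (x 2 z) := by
  filter_upwards [isOpen_octant.mem_nhds hz] with y hy using logTerm_eq hy

lemma hasFDerivAt_logTerm {z : C4} (hz : z ∈ octant) :
    HasFDerivAt logTerm ((x 0 z)⁻¹ • xR 0 + (x 1 z)⁻¹ • xR 1 - (2 : ℝ) • ((x 2 z)⁻¹ • xR 2)) z :=
  ((((hasFDerivAt_x 0 z).log hz.1.ne').add ((hasFDerivAt_x 1 z).log hz.2.1.ne')).sub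
    (((hasFDerivAt_x 2 z).log hz.2.2.ne').const_mul 2)).congr_of_eventuallyEq
      (logTerm_eventuallyEq hz)

lemma contDiffOn_logTerm : ContDiffOn ℝ ∞ logTerm octant := by
  intro z hz
  refine ContDiffAt.contDiffWithinAt ?_
  refine ContDiffAt.congr_of_eventuallyEq ?_ (logTerm_eventuallyEq hz)
  exact (((contDiff_x 0).contDiffAt.log hz.1.ne').add
    ((contDiff_x 1).contDiffAt.log hz.2.1.ne')).sub
    (contDiffAt_const.mul ((contDiff_x 2).contDiffAt.log hz.2.2.ne'))

lemma contDiffOn_rho : ContDiffOn ℝ ∞ rho octant :=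
  (contDiff_x 3).contDiffOn.add ((contDiff_x 2).contDiffOn.mul contDiffOn_logTerm)

lemma hasFDerivAt_rho {z : C4} (hz : z ∈ octant) : HasFDerivAt rho
    (xR 3 + (x 2 z • ((x 0 z)⁻¹ • xR 0 + (x 1 z)⁻¹ • xR 1 - (2 : ℝ) • ((x 2 z)⁻¹ • xR 2)) +
      logTerm z • xR 2)) z :=
  (hasFDerivAt_x 3 z).add ((hasFDerivAt_x 2 z).mul (hasFDerivAt_logTerm hz))

lemma fderiv_rho {z : C4} (hz : z ∈ octant) (v : C4) : fderiv ℝ rho z v = 2 * (pC z v).re := by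
  rw [(hasFDerivAt_rho hz).fderiv]
  have h2 := hz.2.2.ne'
  simp only [add_apply, sub_apply, smul_apply, xR_apply, smul_eq_mul, pC]
  have e : pC z v = ((x 2 z / x 0 z : ℝ) : ℂ) * v 0 + ((x 2 z / x 1 z : ℝ) : ℂ) * v 1 +
      ((logTerm z - 2 : ℝ) : ℂ) * v 2 + v 3 := by simp [pC]
  rw [← pC, e]
  simp only [Complex.add_re, Complex.re_ofReal_mul]
  field_simp
  ring

lemma pC_add (z v w : C4) : pC z (v + w) = pC z v + pC z w := by simp [pC]; ring

lemma pC_smul (z : C4) (c : ℂ) (v : C4) : pC z (c • v) = c * pC z v := by simp [pC]; ring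

lemma pC_sub (z v w : C4) : pC z (v - w) = pC z v - pC z w := by simp [pC]; ring

lemma pC_star (z v : C4) : pC z (star v) = star (pC z v) := by simp [pC]

/-- The tangent space of the example is the kernel of the real differential of `ρ`. -/
lemma mem_tangentSpace_iff {z : C4} (hz : z ∈ exampleM) (v : C4) :
    v ∈ tangentSpace exampleM z ↔ (pC z v).re = 0 := by
  have hzo := octant_of_mem hz
  have hρ := contDiffOn_rho.contDiffAt (isOpen_octant.mem_nhds hzo)
  constructor
  · intro hv
    have h := fderiv_eq_zero_of_tangent (hρ.differentiableAt (by simp)) isOpen_octant hzo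
      (fun y hy => ((mem_exampleM_iff y).1 hy.1).2) hv
    rw [fderiv_rho hzo] at h
    linarith
  · intro hv
    -- Correct the straight line in the direction of `Re z⁴`, over which `M` is a graph.
    let g : ℝ → C4 := fun t => z + t • v
    let c : ℝ → C4 := fun t => g t - (rho (g t) / 2 : ℝ) • (Pi.single 3 1 : C4)
    have hg : ContDiff ℝ ∞ g := contDiff_const.add (contDiff_id.smul contDiff_const)
    have hg0 : g 0 = z := by simp [g]
    have hgo : ∀ᶠ t in 𝓝 (0 : ℝ), g t ∈ octant :=
      hg.continuous.continuousAt.eventually (by rw [hg0]; exact isOpen_octant.mem_nhds hzo)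
    obtain ⟨δ, hδ, hball⟩ := Metric.eventually_nhds_iff.1 hgo
    have hI : ∀ t ∈ Set.Ioo (-δ) δ, g t ∈ octant := fun t ht =>
      hball (by rw [Real.dist_eq, sub_zero]; exact abs_lt.2 ht)
    have hcx : ∀ t, ∀ j : Fin 4, j ≠ 3 → x j (c t) = x j (g t) := by
      intro t j hj
      simp [x, c, hj]
    have hc3 : ∀ t, x 3 (c t) = x 3 (g t) - rho (g t) := by
      intro t
      simp [x, c]; ring
    refine ⟨δ, hδ, c, ?_, ?_, ?_, ?_⟩
    · exact hg.contDiffOn.sub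
        (((contDiffOn_rho.comp hg.contDiffOn hI).div_const 2).smul contDiffOn_const)
    · simp [c, hg0, ((mem_exampleM_iff z).1 hz).2]
    · intro t ht
      have ho := hI t ht
      have hL : logTerm (c t) = logTerm (g t) := by
        simp [logTerm, hcx t 0 (by decide), hcx t 1 (by decide), hcx t 2 (by decide)]
      refine (mem_exampleM_iff _).2 ⟨?_, ?_⟩
      · simpa [octant, hcx t 0 (by decide), hcx t 1 (by decide), hcx t 2 (by decide)] using ho
      · rw [rho, hc3, hcx t 2 (by decide), hL, rho]; ring
    · have hgd : HasDerivAt g v 0 := by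
        have := ((hasDerivAt_id (0 : ℝ)).smul_const v).const_add z
        rw [one_smul] at this
        exact this
      have hρ' : HasFDerivAt rho (fderiv ℝ rho z) (g 0) := by
        rw [hg0]; exact (hρ.differentiableAt (by simp)).hasFDerivAt
      have h1 : HasDerivAt (fun t => rho (g t)) 0 0 := by
        have := hρ'.comp_hasDerivAt 0 hgd
        rwa [fderiv_rho hzo, hv, mul_zero] at this
      have h2 := hgd.sub ((h1.div_const 2).smul_const (Pi.single 3 1 : C4))
      refine h2.deriv.trans ?_
      simp

lemma mem_D_iff {z : C4} (hz : z ∈ exampleM) (v : C4) : v ∈ D exampleM z ↔ pC z v = 0 := by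
  rw [D, Set.mem_ofPred_eq, mem_tangentSpace_iff hz, mem_tangentSpace_iff hz, pC_smul]
  simp [Complex.ext_iff]

lemma pC_cRe (z : C4) (X : CVec) : pC z (cRe X) = 1 / 2 * (pC z X.1 + star (pC z X.2)) := by
  rw [cRe, pC_smul, pC_add, pC_star]

lemma pC_cIm (z : C4) (X : CVec) :
    pC z (cIm X) = -Complex.I / 2 * (pC z X.1 - star (pC z X.2)) := by
  rw [cIm, pC_smul, pC_sub, pC_star]

lemma mem_CD_iff {z : C4} (hz : z ∈ exampleM) (X : CVec) :
    X ∈ CD exampleM z ↔ pC z X.1 = 0 ∧ pC z X.2 = 0 := by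
  rw [CD, Set.mem_ofPred_eq, mem_D_iff hz, mem_D_iff hz, pC_cRe, pC_cIm]
  constructor
  · rintro ⟨h1, h2⟩
    have h3 : pC z X.1 - star (pC z X.2) = 0 := by
      simpa [Complex.I_ne_zero] using h2
    have h4 : pC z X.1 + star (pC z X.2) = 0 := by simpa using h1
    have h5 : pC z X.1 = 0 := by linear_combination (h3 + h4) / 2
    rw [h5] at h4
    exact ⟨h5, by simpa using h4⟩
  · rintro ⟨h1, h2⟩
    simp [h1, h2]

lemma mem_H_iff {z : C4} (hz : z ∈ exampleM) (X : CVec) :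
    X ∈ H exampleM z ↔ pC z X.1 = 0 ∧ X.2 = 0 := by
  rw [H, Set.mem_ofPred_eq, mem_CD_iff hz]
  constructor
  · rintro ⟨⟨h1, -⟩, h2⟩; exact ⟨h1, h2⟩
  · rintro ⟨h1, h2⟩; exact ⟨⟨h1, by simp [h2, pC]⟩, h2⟩

lemma mem_Hbar_iff {z : C4} (hz : z ∈ exampleM) (X : CVec) :
    X ∈ Hbar exampleM z ↔ pC z X.2 = 0 ∧ X.1 = 0 := by
  rw [Hbar, Set.mem_ofPred_eq, mem_CD_iff hz]
  constructor
  · rintro ⟨⟨-, h1⟩, h2⟩; exact ⟨h1, h2⟩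
  · rintro ⟨h1, h2⟩; exact ⟨⟨by simp [h2, pC], h1⟩, h2⟩

lemma isRealHypersurface_exampleM : IsRealHypersurface exampleM := by
  intro z hz
  refine ⟨octant, isOpen_octant, octant_of_mem hz, rho, contDiffOn_rho, ?_, ?_⟩
  · intro y hy h0
    have h := fderiv_rho hy (Pi.single 3 1)
    rw [h0] at h
    simp [pC] at h
  · intro y hy
    rw [mem_exampleM_iff]
    exact ⟨fun h => h.2, fun h => ⟨hy, h⟩⟩

/-! ### Derivatives of the coefficients of the defining form -/

lemma ofReal_differentiableAt {f : C4 → ℝ} {z : C4} (hf : DifferentiableAt ℝ f z) :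
    DifferentiableAt ℝ (fun y => (f y : ℂ)) z :=
  Complex.ofRealCLM.differentiableAt.comp z hf

lemma differentiableAt_logTerm {z : C4} (hz : z ∈ octant) :
    DifferentiableAt ℝ (fun y => (logTerm y : ℂ)) z :=
  ofReal_differentiableAt (hasFDerivAt_logTerm hz).differentiableAt

lemma dC_logTerm {z : C4} (hz : z ∈ octant) (X : CVec) :
    dC X (fun y => (logTerm y : ℂ)) z =
      (X.1 0 + X.2 0) / x 0 z + (X.1 1 + X.2 1) / x 1 z - 2 * ((X.1 2 + X.2 2) / x 2 z) := by
  have h := Complex.ofRealCLM.hasFDerivAt.comp z (hasFDerivAt_logTerm hz)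
  have h2 : ∀ j, evalC (Complex.ofRealCLM.comp (xR j)) X = X.1 j + X.2 j := by
    intro j
    rw [← dC_x X j z, dC]
    erw [(Complex.ofRealCLM.hasFDerivAt.comp z (hasFDerivAt_x j z)).fderiv]
  rw [dC]
  erw [h.fderiv]
  simp only [← h2, evalC, ContinuousLinearMap.comp_apply, add_apply, sub_apply, smul_apply,
    Complex.ofRealCLM_apply, smul_eq_mul]
  push_cast
  ring

/-- The derivative of `y ↦ p_y(G(y))`: the Hessian term plus the term from `G`. -/
lemma hasDC_pC {z : C4} (hz : z ∈ octant) {G : C4 → C4}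
    (hG : ∀ j, DifferentiableAt ℝ (fun y => G y j) z) (X : CVec) :
    HasDC X (fun y => pC y (G y)) z (hessC z (X.1 + X.2) (G z) + pC z (dV X G z)) := by
  obtain ⟨h0, h1, h2⟩ := x_ne_zero hz
  have hG' := fun j => HasDC.of_differentiableAt (X := X) (hG j)
  have hL : HasDC X (fun y => (logTerm y : ℂ)) z _ := ⟨differentiableAt_logTerm hz, dC_logTerm hz X⟩
  obtain ⟨k1, k2⟩ := (((((HasDC.x 2).div (HasDC.x 0) h0).mul (hG' 0)).add
    (((HasDC.x 2).div (HasDC.x 1) h1).mul (hG' 1))).add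
    ((hL.sub (HasDC.const 2)).mul (hG' 2))).add (hG' 3)
  refine ⟨k1, k2.trans ?_⟩
  simp only [hessC, th1, th2, dV, pC, Pi.add_apply]
  field_simp
  ring

/-- A vector field with values in `ℂD` along `S` near `z`, differentiable at `z`. -/
def IsCDField (S : Set C4) (z : C4) (X : C4 → CVec) : Prop :=
  DifferentiableAt ℝ X z ∧ ∃ U : Set C4, IsOpen U ∧ z ∈ U ∧ ∀ y ∈ S ∩ U, X y ∈ CD S y

lemma IsCRField.isCDField {S : Set C4} {z : C4} {X : C4 → CVec} (h : IsCRField S z X) :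
    IsCDField S z X := by
  obtain ⟨U, hU, hz, hs, hX⟩ := h
  exact ⟨(hs.contDiffAt (hU.mem_nhds hz)).differentiableAt (by simp), U, hU, hz,
    fun y hy => (hX y hy).1⟩

lemma CD_cConj {z : C4} {X : CVec} (hX : X ∈ CD exampleM z) (hz : z ∈ exampleM) :
    cConj X ∈ CD exampleM z := by
  rw [mem_CD_iff hz] at hX ⊢
  simp [cConj, pC_star, hX.1, hX.2]

lemma IsCDField.conj {z : C4} {X : C4 → CVec} (h : IsCDField exampleM z X) :
    IsCDField exampleM z (conjField X) := by
  obtain ⟨hd, U, hU, hz, hX⟩ := h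
  exact ⟨differentiableAt_conjField hd, U, hU, hz, fun y hy => CD_cConj (hX y hy) hy.1⟩

lemma IsCDField.mem {S : Set C4} {z : C4} {X : C4 → CVec} (h : IsCDField S z X) (hz : z ∈ S) :
    X z ∈ CD S z := by
  obtain ⟨hd, U, hU, hzU, hX⟩ := h
  exact hX z ⟨hz, hzU⟩

/-- For a field `B` in `ℂD`, differentiating `p(B) = 0` along `ℂD`. -/
lemma pC_cderiv {z : C4} (hz : z ∈ exampleM) {B : C4 → CVec} (hB : IsCDField exampleM z B)
    {X : CVec} (hX : X ∈ CD exampleM z) :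
    pC z (cderiv X B z).1 = -hessC z (X.1 + X.2) (B z).1 ∧
      pC z (cderiv X B z).2 = -hessC z (X.1 + X.2) (B z).2 := by
  obtain ⟨hd, U, hU, hzU, hBU⟩ := hB
  have hzo := octant_of_mem hz
  have g1 := fun j => differentiableAt_fst_apply hd j
  have g2 := fun j => differentiableAt_snd_apply hd j
  have k1 := dC_eq_zero_of_tangent (hasDC_pC hzo g1 X).1 hU hzU
    (fun y hy => ((mem_CD_iff hy.1 _).1 (hBU y hy)).1) hX
  have k2 := dC_eq_zero_of_tangent (hasDC_pC hzo g2 X).1 hU hzU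
    (fun y hy => ((mem_CD_iff hy.1 _).1 (hBU y hy)).2) hX
  rw [(hasDC_pC hzo g1 X).2] at k1
  rw [(hasDC_pC hzo g2 X).2] at k2
  have e1 : dV X (fun y => (B y).1) z = (cderiv X B z).1 := by
    ext j; exact (cderiv_fst hd X j).symm
  have e2 : dV X (fun y => (B y).2) z = (cderiv X B z).2 := by
    ext j; exact (cderiv_snd hd X j).symm
  rw [e1] at k1
  rw [e2] at k2
  exact ⟨by linear_combination k1, by linear_combination k2⟩

/-- The bracket of two fields in `ℂD` modulo `ℂD`, in terms of the Hessian of `ρ`. This formula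
gives integrability, the Levi form and the cubic form of the example. -/
lemma pC_bracket {z : C4} (hz : z ∈ exampleM) {A B : C4 → CVec} (hA : IsCDField exampleM z A)
    (hB : IsCDField exampleM z B) :
    pC z (bracket A B z).1 = hessC z (A z).1 (B z).2 - hessC z (A z).2 (B z).1 ∧
      pC z (bracket A B z).2 = hessC z (A z).2 (B z).1 - hessC z (A z).1 (B z).2 := by
  have h1 := pC_cderiv hz hB (hA.mem hz)
  have h2 := pC_cderiv hz hA (hB.mem hz)
  simp only [bracket, Prod.fst_sub, Prod.snd_sub, pC_sub]
  rw [h1.1, h1.2, h2.1, h2.2]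
  simp only [hessC, th1, th2, Pi.add_apply]
  constructor <;> ring

/-! ### A frame of the CR bundle of the example and its brackets -/

/-- The Euler field `∑ x_j ∂/∂z^j`, which spans the Levi kernel of the example. -/
noncomputable def fieldE (z : C4) : CVec := (![x 0 z, x 1 z, x 2 z, x 3 z], 0)

/-- The CR vector field `x₁ ∂/∂z¹ - x₃ ∂/∂z⁴`. -/
noncomputable def fieldY1 (z : C4) : CVec := (![x 0 z, 0, 0, -x 2 z], 0)

/-- The CR vector field `x₂ ∂/∂z² - x₃ ∂/∂z⁴`. -/
noncomputable def fieldY2 (z : C4) : CVec := (![0, x 1 z, 0, -x 2 z], 0)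

/-- The field `x₃ (∂/∂z̄⁴ - ∂/∂z⁴)`, transverse to the CR bundle of the example. -/
noncomputable def fieldT (z : C4) : CVec := (![0, 0, 0, -x 2 z], ![0, 0, 0, x 2 z])

lemma contDiff_ofReal_x (j : Fin 4) : ContDiff ℝ ∞ (fun z : C4 => (x j z : ℂ)) :=
  Complex.ofRealCLM.contDiff.comp (contDiff_x j)

lemma contDiff_fieldE : ContDiff ℝ ∞ fieldE := by
  refine ContDiff.prodMk (contDiff_pi.2 fun j => ?_) contDiff_const
  fin_cases j <;> exact contDiff_ofReal_x _

lemma contDiff_fieldY1 : ContDiff ℝ ∞ fieldY1 := by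
  refine ContDiff.prodMk (contDiff_pi.2 fun j => ?_) contDiff_const
  fin_cases j
  exacts [contDiff_ofReal_x _, contDiff_const, contDiff_const, (contDiff_ofReal_x _).neg]

lemma contDiff_fieldY2 : ContDiff ℝ ∞ fieldY2 := by
  refine ContDiff.prodMk (contDiff_pi.2 fun j => ?_) contDiff_const
  fin_cases j
  exacts [contDiff_const, contDiff_ofReal_x _, contDiff_const, (contDiff_ofReal_x _).neg]

lemma differentiable_fieldE (z : C4) : DifferentiableAt ℝ fieldE z :=
  contDiff_fieldE.differentiable (by simp) z

lemma differentiable_fieldY1 (z : C4) : DifferentiableAt ℝ fieldY1 z :=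
  contDiff_fieldY1.differentiable (by simp) z

lemma differentiable_fieldY2 (z : C4) : DifferentiableAt ℝ fieldY2 z :=
  contDiff_fieldY2.differentiable (by simp) z

lemma fieldE_mem {z : C4} (hz : z ∈ exampleM) : fieldE z ∈ H exampleM z := by
  rw [mem_H_iff hz]
  have h := ((mem_exampleM_iff z).1 hz).2
  obtain ⟨h0, h1, h2⟩ := x_ne_zero (octant_of_mem hz)
  refine ⟨?_, rfl⟩
  have h' : (x 3 z : ℂ) + x 2 z * logTerm z = 0 := by exact_mod_cast h
  simp [pC, fieldE]
  field_simp
  linear_combination h'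

lemma fieldY1_mem {z : C4} (hz : z ∈ exampleM) : fieldY1 z ∈ H exampleM z := by
  rw [mem_H_iff hz]
  obtain ⟨h0, h1, h2⟩ := x_ne_zero (octant_of_mem hz)
  refine ⟨?_, rfl⟩
  simp [pC, fieldY1]
  field_simp
  ring

lemma fieldY2_mem {z : C4} (hz : z ∈ exampleM) : fieldY2 z ∈ H exampleM z := by
  rw [mem_H_iff hz]
  obtain ⟨h0, h1, h2⟩ := x_ne_zero (octant_of_mem hz)
  refine ⟨?_, rfl⟩
  simp [pC, fieldY2]
  field_simp
  ring

lemma isCRField_of_contDiff {S : Set C4} {X : C4 → CVec} (hX : ContDiff ℝ ∞ X)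
    (h : ∀ z ∈ S, X z ∈ H S z) (z : C4) : IsCRField S z X :=
  ⟨Set.univ, isOpen_univ, trivial, hX.contDiffOn, fun y hy => h y hy.1⟩

lemma isCRField_Y1 (z : C4) : IsCRField exampleM z fieldY1 :=
  isCRField_of_contDiff contDiff_fieldY1 (fun _ => fieldY1_mem) z

lemma isCRField_Y2 (z : C4) : IsCRField exampleM z fieldY2 :=
  isCRField_of_contDiff contDiff_fieldY2 (fun _ => fieldY2_mem) z

lemma dC_neg_x (X : CVec) (j : Fin 4) (z : C4) :
    dC X (fun y => -(x j y : ℂ)) z = -(X.1 j + X.2 j) := by rw [dC_neg, dC_x]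

section Brackets

variable (z : C4)

lemma bracket_E_E : bracket fieldE (conjField fieldE) z = conjField fieldE z - fieldE z := by
  have dE := differentiable_fieldE z
  ext j
  · rw [bracket_fst dE (differentiableAt_conjField dE)]
    fin_cases j <;> simp [conjField, cConj, fieldE, dC_x, dC_const]
  · rw [bracket_snd dE (differentiableAt_conjField dE)]
    fin_cases j <;> simp [conjField, cConj, fieldE, dC_x, dC_const]

lemma bracket_E_Y1 : bracket fieldE (conjField fieldY1) z = conjField fieldY1 z - fieldY1 z := by
  have dE := differentiable_fieldE z
  have dY := differentiableAt_conjField (differentiable_fieldY1 z)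
  ext j
  · rw [bracket_fst dE dY]
    fin_cases j <;> simp [conjField, cConj, fieldE, fieldY1, dC_x, dC_const]
  · rw [bracket_snd dE dY]
    fin_cases j <;> simp [conjField, cConj, fieldE, fieldY1, dC_x, dC_const, dC_neg_x]

lemma bracket_E_Y2 : bracket fieldE (conjField fieldY2) z = conjField fieldY2 z - fieldY2 z := by
  have dE := differentiable_fieldE z
  have dY := differentiableAt_conjField (differentiable_fieldY2 z)
  ext j
  · rw [bracket_fst dE dY]
    fin_cases j <;> simp [conjField, cConj, fieldE, fieldY2, dC_x, dC_const]
  · rw [bracket_snd dE dY]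
    fin_cases j <;> simp [conjField, cConj, fieldE, fieldY2, dC_x, dC_const, dC_neg_x]

lemma bracket_Y1_Y1 : bracket fieldY1 (conjField fieldY1) z =
    conjField fieldY1 z - fieldY1 z + fieldT z := by
  have d1 := differentiable_fieldY1 z
  have dY := differentiableAt_conjField (differentiable_fieldY1 z)
  ext j
  · rw [bracket_fst d1 dY]
    fin_cases j <;> simp [conjField, cConj, fieldT, fieldY1, dC_x, dC_const, dC_neg_x]
  · rw [bracket_snd d1 dY]
    fin_cases j <;> simp [conjField, cConj, fieldT, fieldY1, dC_x, dC_const, dC_neg_x] <;>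
      simp [Matrix.vecHead, Matrix.vecTail]

lemma bracket_Y2_Y2 : bracket fieldY2 (conjField fieldY2) z =
    conjField fieldY2 z - fieldY2 z + fieldT z := by
  have d1 := differentiable_fieldY2 z
  have dY := differentiableAt_conjField (differentiable_fieldY2 z)
  ext j
  · rw [bracket_fst d1 dY]
    fin_cases j <;> simp [conjField, cConj, fieldT, fieldY2, dC_x, dC_const, dC_neg_x]
  · rw [bracket_snd d1 dY]
    fin_cases j <;> simp [conjField, cConj, fieldT, fieldY2, dC_x, dC_const, dC_neg_x] <;>
      simp [Matrix.vecHead, Matrix.vecTail]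

lemma bracket_Y1_Y2 : bracket fieldY1 (conjField fieldY2) z = 0 := by
  have d1 := differentiable_fieldY1 z
  have dY := differentiableAt_conjField (differentiable_fieldY2 z)
  ext j
  · rw [bracket_fst d1 dY]
    fin_cases j <;>
      simp [conjField, cConj, fieldY1, fieldY2, dC_x, dC_const, dC_neg_x]
  · rw [bracket_snd d1 dY]
    fin_cases j <;>
      simp [conjField, cConj, fieldY1, fieldY2, dC_x, dC_const, dC_neg_x]

lemma bracket_Y2_Y1 : bracket fieldY2 (conjField fieldY1) z = 0 := by
  have d1 := differentiable_fieldY2 z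
  have dY := differentiableAt_conjField (differentiable_fieldY1 z)
  ext j
  · rw [bracket_fst d1 dY]
    fin_cases j <;>
      simp [conjField, cConj, fieldY1, fieldY2, dC_x, dC_const, dC_neg_x]
  · rw [bracket_snd d1 dY]
    fin_cases j <;>
      simp [conjField, cConj, fieldY1, fieldY2, dC_x, dC_const, dC_neg_x]

end Brackets

/-! ### Integrability and the Levi kernel -/

lemma isIntegrableCR_exampleM : IsIntegrableCR exampleM := by
  intro z hz X Y hX hY
  have hX' := hX.isCDField
  have hY' := hY.isCDField
  have hXz := (mem_H_iff hz _).1 (show X z ∈ H exampleM z by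
    obtain ⟨U, -, hzU, -, h⟩ := hX; exact h z ⟨hz, hzU⟩)
  have hYz := (mem_H_iff hz _).1 (show Y z ∈ H exampleM z by
    obtain ⟨U, -, hzU, -, h⟩ := hY; exact h z ⟨hz, hzU⟩)
  rw [mem_H_iff hz]
  constructor
  · rw [(pC_bracket hz hX' hY').1, hXz.2, hYz.2]
    simp [hessC, th1, th2]
  · ext j
    obtain ⟨U, hU, hzU, -, hXU⟩ := hX
    obtain ⟨V, hV, hzV, -, hYV⟩ := hY
    rw [bracket_snd hX'.1 hY'.1,
      dC_eq_zero_of_tangent (differentiableAt_snd_apply hY'.1 j) hV hzV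
        (fun y hy => by rw [(hYV y hy).2]; rfl) (hX'.mem hz),
      dC_eq_zero_of_tangent (differentiableAt_snd_apply hX'.1 j) hU hzU
        (fun y hy => by rw [(hXU y hy).2]; rfl) (hY'.mem hz)]
    simp

/-- The CR vector field whose first three components are those of `a`. -/
noncomputable def extendH (a : C4) (z : C4) : CVec :=
  (![a 0, a 1, a 2, -((x 2 z / x 0 z : ℝ) * a 0 + (x 2 z / x 1 z : ℝ) * a 1 +
    ((logTerm z - 2 : ℝ) : ℂ) * a 2)], 0)

lemma isCRField_extendH {z : C4} (hz : z ∈ exampleM) (a : C4) :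
    IsCRField exampleM z (extendH a) := by
  refine ⟨octant, isOpen_octant, octant_of_mem hz, ?_, ?_⟩
  · refine ContDiffOn.prodMk (contDiffOn_pi.2 fun j => ?_) contDiffOn_const
    have hr : ∀ f : C4 → ℝ, ContDiffOn ℝ ∞ f octant → ∀ c : ℂ,
        ContDiffOn ℝ ∞ (fun y => (f y : ℂ) * c) octant := fun f hf c =>
      (Complex.ofRealCLM.contDiff.comp_contDiffOn hf).mul contDiffOn_const
    have hx := fun j => (contDiff_x j).contDiffOn (s := octant)
    fin_cases j
    · exact contDiffOn_const
    · exact contDiffOn_const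
    · exact contDiffOn_const
    · exact (((hr _ ((hx 2).div (hx 0) fun _ hy => hy.1.ne') _).add
        (hr _ ((hx 2).div (hx 1) fun _ hy => hy.2.1.ne') _)).add
        (hr _ (contDiffOn_logTerm.sub contDiffOn_const) _)).neg
  · rintro y ⟨hy, -⟩
    rw [mem_H_iff hy]
    refine ⟨?_, rfl⟩
    simp [pC, extendH]

lemma extendH_apply {z : C4} (hz : z ∈ exampleM) {u : CVec} (hu : u ∈ H exampleM z) :
    extendH u.1 z = u := by
  obtain ⟨h1, h2⟩ := (mem_H_iff hz u).1 hu
  have h3 : -((x 2 z / x 0 z : ℝ) * u.1 0 + (x 2 z / x 1 z : ℝ) * u.1 1 +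
      ((logTerm z - 2 : ℝ) : ℂ) * u.1 2) = u.1 3 := by
    simp only [pC] at h1
    push_cast
    linear_combination -h1
  refine Prod.ext ?_ h2.symm
  ext j
  fin_cases j
  · rfl
  · rfl
  · rfl
  · exact h3

/-- For CR fields the class of `[X, Ȳ]` modulo `ℂD` is given by the Hessian of `ρ`. -/
lemma pC_bracket_conj {z : C4} (hz : z ∈ exampleM) {X Y : C4 → CVec}
    (hX : IsCRField exampleM z X) (hY : IsCRField exampleM z Y) :
    pC z (bracket X (conjField Y) z).1 = hessC z (X z).1 (star (Y z).1) ∧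
      pC z (bracket X (conjField Y) z).2 = -hessC z (X z).1 (star (Y z).1) := by
  have h := pC_bracket hz hX.isCDField hY.isCDField.conj
  have hXz : (X z).2 = 0 := by
    obtain ⟨U, -, hzU, -, h⟩ := hX; exact (h z ⟨hz, hzU⟩).2
  have hYz : (Y z).2 = 0 := by
    obtain ⟨U, -, hzU, -, h⟩ := hY; exact (h z ⟨hz, hzU⟩).2
  rw [h.1, h.2]
  constructor <;> simp [hessC, conjField, cConj, hXz, hYz, th1, th2]

lemma th_fieldE {z : C4} (hz : z ∈ octant) : th1 z (fieldE z).1 = 0 ∧ th2 z (fieldE z).1 = 0 := by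
  obtain ⟨h0, h1, h2⟩ := x_ne_zero hz
  simp [th1, th2, fieldE, h0, h1, h2]

lemma th_fieldY1 {z : C4} (hz : z ∈ octant) :
    th1 z (fieldY1 z).1 = 1 ∧ th2 z (fieldY1 z).1 = 0 := by
  obtain ⟨h0, h1, h2⟩ := x_ne_zero hz
  simp [th1, th2, fieldY1, h0]

lemma th_fieldY2 {z : C4} (hz : z ∈ octant) :
    th1 z (fieldY2 z).1 = 0 ∧ th2 z (fieldY2 z).1 = 1 := by
  obtain ⟨h0, h1, h2⟩ := x_ne_zero hz
  simp [th1, th2, fieldY2, h1]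

lemma th1_smul (z : C4) (c : ℂ) (a : C4) : th1 z (c • a) = c * th1 z a := by
  simp [th1]; ring

lemma th2_smul (z : C4) (c : ℂ) (a : C4) : th2 z (c • a) = c * th2 z a := by
  simp [th2]; ring

lemma th1_star (z : C4) (a : C4) : th1 z (star a) = star (th1 z a) := by
  simp [th1]

lemma th2_star (z : C4) (a : C4) : th2 z (star a) = star (th2 z a) := by
  simp [th2]

/-- The forms `th1`, `th2` and `p` cut out the line spanned by the Euler field. -/
lemma eq_smul_fieldE {z : C4} (hz : z ∈ exampleM) {u : CVec} (hu : u ∈ H exampleM z)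
    (h1 : th1 z u.1 = 0) (h2 : th2 z u.1 = 0) : u = (u.1 0 / x 0 z) • fieldE z := by
  obtain ⟨k0, k1, k2⟩ := x_ne_zero (octant_of_mem hz)
  have hE := (mem_H_iff hz _).1 (fieldE_mem hz)
  obtain ⟨hp, hu2⟩ := (mem_H_iff hz u).1 hu
  have hρ : (x 3 z : ℂ) + x 2 z * logTerm z = 0 := by
    exact_mod_cast ((mem_exampleM_iff z).1 hz).2
  simp only [th1] at h1
  simp only [th2] at h2
  have a2 : u.1 2 = u.1 0 / x 0 z * x 2 z := by
    field_simp at h1 ⊢; linear_combination -h1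
  have a1 : u.1 1 = u.1 0 / x 0 z * x 1 z := by
    rw [a2] at h2
    field_simp at h2 ⊢; linear_combination h2
  have a3 : u.1 3 = u.1 0 / x 0 z * x 3 z := by
    simp only [pC] at hp
    rw [a1, a2] at hp
    field_simp at hp ⊢; linear_combination hp - u.1 0 * hρ
  refine Prod.ext ?_ (by simp [hu2, fieldE])
  ext j
  fin_cases j
  · simp [fieldE]; field_simp
  · simpa [fieldE] using a1
  · simpa [fieldE] using a2
  · simpa [fieldE] using a3

lemma mem_leviKernel_iff {z : C4} (hz : z ∈ exampleM) (u : CVec) :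
    u ∈ leviKernel exampleM z ↔ u ∈ H exampleM z ∧ th1 z u.1 = 0 ∧ th2 z u.1 = 0 := by
  have hzo := octant_of_mem hz
  obtain ⟨k0, k1, k2⟩ := x_ne_zero hzo
  constructor
  · rintro ⟨hu, h⟩
    have key : ∀ Y, IsCRField exampleM z Y → hessC z u.1 (star (Y z).1) = 0 := by
      intro Y hY
      have hX := isCRField_extendH hz u.1
      have h1 := h _ Y hX hY (extendH_apply hz hu)
      have h2 := ((mem_CD_iff hz _).1 h1).1
      rw [Prod.smul_fst, pC_smul, (pC_bracket_conj hz hX hY).1, extendH_apply hz hu] at h2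
      simpa [Complex.I_ne_zero] using h2
    refine ⟨hu, ?_, ?_⟩
    · have := key _ (isCRField_Y1 z)
      simpa [hessC, th1_star, th2_star, th_fieldY1 hzo, k2] using this
    · have := key _ (isCRField_Y2 z)
      simpa [hessC, th1_star, th2_star, th_fieldY2 hzo, k2] using this
  · rintro ⟨hu, h1, h2⟩
    refine ⟨hu, fun X Y hX hY hXu => ?_⟩
    have h := pC_bracket_conj hz hX hY
    rw [mem_CD_iff hz, Prod.smul_fst, Prod.smul_snd, pC_smul, pC_smul, h.1, h.2, hXu]
    simp [hessC, h1, h2]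

lemma smul_fieldE_mem {z : C4} (hz : z ∈ exampleM) (c : ℂ) :
    c • fieldE z ∈ leviKernel exampleM z := by
  have hE := fieldE_mem hz
  rw [mem_H_iff hz] at hE
  rw [mem_leviKernel_iff hz, mem_H_iff hz]
  simp [pC_smul, hE.1, hE.2, th1_smul, th2_smul, th_fieldE (octant_of_mem hz)]

lemma isKernelField_smul_E (c : ℂ) (z : C4) : IsKernelField exampleM z (fun y => c • fieldE y) :=
  ⟨isCRField_of_contDiff (contDiff_fieldE.const_smul c)
    (fun _ hy => ((mem_leviKernel_iff hy _).1 (smul_fieldE_mem hy c)).1) z,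
    Set.univ, isOpen_univ, trivial, fun _ hy => smul_fieldE_mem hy.1 c⟩

lemma fieldE_ne_zero {z : C4} (hz : z ∈ octant) : fieldE z ≠ 0 := by
  intro h
  have := congrFun (congrArg Prod.fst h) 0
  exact (x_ne_zero hz).1 (by simpa [fieldE] using this)

lemma hasRankOneLeviKernel_exampleM : HasRankOneLeviKernel exampleM := by
  intro z hz
  refine ⟨fieldE, by simpa using isKernelField_smul_E 1 z, Set.univ, isOpen_univ, trivial, ?_⟩
  rintro y ⟨hy, -⟩
  refine ⟨fieldE_ne_zero (octant_of_mem hy), fun u => ⟨fun hu => ?_, ?_⟩⟩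
  · obtain ⟨h1, h2, h3⟩ := (mem_leviKernel_iff hy u).1 hu
    exact ⟨_, eq_smul_fieldE hy h1 h2 h3⟩
  · rintro ⟨c, rfl⟩
    exact smul_fieldE_mem hy c

/-! ### The Levi form and the cubic form -/

/-- The Levi form of the example with respect to any real covector annihilating `D`. -/
lemma levi_eq {z : C4} (hz : z ∈ exampleM) {θ : C4 →L[ℝ] ℝ} (hθ : ∀ v ∈ D exampleM z, θ v = 0)
    {X Y : C4 → CVec} (hX : IsCRField exampleM z X) (hY : IsCRField exampleM z Y) :
    levi θ X Y z =
      θ (Complex.I • Pi.single 3 1) * hessC z (X z).1 (star (Y z).1) := by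
  set r := θ (Complex.I • Pi.single 3 1) with hr
  have hT : ∀ v, (pC z v).re = 0 → θ v = (pC z v).im * r := by
    intro v hv
    have h1 : v - (pC z v).im • (Complex.I • Pi.single 3 1 : C4) ∈ D exampleM z := by
      rw [mem_D_iff hz, pC_sub]
      have : (pC z v).im • (Complex.I • Pi.single 3 1 : C4) =
          (((pC z v).im : ℂ) * Complex.I) • (Pi.single 3 1 : C4) := by
        rw [← smul_smul]; rfl
      rw [this, pC_smul]
      have e : pC z (Pi.single 3 1) = 1 := by simp [pC]
      rw [e]
      apply Complex.ext <;> simp [hv]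
    have h2 := hθ _ h1
    rw [map_sub, map_smul, smul_eq_mul, ← hr] at h2
    linarith
  obtain ⟨h1, h2⟩ := pC_bracket_conj hz hX hY
  set s := hessC z (X z).1 (star (Y z).1)
  set W := bracket X (conjField Y) z
  have e1 : pC z (cRe W) = s.im * Complex.I := by
    rw [pC_cRe, h1, h2]
    apply Complex.ext <;> simp; ring
  have e2 : pC z (cIm W) = -s.re * Complex.I := by
    rw [pC_cIm, h1, h2]
    apply Complex.ext <;> simp; ring
  rw [levi, evalC]
  simp only [ofRealForm, ContinuousLinearMap.comp_apply, Complex.ofRealCLM_apply]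
  rw [hT _ (by rw [e1]; simp), hT _ (by rw [e2]; simp), e1, e2]
  apply Complex.ext <;> simp <;> ring

/-- The contact covector `-Im p`. -/
noncomputable def contactForm (z : C4) : C4 →L[ℝ] ℝ :=
  -(Complex.imCLM.comp ((x 2 z / x 0 z : ℂ) • coordR 0 + (x 2 z / x 1 z : ℂ) • coordR 1 +
    ((logTerm z : ℂ) - 2) • coordR 2 + coordR 3))

lemma contactForm_apply (z v : C4) : contactForm z v = -(pC z v).im := by
  simp [contactForm, pC, coordR]

lemma isLeviDefinite_exampleM : IsLeviDefinite exampleM := by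
  intro z hz
  have hzo := octant_of_mem hz
  have h0 : ∀ v ∈ D exampleM z, contactForm z v = 0 := by
    intro v hv
    rw [contactForm_apply, (mem_D_iff hz v).1 hv]; simp
  have hT : contactForm z (Complex.I • Pi.single 3 1) = -1 := by
    rw [contactForm_apply]; simp [pC]
  refine ⟨contactForm z, ⟨h0, Complex.I • Pi.single 3 1, ?_, by rw [hT]; norm_num⟩, ?_⟩
  · rw [mem_tangentSpace_iff hz]; simp [pC]
  · intro X hX hXK
    refine ⟨x 2 z * (Complex.normSq (th1 z (X z).1) + Complex.normSq (th2 z (X z).1)), ?_, ?_⟩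
    · have hXH : X z ∈ H exampleM z := by
        obtain ⟨U, -, hzU, -, h⟩ := hX; exact h z ⟨hz, hzU⟩
      refine mul_pos hzo.2.2 ?_
      rw [mem_leviKernel_iff hz] at hXK
      by_cases h1 : th1 z (X z).1 = 0
      · have h2 : th2 z (X z).1 ≠ 0 := fun h2 => hXK ⟨hXH, h1, h2⟩
        have := Complex.normSq_pos.2 h2
        have := Complex.normSq_nonneg (th1 z (X z).1)
        linarith
      · have := Complex.normSq_pos.2 h1
        have := Complex.normSq_nonneg (th2 z (X z).1)
        linarith
    · rw [levi_eq hz h0 hX hX, hT, hessC, th1_star, th2_star]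
      push_cast
      rw [Complex.normSq_eq_conj_mul_self, Complex.normSq_eq_conj_mul_self]
      simp only [starRingEnd_apply]
      ring

lemma isTwoNondegenerate_exampleM : IsTwoNondegenerate exampleM := by
  rintro z hz u ⟨hu, h⟩
  have hzo := octant_of_mem hz
  obtain ⟨k0, k1, k2⟩ := x_ne_zero hzo
  obtain ⟨huH, hu1, hu2⟩ := (mem_leviKernel_iff hz u).1 hu
  set c := u.1 0 / x 0 z
  have huE : u = c • fieldE z := eq_smul_fieldE hz huH hu1 hu2
  have h1 := h _ _ _ (isKernelField_smul_E c z) (isCRField_Y1 z) (isCRField_Y1 z) huE.symm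
  have hbr : bracket (fun y => c • fieldE y) (conjField fieldY1) =
      fun y => c • (conjField fieldY1 y - fieldY1 y) := by
    funext y
    rw [← bracket_E_Y1]
    have dE := differentiable_fieldE y
    have dY := differentiableAt_conjField (differentiable_fieldY1 y)
    ext j
    · rw [bracket_fst (dE.fun_const_smul c) dY, Prod.smul_fst, Pi.smul_apply, bracket_fst dE dY,
        dC_smul_vec]
      simp only [Prod.smul_fst, Pi.smul_apply, smul_eq_mul]
      rw [dC_const_mul _ _ (differentiableAt_fst_apply dE j)]
      simp [conjField, cConj, fieldY1, dC_const]
    · rw [bracket_snd (dE.fun_const_smul c) dY, Prod.smul_snd, Pi.smul_apply, bracket_snd dE dY,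
        dC_smul_vec]
      simp only [Prod.smul_snd, Pi.smul_apply, smul_eq_mul]
      rw [dC_const_mul _ _ (differentiableAt_snd_apply dE j)]
      ring
  rw [hbr] at h1
  have hA : IsCDField exampleM z (fun y => c • (conjField fieldY1 y - fieldY1 y)) := by
    refine ⟨((differentiableAt_conjField (differentiable_fieldY1 z)).sub
      (differentiable_fieldY1 z)).const_smul c, Set.univ, isOpen_univ, trivial, ?_⟩
    rintro y ⟨hy, -⟩
    have a1 := (mem_CD_iff hy _).1 (fieldY1_mem hy).1
    rw [mem_CD_iff hy]
    simp [pC_smul, pC_sub, a1, conjField, cConj, pC_star]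
  have h2 := ((mem_CD_iff hz _).1 h1).1
  rw [Prod.smul_fst, pC_smul, (pC_bracket hz hA (isCRField_Y1 z).isCDField.conj).1] at h2
  have f1 : (c • (conjField fieldY1 z - fieldY1 z)).1 = (-c) • (fieldY1 z).1 := by
    ext j; simp [conjField, cConj, show (fieldY1 z).2 = 0 from rfl]
  have f2 : (conjField fieldY1 z).1 = 0 := by
    ext j; simp [conjField, cConj, fieldY1]
  have f3 : (conjField fieldY1 z).2 = star (fieldY1 z).1 := rfl
  have t0 : th1 z 0 = 0 ∧ th2 z 0 = 0 := by simp [th1, th2]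
  obtain ⟨t1, t2⟩ := th_fieldY1 hzo
  simp only [hessC, f1, f2, f3, th1_smul, th2_smul, th1_star, th2_star, t0, t1, t2, star_one,
    star_zero] at h2
  have hc : c = 0 := by
    simpa [Complex.I_ne_zero, k2] using h2
  rw [huE, hc, zero_smul]

/-- For `X = c E` in the Levi kernel, where `E` is the Euler field, `ad_X` is `-c` times complex
conjugation in the coframe `th1`, `th2` of `H/K`. -/
lemma th_of_representsAd {z : C4} (hz : z ∈ exampleM) {X Y W : C4 → CVec}
    (hX : IsKernelField exampleM z X) (hY : IsCRField exampleM z Y)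
    (h : RepresentsAd exampleM z X Y W) :
    th1 z (W z).1 = -((X z).1 0 / x 0 z) * star (th1 z (Y z).1) ∧
      th2 z (W z).1 = -((X z).1 0 / x 0 z) * star (th2 z (Y z).1) := by
  have hzo := octant_of_mem hz
  obtain ⟨k0, k1, k2⟩ := x_ne_zero hzo
  obtain ⟨hW, k, hk, w, hw, hbr⟩ := h
  obtain ⟨-, hk1, hk2⟩ := (mem_leviKernel_iff hz k).1 hk
  have hw1 := ((mem_Hbar_iff hz w).1 hw).2
  obtain ⟨hXC, U, hU, hzU, hXU⟩ := hX
  have hXd := hXC.isCDField.1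
  have hYc := hY.isCDField.conj
  have hYd := hYc.1
  have hY2 : (Y z).2 = 0 := by
    obtain ⟨V, -, hzV, -, h⟩ := hY; exact (h z ⟨hz, hzV⟩).2
  have hX2 : (X z).2 = 0 := by
    obtain ⟨V, -, hzV, -, h⟩ := hXC; exact (h z ⟨hz, hzV⟩).2
  -- the holomorphic part of `Ȳ` vanishes along `M`, so only `-Ȳ(X)` contributes
  have hb : ∀ j, (W z).1 j + k.1 j = -dC (conjField Y z) (fun y => (X y).1 j) z := by
    intro j
    have h1 := congrFun (congrArg Prod.fst hbr) j
    rw [bracket_fst hXd hYd] at h1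
    have h2 : dC (X z) (fun y => (conjField Y y).1 j) z = 0 := by
      obtain ⟨V, hV, hzV, -, hYV⟩ := hY
      exact dC_eq_zero_of_tangent (differentiableAt_fst_apply hYd j) hV hzV
        (fun y hy => by simp [conjField, cConj, (hYV y hy).2]) (hXC.isCDField.mem hz)
    rw [h2] at h1
    simp [hw1] at h1
    linear_combination -h1
  have hX1 := (mem_leviKernel_iff hz _).1 (hXU z ⟨hz, hzU⟩)
  have dX := fun j => HasDC.of_differentiableAt (X := conjField Y z)
    (differentiableAt_fst_apply hXd j)
  have hd1 := ((dX 0).div (HasDC.x 0) k0).sub ((dX 2).div (HasDC.x 2) k2)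
  have hd2 := ((dX 1).div (HasDC.x 1) k1).sub ((dX 2).div (HasDC.x 2) k2)
  have e1 := dC_eq_zero_of_tangent hd1.1 hU hzU
    (fun y hy => ((mem_leviKernel_iff hy.1 _).1 (hXU y hy)).2.1) (hYc.mem hz)
  have e2 := dC_eq_zero_of_tangent hd2.1 hU hzU
    (fun y hy => ((mem_leviKernel_iff hy.1 _).1 (hXU y hy)).2.2) (hYc.mem hz)
  rw [hd1.2] at e1
  rw [hd2.2] at e2
  have hXE := eq_smul_fieldE hz hX1.1 hX1.2.1 hX1.2.2
  set c := (X z).1 0 / x 0 z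
  have X0 : (X z).1 0 = c * x 0 z := by simp only [c]; field_simp
  have X1 : (X z).1 1 = c * x 1 z := by rw [hXE]; simp [fieldE]
  have X2 : (X z).1 2 = c * x 2 z := by rw [hXE]; simp [fieldE]
  rw [X0, X2] at e1
  rw [X1, X2] at e2
  have b0 := hb 0
  have b1 := hb 1
  have b2 := hb 2
  simp only [th1, th2] at hk1 hk2 ⊢
  simp only [conjField, cConj, hY2, star_zero, Pi.zero_apply, zero_add,
    Pi.star_apply] at e1 e2 b0 b1 b2
  simp only [star_sub, star_div₀, Complex.star_def, Complex.conj_ofReal] at e1 e2 b0 b1 b2 ⊢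
  field_simp at e1 e2 hk1 hk2 ⊢
  constructor
  · linear_combination (x 2 z : ℂ) * b0 - (x 0 z : ℂ) * b2 - hk1 - e1
  · linear_combination (x 2 z : ℂ) * b1 - (x 1 z : ℂ) * b2 - hk2 - e2

lemma isConformalUnitaryType_exampleM : IsConformalUnitaryType exampleM := by
  intro z hz X hX hX0
  have hzo := octant_of_mem hz
  obtain ⟨k0, k1, k2⟩ := x_ne_zero hzo
  set c := (X z).1 0 / x 0 z with hc
  have hXE : X z = c • fieldE z := by
    obtain ⟨-, U, -, hzU, hXU⟩ := hX
    obtain ⟨a1, a2, a3⟩ := (mem_leviKernel_iff hz _).1 (hXU z ⟨hz, hzU⟩)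
    exact eq_smul_fieldE hz a1 a2 a3
  have hc0 : c ≠ 0 := by
    rintro h
    exact hX0 (by rw [hXE, h, zero_smul])
  refine ⟨c * star c, mul_ne_zero hc0 (star_ne_zero.2 hc0), ?_⟩
  intro θ hθ Y Z Y' Z' hY hZ hY' hZ'
  obtain ⟨y1, y2⟩ := th_of_representsAd hz hX hY hY'
  obtain ⟨z1, z2⟩ := th_of_representsAd hz hX hZ hZ'
  rw [levi_eq hz hθ.1 hY'.1 hZ'.1, levi_eq hz hθ.1 hY hZ]
  simp only [hessC, th1_star, th2_star, y1, y2, z1, z2, ← hc]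
  simp only [star_mul', star_neg, star_add, star_star]
  simp only [Complex.star_def, Complex.conj_ofReal]
  ring

theorem isDefiniteConformalUnitaryCR_exampleM : IsDefiniteConformalUnitaryCR exampleM :=
  ⟨isRealHypersurface_exampleM, isIntegrableCR_exampleM, hasRankOneLeviKernel_exampleM,
    isLeviDefinite_exampleM, isTwoNondegenerate_exampleM, isConformalUnitaryType_exampleM⟩

/-! ### The coframing in terms of logarithmic differentials -/

/-- The form `dz³/x₃`. -/
noncomputable def kap (z v : C4) : ℂ := v 2 / x 2 z

lemma sqrt3_sq {z : C4} (hz : z ∈ octant) : sqrt3 z ^ 2 = x 2 z := by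
  unfold sqrt3
  exact_mod_cast Real.sq_sqrt hz.2.2.le

lemma sqrt3_ne_zero {z : C4} (hz : z ∈ octant) : sqrt3 z ≠ 0 := by
  unfold sqrt3
  exact_mod_cast (Real.sqrt_pos.2 hz.2.2).ne'

lemma star_sqrt3 (z : C4) : star (sqrt3 z) = sqrt3 z := by
  simp [sqrt3]

lemma coframe0_apply (z v : C4) : exampleCoframe 0 z v = 2 * Complex.I * pC z v := by
  simp [exampleCoframe, dz, pC]
  ring

lemma coframe1_apply {z : C4} (hz : z ∈ octant) (v : C4) : exampleCoframe 1 z v =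
    sqrt3 z * (th1 z v + Complex.I * th2 z v) - (1 + Complex.I) / (2 * sqrt3 z) * pC z v := by
  obtain ⟨h0, h1, -⟩ := x_ne_zero hz
  have hs := sqrt3_ne_zero hz
  simp [exampleCoframe, dz, pC, th1, th2]
  rw [← sqrt3_sq hz]
  field_simp
  ring_nf

lemma coframe2_apply {z : C4} (hz : z ∈ octant) (v : C4) : exampleCoframe 2 z v =
    sqrt3 z * (th1 z v - Complex.I * th2 z v) - (1 - Complex.I) / (2 * sqrt3 z) * pC z v := by
  obtain ⟨h0, h1, -⟩ := x_ne_zero hz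
  have hs := sqrt3_ne_zero hz
  simp [exampleCoframe, dz, pC, th1, th2]
  rw [← sqrt3_sq hz]
  field_simp
  ring_nf

lemma coframe3_apply {z : C4} (hz : z ∈ octant) (v : C4) : exampleCoframe 3 z v =
    kap z v + pC z v / (8 * sqrt3 z ^ 2) := by
  obtain ⟨h0, h1, -⟩ := x_ne_zero hz
  have hs := sqrt3_ne_zero hz
  simp [exampleCoframe, dz, pC, kap]
  rw [← sqrt3_sq hz]
  field_simp
  ring_nf

/-- The forms `th1`, `th2`, `kap`, `p` are a basis of the complex linear forms. -/
lemma exists_frame {z : C4} (hz : z ∈ octant) (a b k q : ℂ) :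
    ∃ v, th1 z v = a ∧ th2 z v = b ∧ kap z v = k ∧ pC z v = q := by
  obtain ⟨h0, h1, h2⟩ := x_ne_zero hz
  refine ⟨![x 0 z * (a + k), x 1 z * (b + k), x 2 z * k,
    q - (x 2 z * (a + k) + x 2 z * (b + k) + (logTerm z - 2) * (x 2 z * k))], ?_, ?_, ?_, ?_⟩
  · simp [th1]; field_simp; ring
  · simp [th2]; field_simp; ring
  · simp [kap]; field_simp
  · simp [pC]; field_simp; ring

lemma frame_injective {z : C4} (hz : z ∈ octant) {v w : C4} (ha : th1 z v = th1 z w)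
    (hb : th2 z v = th2 z w) (hk : kap z v = kap z w) (hq : pC z v = pC z w) : v = w := by
  obtain ⟨h0, h1, h2⟩ := x_ne_zero hz
  have e2 : v 2 = w 2 := by
    simp only [kap] at hk; field_simp at hk; exact hk
  have e0 : v 0 = w 0 := by
    simp only [th1, e2] at ha; field_simp at ha
    exact mul_right_cancel₀ h2 (by linear_combination ha)
  have e1 : v 1 = w 1 := by
    simp only [th2, e2] at hb; field_simp at hb
    exact mul_right_cancel₀ h2 (by linear_combination hb)
  have e3 : v 3 = w 3 := by
    simp only [pC, e0, e1, e2] at hq; linear_combination hq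
  ext j
  fin_cases j <;> assumption

/-! ### Smoothness of the coframing -/

lemma contDiffOn_sqrt3 : ContDiffOn ℝ ∞ sqrt3 octant :=
  Complex.ofRealCLM.contDiff.comp_contDiffOn
    ((contDiff_x 2).contDiffOn.sqrt fun _ hz => hz.2.2.ne')

lemma contDiffOn_coframe (j : Fin 4) : ContDiffOn ℝ ∞ (exampleCoframe j) octant := by
  have hx := fun j => (contDiff_ofReal_x j).contDiffOn (s := octant)
  have hL : ContDiffOn ℝ ∞ (fun z => (logTerm z : ℂ)) octant :=
    Complex.ofRealCLM.contDiff.comp_contDiffOn contDiffOn_logTerm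
  have hs := contDiffOn_sqrt3
  have h0 : ∀ z ∈ octant, (x 0 z : ℂ) ≠ 0 := fun z hz => (x_ne_zero hz).1
  have h1 : ∀ z ∈ octant, (x 1 z : ℂ) ≠ 0 := fun z hz => (x_ne_zero hz).2.1
  have h2 : ∀ z ∈ octant, (x 2 z : ℂ) ≠ 0 := fun z hz => (x_ne_zero hz).2.2
  have hs0 : ∀ z ∈ octant, sqrt3 z ≠ 0 := fun z hz => sqrt3_ne_zero hz
  have c : ∀ a : ℂ, ContDiffOn ℝ ∞ (fun _ : C4 => a) octant := fun a => contDiffOn_const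
  have k : ∀ j, ContDiffOn ℝ ∞ (fun _ : C4 => dz j) octant := fun j => contDiffOn_const
  have ne : ∀ {a : ℂ} {f : C4 → ℂ}, a ≠ 0 → (∀ z ∈ octant, f z ≠ 0) →
      ∀ z ∈ octant, a * f z ≠ 0 := fun ha hf z hz => mul_ne_zero ha (hf z hz)
  have dv : ∀ {f g : C4 → ℂ}, ContDiffOn ℝ ∞ f octant → ContDiffOn ℝ ∞ g octant →
      (∀ z ∈ octant, g z ≠ 0) → ContDiffOn ℝ ∞ (fun z => f z / g z) octant := by
    intro f g hf hg h
    simp only [div_eq_mul_inv]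
    exact hf.mul (hg.inv h)
  fin_cases j
  · exact (((((c _).mul (dv (hx 2) (hx 0) h0)).smul (k 0)).add
      (((c _).mul (dv (hx 2) (hx 1) h1)).smul (k 1))).add
      (((c _).mul (hL.sub (c _))).smul (k 2))).add ((c _).smul (k 3))
  · exact ((((dv ((c _).mul hs) ((c _).mul (hx 0)) (ne two_ne_zero h0)).smul (k 0)).sub
      ((dv ((c _).mul hs) ((c _).mul (hx 1)) (ne two_ne_zero h1)).smul (k 1))).sub
      (((dv (c _) ((c _).mul hs) (ne two_ne_zero hs0)).mul hL).smul (k 2))).sub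
      ((dv (c _) ((c _).mul hs) (ne two_ne_zero hs0)).smul (k 3))
  · exact ((((dv ((c _).mul hs) ((c _).mul (hx 0)) (ne two_ne_zero h0)).smul (k 0)).sub
      ((dv ((c _).mul hs) ((c _).mul (hx 1)) (ne two_ne_zero h1)).smul (k 1))).sub
      (((dv (c _) ((c _).mul hs) (ne two_ne_zero hs0)).mul hL).smul (k 2))).sub
      ((dv (c _) ((c _).mul hs) (ne two_ne_zero hs0)).smul (k 3))
  · have h8 : (8 : ℂ) ≠ 0 := by norm_num
    exact ((((dv (c _) ((c _).mul (hx 0)) (ne h8 h0)).smul (k 0)).add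
      ((dv (c _) ((c _).mul (hx 1)) (ne h8 h1)).smul (k 1))).add
      ((dv ((c _).add hL) ((c _).mul (hx 2)) (ne h8 h2)).smul (k 2))).add
      ((dv (c _) ((c _).mul (hx 2)) (ne h8 h2)).smul (k 3))

lemma exampleM_subset_octant : exampleM ⊆ octant := fun _ hz => octant_of_mem hz

lemma coframe_I_smul (j : Fin 4) (z v : C4) :
    exampleCoframe j z (Complex.I • v) = Complex.I * exampleCoframe j z v := by
  fin_cases j <;> simp [exampleCoframe, dz] <;> ring

lemma mem_tangentSpace_of_coframe0 {z : C4} (hz : z ∈ exampleM) {v : C4} {r : ℝ}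
    (h : exampleCoframe 0 z v = r) : v ∈ tangentSpace exampleM z := by
  rw [mem_tangentSpace_iff hz]
  rw [coframe0_apply] at h
  have := congrArg Complex.im h
  simp at this
  exact this

/-- Vectors with prescribed values of the coframing. -/
lemma exists_coframe_eq {z : C4} (hz : z ∈ octant) (c0 c1 c2 c3 : ℂ) :
    ∃ v, exampleCoframe 0 z v = c0 ∧ exampleCoframe 1 z v = c1 ∧ exampleCoframe 2 z v = c2 ∧
      exampleCoframe 3 z v = c3 := by
  have hs := sqrt3_ne_zero hz
  have hI := Complex.I_ne_zero
  obtain ⟨v, h1, h2, h3, h4⟩ := exists_frame hz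
    (((c1 + (1 + Complex.I) / (2 * sqrt3 z) * (c0 / (2 * Complex.I))) / sqrt3 z +
      (c2 + (1 - Complex.I) / (2 * sqrt3 z) * (c0 / (2 * Complex.I))) / sqrt3 z) / 2)
    (((c1 + (1 + Complex.I) / (2 * sqrt3 z) * (c0 / (2 * Complex.I))) / sqrt3 z -
      (c2 + (1 - Complex.I) / (2 * sqrt3 z) * (c0 / (2 * Complex.I))) / sqrt3 z) / (2 * Complex.I))
    (c3 - (c0 / (2 * Complex.I)) / (8 * sqrt3 z ^ 2)) (c0 / (2 * Complex.I))
  refine ⟨v, ?_, ?_, ?_, ?_⟩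
  · rw [coframe0_apply, h4]; field_simp
  · rw [coframe1_apply hz, h1, h2, h4]; field_simp; ring
  · rw [coframe2_apply hz, h1, h2, h4]; field_simp; ring
  · rw [coframe3_apply hz, h3, h4]; ring

lemma coframe_injective {z : C4} (hz : z ∈ octant) {v w : C4}
    (h : ∀ j, exampleCoframe j z v = exampleCoframe j z w) : v = w := by
  have hs := sqrt3_ne_zero hz
  have hI := Complex.I_ne_zero
  have h0 := h 0
  have h1 := h 1
  have h2 := h 2
  have h3 := h 3
  rw [coframe0_apply, coframe0_apply] at h0
  have e0 : pC z v = pC z w := mul_left_cancel₀ (mul_ne_zero two_ne_zero hI) h0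
  rw [coframe1_apply hz, coframe1_apply hz, e0] at h1
  rw [coframe2_apply hz, coframe2_apply hz, e0] at h2
  rw [coframe3_apply hz, coframe3_apply hz, e0] at h3
  have h1' := mul_left_cancel₀ hs (sub_left_injective h1)
  have h2' := mul_left_cancel₀ hs (sub_left_injective h2)
  refine frame_injective hz ?_ ?_ (add_left_injective _ h3) e0
  · linear_combination (h1' + h2') / 2
  · refine mul_left_cancel₀ hI ?_
    linear_combination (h1' - h2') / 2

lemma evalC_coframe (j : Fin 4) (z : C4) (X : CVec) :
    evalC (exampleCoframe j z) X = exampleCoframe j z X.1 := by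
  have h : X.1 = cRe X + Complex.I • cIm X := by
    ext i
    simp only [Pi.add_apply, Pi.smul_apply, cRe_apply, cIm_apply, smul_eq_mul]
    linear_combination (1 / 2 : ℂ) * (X.1 i - star (X.2 i)) * Complex.I_mul_I
  rw [h, map_add, coframe_I_smul, evalC]

lemma isZeroAdapted_coframe : IsZeroAdapted exampleM exampleCoframe where
  smooth j := ⟨octant, isOpen_octant, exampleM_subset_octant, contDiffOn_coframe j⟩
  real z hz v hv := by
    rw [mem_tangentSpace_iff hz] at hv
    rw [coframe0_apply]; simp [hv]
  coframe z hz r c := by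
    obtain ⟨v, h0, h1, h2, h3⟩ := exists_coframe_eq (octant_of_mem hz) r (c 0) (c 1) (c 2)
    refine ⟨v, ⟨mem_tangentSpace_of_coframe0 hz h0, h0, ?_⟩, ?_⟩
    · intro j; fin_cases j <;> assumption
    · rintro w ⟨-, k0, k⟩
      refine coframe_injective (octant_of_mem hz) fun j => ?_
      have k1 := k 0
      have k2 := k 1
      have k3 := k 2
      fin_cases j
      exacts [k0.trans h0.symm, k1.trans h1.symm, k2.trans h2.symm, k3.trans h3.symm]
  ann_D z hz v hv := by
    rw [coframe0_apply, (mem_D_iff hz v).1 hv, mul_zero]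
  ann_Hbar z hz X hX j := by
    rw [evalC_coframe, ((mem_Hbar_iff hz X).1 hX).2, map_zero]
  ann_K z hz X hX := by
    obtain ⟨h, h1, h2⟩ := (mem_leviKernel_iff hz X).1 hX
    have hp := ((mem_H_iff hz X).1 h).1
    rw [evalC_coframe, evalC_coframe, coframe1_apply (octant_of_mem hz),
      coframe2_apply (octant_of_mem hz), h1, h2, hp]
    simp

/-! ### Exterior derivatives of the coframing -/

/-- A real tangent vector as a complexified one. -/
def realVec (u : C4) : CVec := (u, star u)

lemma dC_realVec (u : C4) (f : C4 → ℂ) (z : C4) : dC (realVec u) f z = fderiv ℝ f z u := by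
  have h1 : cRe (realVec u) = u := by
    ext j; simp [cRe_apply, realVec]; ring
  have h2 : cIm (realVec u) = 0 := by
    ext j; simp [cIm_apply, realVec]
  rw [dC, evalC, h1, h2]; simp

lemma extd_eq {α : C4 → C4 →L[ℝ] ℂ} {z : C4} (hα : DifferentiableAt ℝ α z) (u v : C4) :
    extd α z u v =
      dC (realVec u) (fun y => α y v) z - dC (realVec v) (fun y => α y u) z := by
  have h : ∀ u v, fderiv ℝ (fun y => α y v) z u = fderiv ℝ α z u v := by
    intro u v
    rw [fderiv_clm_apply hα (differentiableAt_const v)]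
    simp
  rw [dC_realVec, dC_realVec, h, h, extd]

lemma dC_congr {X : CVec} {f g : C4 → ℂ} {z : C4} {U : Set C4} (hU : IsOpen U) (hz : z ∈ U)
    (h : ∀ y ∈ U, f y = g y) : dC X f z = dC X g z := by
  unfold dC
  rw [Filter.EventuallyEq.fderiv_eq]
  filter_upwards [hU.mem_nhds hz] with y hy using h y hy

lemma differentiableAt_sqrt3 {z : C4} (hz : z ∈ octant) : DifferentiableAt ℝ sqrt3 z :=
  (contDiffOn_sqrt3.contDiffAt (isOpen_octant.mem_nhds hz)).differentiableAt (by simp)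

lemma hasDC_sqrt3 {z : C4} (hz : z ∈ octant) (u : C4) :
    HasDC (realVec u) sqrt3 z (sqrt3 z / 2 * (kap z u + star (kap z u))) := by
  have hd := differentiableAt_sqrt3 hz
  have hs := sqrt3_ne_zero hz
  refine ⟨hd, ?_⟩
  have h1 := (HasDC.of_differentiableAt (X := realVec u) hd).mul
    (HasDC.of_differentiableAt (X := realVec u) hd)
  have h2 : dC (realVec u) (fun y => sqrt3 y * sqrt3 y) z =
      dC (realVec u) (fun y => (x 2 y : ℂ)) z :=
    dC_congr isOpen_octant hz fun y hy => by rw [← sqrt3_sq hy, sq]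
  rw [h1.2, dC_x] at h2
  simp only [kap, star_div₀, ← sqrt3_sq hz, star_pow, star_sqrt3, realVec, Pi.star_apply] at h2 ⊢
  field_simp
  linear_combination h2

lemma hasDC_pC_const {z : C4} (hz : z ∈ octant) (u v : C4) :
    HasDC (realVec u) (fun y => pC y v) z
      (-(sqrt3 z ^ 2) * ((th1 z u + star (th1 z u)) * th1 z v +
        (th2 z u + star (th2 z u)) * th2 z v)) := by
  have h := hasDC_pC hz (G := fun _ => v) (fun j => differentiableAt_const (v j)) (realVec u)
  refine ⟨h.1, h.2.trans ?_⟩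
  have h0 : dV (realVec u) (fun _ => v) z = 0 := by
    ext j; exact dC_const _ _ _
  have h1 : th1 z (u + star u) = th1 z u + star (th1 z u) := by
    rw [← th1_star]; simp [th1]; ring
  have h2 : th2 z (u + star u) = th2 z u + star (th2 z u) := by
    rw [← th2_star]; simp [th2]; ring
  rw [h0, hessC, sqrt3_sq hz]
  simp only [realVec, h1, h2]
  simp [pC]

lemma hasDC_kap {z : C4} (hz : z ∈ octant) (u v : C4) :
    HasDC (realVec u) (fun y => kap y v) z (-(kap z u + star (kap z u)) * kap z v) := by
  obtain ⟨h0, h1, h2⟩ := x_ne_zero hz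
  have h := (HasDC.const (X := realVec u) (z := z) (v 2)).div (HasDC.x 2) h2
  refine ⟨h.1, h.2.trans ?_⟩
  simp [kap, realVec]
  field_simp
  ring

lemma hasDC_th1 {z : C4} (hz : z ∈ octant) (u v : C4) :
    HasDC (realVec u) (fun y => th1 y v) z
      (-(th1 z u + kap z u + star (th1 z u) + star (kap z u)) * (th1 z v + kap z v) +
        (kap z u + star (kap z u)) * kap z v) := by
  obtain ⟨h0, h1, h2⟩ := x_ne_zero hz
  have h := ((HasDC.const (X := realVec u) (z := z) (v 0)).div (HasDC.x 0) h0).sub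
    (hasDC_kap hz u v)
  refine ⟨h.1, h.2.trans ?_⟩
  simp [kap, th1, realVec]
  field_simp
  ring

lemma hasDC_th2 {z : C4} (hz : z ∈ octant) (u v : C4) :
    HasDC (realVec u) (fun y => th2 y v) z
      (-(th2 z u + kap z u + star (th2 z u) + star (kap z u)) * (th2 z v + kap z v) +
        (kap z u + star (kap z u)) * kap z v) := by
  obtain ⟨h0, h1, h2⟩ := x_ne_zero hz
  have h := ((HasDC.const (X := realVec u) (z := z) (v 1)).div (HasDC.x 1) h1).sub
    (hasDC_kap hz u v)
  refine ⟨h.1, h.2.trans ?_⟩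
  simp [kap, th2, realVec]
  field_simp
  ring

lemma differentiableAt_coframe {z : C4} (hz : z ∈ octant) (j : Fin 4) :
    DifferentiableAt ℝ (exampleCoframe j) z :=
  ((contDiffOn_coframe j).contDiffAt (isOpen_octant.mem_nhds hz)).differentiableAt (by simp)

lemma extd_coframe0 {z : C4} (hz : z ∈ octant) (u v : C4) : extd (exampleCoframe 0) z u v =
    2 * Complex.I * (-(sqrt3 z ^ 2) * ((th1 z u + star (th1 z u)) * th1 z v +
        (th2 z u + star (th2 z u)) * th2 z v)) -
    2 * Complex.I * (-(sqrt3 z ^ 2) * ((th1 z v + star (th1 z v)) * th1 z u +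
        (th2 z v + star (th2 z v)) * th2 z u)) := by
  rw [extd_eq (differentiableAt_coframe hz 0)]
  have h : ∀ v, (fun y => exampleCoframe 0 y v) = fun y => 2 * Complex.I * pC y v :=
    fun v => funext fun y => coframe0_apply y v
  rw [h, h, ((hasDC_pC_const hz u v).const_mul _).2, ((hasDC_pC_const hz v u).const_mul _).2]

lemma dC_coframe1 {z : C4} (hz : z ∈ octant) (u v : C4) :
    dC (realVec u) (fun y => exampleCoframe 1 y v) z =
      sqrt3 z / 2 * (kap z u + star (kap z u)) * (th1 z v + Complex.I * th2 z v) +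
      sqrt3 z * ((-(th1 z u + kap z u + star (th1 z u) + star (kap z u)) * (th1 z v + kap z v) +
          (kap z u + star (kap z u)) * kap z v) +
        Complex.I * (-(th2 z u + kap z u + star (th2 z u) + star (kap z u)) *
          (th2 z v + kap z v) + (kap z u + star (kap z u)) * kap z v)) +
      (1 + Complex.I) / (4 * sqrt3 z) * (kap z u + star (kap z u)) * pC z v +
      (1 + Complex.I) / 2 * sqrt3 z * ((th1 z u + star (th1 z u)) * th1 z v +
        (th2 z u + star (th2 z u)) * th2 z v) := by
  have hs := sqrt3_ne_zero hz
  rw [dC_congr isOpen_octant hz fun y hy => coframe1_apply hy v]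
  have hS := hasDC_sqrt3 hz u
  have h := (hS.mul ((hasDC_th1 hz u v).add ((hasDC_th2 hz u v).const_mul Complex.I))).sub
    (((HasDC.const (1 + Complex.I)).div (hS.const_mul 2) (mul_ne_zero two_ne_zero hs)).mul
      (hasDC_pC_const hz u v))
  refine h.2.trans ?_
  field_simp
  ring

lemma dC_coframe2 {z : C4} (hz : z ∈ octant) (u v : C4) :
    dC (realVec u) (fun y => exampleCoframe 2 y v) z =
      sqrt3 z / 2 * (kap z u + star (kap z u)) * (th1 z v - Complex.I * th2 z v) +
      sqrt3 z * ((-(th1 z u + kap z u + star (th1 z u) + star (kap z u)) * (th1 z v + kap z v) +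
          (kap z u + star (kap z u)) * kap z v) -
        Complex.I * (-(th2 z u + kap z u + star (th2 z u) + star (kap z u)) *
          (th2 z v + kap z v) + (kap z u + star (kap z u)) * kap z v)) +
      (1 - Complex.I) / (4 * sqrt3 z) * (kap z u + star (kap z u)) * pC z v +
      (1 - Complex.I) / 2 * sqrt3 z * ((th1 z u + star (th1 z u)) * th1 z v +
        (th2 z u + star (th2 z u)) * th2 z v) := by
  have hs := sqrt3_ne_zero hz
  rw [dC_congr isOpen_octant hz fun y hy => coframe2_apply hy v]
  have hS := hasDC_sqrt3 hz u
  have h := (hS.mul ((hasDC_th1 hz u v).sub ((hasDC_th2 hz u v).const_mul Complex.I))).sub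
    (((HasDC.const (1 - Complex.I)).div (hS.const_mul 2) (mul_ne_zero two_ne_zero hs)).mul
      (hasDC_pC_const hz u v))
  refine h.2.trans ?_
  field_simp
  ring

lemma dC_coframe3 {z : C4} (hz : z ∈ octant) (u v : C4) :
    dC (realVec u) (fun y => exampleCoframe 3 y v) z =
      -(kap z u + star (kap z u)) * kap z v -
      ((th1 z u + star (th1 z u)) * th1 z v + (th2 z u + star (th2 z u)) * th2 z v) / 8 -
      pC z v * (kap z u + star (kap z u)) / (8 * sqrt3 z ^ 2) := by
  have hs := sqrt3_ne_zero hz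
  rw [dC_congr isOpen_octant hz fun y hy => (coframe3_apply hy v).trans (by rw [pow_two])]
  have hS := hasDC_sqrt3 hz u
  have h := (hasDC_kap hz u v).add ((hasDC_pC_const hz u v).div ((hS.mul hS).const_mul 8)
    (mul_ne_zero (by norm_num) (mul_ne_zero hs hs)))
  refine h.2.trans ?_
  field_simp
  ring

/-! ### The structure equations -/

/-- The real form `α + ᾱ`. -/
noncomputable def reForm (α : C4 →L[ℝ] ℂ) : C4 →L[ℝ] ℝ := (2 : ℝ) • Complex.reCLM.comp α

lemma ofRealForm_reForm (α : C4 →L[ℝ] ℂ) (v : C4) :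
    ofRealForm (reForm α) v = α v + star (α v) := by
  apply Complex.ext
  · simp [ofRealForm, reForm]; ring
  · simp [ofRealForm, reForm]

lemma conjForm_apply (α : C4 →L[ℝ] ℂ) (v : C4) : conjForm α v = star (α v) := rfl

/-- The connection form `τ` of the example. -/
noncomputable def formTau (z : C4) : C4 →L[ℝ] ℝ :=
  reForm (((1 - Complex.I) / 8 * (sqrt3 z)⁻¹) • exampleCoframe 1 z +
    ((1 + Complex.I) / 8 * (sqrt3 z)⁻¹) • exampleCoframe 2 z)

/-- The connection form `ϱ` of the example. -/
noncomputable def formRho (z : C4) : C4 →L[ℝ] ℝ :=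
  reForm (((-1 - Complex.I) / 8 * (sqrt3 z)⁻¹) • exampleCoframe 1 z +
    ((-1 + Complex.I) / 8 * (sqrt3 z)⁻¹) • exampleCoframe 2 z +
    (Complex.I / 2) • exampleCoframe 3 z)

/-- The connection form `ς` of the example. -/
noncomputable def formSigma (z : C4) : C4 →L[ℝ] ℝ :=
  reForm (((1 + Complex.I) / 8 * (sqrt3 z)⁻¹) • exampleCoframe 1 z +
    ((1 - Complex.I) / 8 * (sqrt3 z)⁻¹) • exampleCoframe 2 z +
    (Complex.I / 2) • exampleCoframe 3 z)

/-- The connection form `γ¹` of the example. -/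
noncomputable def formGamma1 (z : C4) : C4 →L[ℝ] ℂ :=
  ((1 + Complex.I) / 64 * (sqrt3 z)⁻¹ ^ 3) • exampleCoframe 0 z +
    (-Complex.I / 16 * (sqrt3 z)⁻¹ ^ 2) • exampleCoframe 1 z +
    (-1 / 8 * (sqrt3 z)⁻¹ ^ 2) • exampleCoframe 2 z +
    (-1 / 8 * (sqrt3 z)⁻¹ ^ 2) • conjForm (exampleCoframe 1 z) +
    (-Complex.I / 16 * (sqrt3 z)⁻¹ ^ 2) • conjForm (exampleCoframe 2 z)

/-- The connection form `γ²` of the example. -/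
noncomputable def formGamma2 (z : C4) : C4 →L[ℝ] ℂ :=
  ((1 - Complex.I) / 64 * (sqrt3 z)⁻¹ ^ 3) • exampleCoframe 0 z +
    (1 / 8 * (sqrt3 z)⁻¹ ^ 2) • exampleCoframe 1 z +
    (-Complex.I / 16 * (sqrt3 z)⁻¹ ^ 2) • exampleCoframe 2 z +
    (-Complex.I / 16 * (sqrt3 z)⁻¹ ^ 2) • conjForm (exampleCoframe 1 z) +
    (1 / 8 * (sqrt3 z)⁻¹ ^ 2) • conjForm (exampleCoframe 2 z)

lemma contDiffOn_inv_sqrt3_pow (a : ℂ) (n : ℕ) :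
    ContDiffOn ℝ ∞ (fun z => a * (sqrt3 z)⁻¹ ^ n) octant :=
  contDiffOn_const.mul ((contDiffOn_sqrt3.inv fun _ hz => sqrt3_ne_zero hz).pow n)

lemma contDiffOn_inv_sqrt3 (a : ℂ) : ContDiffOn ℝ ∞ (fun z => a * (sqrt3 z)⁻¹) octant := by
  simpa using contDiffOn_inv_sqrt3_pow a 1

lemma contDiffOn_reForm {α : C4 → C4 →L[ℝ] ℂ} (h : ContDiffOn ℝ ∞ α octant) :
    ContDiffOn ℝ ∞ (fun z => reForm (α z)) octant :=
  (contDiffOn_const.clm_comp h).const_smul (2 : ℝ)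

lemma contDiffOn_conjForm {α : C4 → C4 →L[ℝ] ℂ} (h : ContDiffOn ℝ ∞ α octant) :
    ContDiffOn ℝ ∞ (fun z => conjForm (α z)) octant :=
  contDiffOn_const.clm_comp h

lemma smoothNear_of_octant {V : Type} [NormedAddCommGroup V] [NormedSpace ℝ V] {α : C4 → V}
    (h : ContDiffOn ℝ ∞ α octant) : SmoothNear exampleM α :=
  ⟨octant, isOpen_octant, exampleM_subset_octant, h⟩

lemma smoothNear_formTau : SmoothNear exampleM formTau :=
  smoothNear_of_octant (contDiffOn_reForm
    (((contDiffOn_inv_sqrt3 _).smul (contDiffOn_coframe 1)).add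
      ((contDiffOn_inv_sqrt3 _).smul (contDiffOn_coframe 2))))

lemma smoothNear_formRho : SmoothNear exampleM formRho :=
  smoothNear_of_octant (contDiffOn_reForm
    ((((contDiffOn_inv_sqrt3 _).smul (contDiffOn_coframe 1)).add
      ((contDiffOn_inv_sqrt3 _).smul (contDiffOn_coframe 2))).add
      ((contDiffOn_coframe 3).const_smul (Complex.I / 2))))

lemma smoothNear_formSigma : SmoothNear exampleM formSigma :=
  smoothNear_of_octant (contDiffOn_reForm
    ((((contDiffOn_inv_sqrt3 _).smul (contDiffOn_coframe 1)).add
      ((contDiffOn_inv_sqrt3 _).smul (contDiffOn_coframe 2))).add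
      ((contDiffOn_coframe 3).const_smul (Complex.I / 2))))

lemma smoothNear_formGamma1 : SmoothNear exampleM formGamma1 :=
  smoothNear_of_octant (((((contDiffOn_inv_sqrt3_pow _ 3).smul (contDiffOn_coframe 0)).add
    ((contDiffOn_inv_sqrt3_pow _ 2).smul (contDiffOn_coframe 1))).add
    ((contDiffOn_inv_sqrt3_pow _ 2).smul (contDiffOn_coframe 2))).add
    ((contDiffOn_inv_sqrt3_pow _ 2).smul (contDiffOn_conjForm (contDiffOn_coframe 1))) |>.add
    ((contDiffOn_inv_sqrt3_pow _ 2).smul (contDiffOn_conjForm (contDiffOn_coframe 2))))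

lemma smoothNear_formGamma2 : SmoothNear exampleM formGamma2 :=
  smoothNear_of_octant (((((contDiffOn_inv_sqrt3_pow _ 3).smul (contDiffOn_coframe 0)).add
    ((contDiffOn_inv_sqrt3_pow _ 2).smul (contDiffOn_coframe 1))).add
    ((contDiffOn_inv_sqrt3_pow _ 2).smul (contDiffOn_coframe 2))).add
    ((contDiffOn_inv_sqrt3_pow _ 2).smul (contDiffOn_conjForm (contDiffOn_coframe 1))) |>.add
    ((contDiffOn_inv_sqrt3_pow _ 2).smul (contDiffOn_conjForm (contDiffOn_coframe 2))))

section StructureEquations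

variable {z u v : C4}

lemma star_pC_of_tangent (hz : z ∈ exampleM) (hv : v ∈ tangentSpace exampleM z) :
    star (pC z v) = -pC z v := by
  rw [mem_tangentSpace_iff hz] at hv
  apply Complex.ext <;> simp [hv]

/-- On the tangent space `p` is imaginary, so that after expressing all forms through `th1`, `th2`,
`kap` and `p` each structure equation is an identity of rational functions in the values of `th1`,
`th2`, `kap`, their conjugates, `p`, `√x₃` and `i`. -/
lemma structure_equation0 (hz : z ∈ exampleM) (hu : u ∈ tangentSpace exampleM z)
    (hv : v ∈ tangentSpace exampleM z) :
    extd (exampleCoframe 0) z u v =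
        -2 * wedge (ofRealForm (formTau z)) (exampleCoframe 0 z) u v
        + Complex.I * wedge (exampleCoframe 1 z) (conjForm (exampleCoframe 1 z)) u v
        + Complex.I * wedge (exampleCoframe 2 z) (conjForm (exampleCoframe 2 z)) u v := by
  have hzo := octant_of_mem hz
  have qu := star_pC_of_tangent hz hu
  have qv := star_pC_of_tangent hz hv
  have hs := sqrt3_ne_zero hzo
  have hss := star_sqrt3 z
  rw [extd_coframe0 hzo]
  simp only [wedge, formTau, ofRealForm_reForm, conjForm_apply, add_apply,
    smul_apply, smul_eq_mul, coframe0_apply, coframe1_apply hzo, coframe2_apply hzo]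
  generalize th1 z u = a at *
  generalize th2 z u = b at *
  generalize kap z u = k at *
  generalize pC z u = q at *
  generalize th1 z v = a' at *
  generalize th2 z v = b' at *
  generalize kap z v = k' at *
  generalize pC z v = q' at *
  generalize sqrt3 z = s at *
  simp only [star_add, star_sub, star_mul', star_div₀, star_inv₀, star_ofNat, hss, qu, qv,
    star_one, show star Complex.I = -Complex.I from Complex.conj_I]
  generalize star a = A at *
  generalize star b = B at *
  generalize star a' = A' at *
  generalize star b' = B' at *
  have i2 : Complex.I ^ 2 = -1 := Complex.I_sq
  have i3 : Complex.I ^ 3 = -Complex.I := by rw [pow_succ, i2]; ring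
  have i4 : Complex.I ^ 4 = 1 := Complex.I_pow_four
  generalize Complex.I = i at *
  field_simp
  ring_nf
  simp only [i3]
  ring

lemma structure_equation1 (hz : z ∈ exampleM) (hu : u ∈ tangentSpace exampleM z)
    (hv : v ∈ tangentSpace exampleM z) :
    extd (exampleCoframe 1) z u v =
        -wedge (formGamma1 z) (exampleCoframe 0 z) u v
        - wedge (ofRealForm (formTau z) + Complex.I • ofRealForm (formRho z))
            (exampleCoframe 1 z) u v
        + wedge (exampleCoframe 3 z) (conjForm (exampleCoframe 2 z)) u v
        + exampleF1 z * wedge (conjForm (exampleCoframe 1 z)) (exampleCoframe 2 z) u v := by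
  have hzo := octant_of_mem hz
  have qu := star_pC_of_tangent hz hu
  have qv := star_pC_of_tangent hz hv
  have hs := sqrt3_ne_zero hzo
  have hss := star_sqrt3 z
  rw [extd_eq (differentiableAt_coframe hzo 1), dC_coframe1 hzo, dC_coframe1 hzo]
  simp only [wedge, formGamma1, formTau, formRho, exampleF1, ofRealForm_reForm, conjForm_apply,
    add_apply, smul_apply, smul_eq_mul, coframe0_apply, coframe1_apply hzo, coframe2_apply hzo,
    coframe3_apply hzo]
  generalize th1 z u = a at *
  generalize th2 z u = b at *
  generalize kap z u = k at *
  generalize pC z u = q at *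
  generalize th1 z v = a' at *
  generalize th2 z v = b' at *
  generalize kap z v = k' at *
  generalize pC z v = q' at *
  generalize sqrt3 z = s at *
  simp only [star_add, star_sub, star_mul', star_div₀, star_inv₀, star_pow, star_ofNat, hss, qu, qv,
    star_one, star_neg, show star Complex.I = -Complex.I from Complex.conj_I]
  generalize star k = K at *
  generalize star k' = K' at *
  generalize star a = A at *
  generalize star b = B at *
  generalize star a' = A' at *
  generalize star b' = B' at *
  have i2 : Complex.I ^ 2 = -1 := Complex.I_sq
  have i3 : Complex.I ^ 3 = -Complex.I := by rw [pow_succ, i2]; ring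
  have i4 : Complex.I ^ 4 = 1 := Complex.I_pow_four
  generalize Complex.I = i at *
  field_simp
  ring_nf
  simp only [i2, i3, i4]
  ring

lemma structure_equation2 (hz : z ∈ exampleM) (hu : u ∈ tangentSpace exampleM z)
    (hv : v ∈ tangentSpace exampleM z) :
    extd (exampleCoframe 2) z u v =
        -wedge (formGamma2 z) (exampleCoframe 0 z) u v
        - wedge (ofRealForm (formTau z) + Complex.I • ofRealForm (formSigma z))
            (exampleCoframe 2 z) u v
        + wedge (exampleCoframe 3 z) (conjForm (exampleCoframe 1 z)) u v
        + exampleF2 z * wedge (conjForm (exampleCoframe 2 z)) (exampleCoframe 1 z) u v := by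
  have hzo := octant_of_mem hz
  have qu := star_pC_of_tangent hz hu
  have qv := star_pC_of_tangent hz hv
  have hs := sqrt3_ne_zero hzo
  have hss := star_sqrt3 z
  rw [extd_eq (differentiableAt_coframe hzo 2), dC_coframe2 hzo, dC_coframe2 hzo]
  simp only [wedge, formGamma2, formTau, formSigma, exampleF2, ofRealForm_reForm, conjForm_apply,
    add_apply, smul_apply, smul_eq_mul, coframe0_apply, coframe1_apply hzo, coframe2_apply hzo,
    coframe3_apply hzo]
  generalize th1 z u = a at *
  generalize th2 z u = b at *
  generalize kap z u = k at *
  generalize pC z u = q at *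
  generalize th1 z v = a' at *
  generalize th2 z v = b' at *
  generalize kap z v = k' at *
  generalize pC z v = q' at *
  generalize sqrt3 z = s at *
  simp only [star_add, star_sub, star_mul', star_div₀, star_inv₀, star_pow, star_ofNat, hss, qu, qv,
    star_one, show star Complex.I = -Complex.I from Complex.conj_I]
  generalize star k = K at *
  generalize star k' = K' at *
  generalize star a = A at *
  generalize star b = B at *
  generalize star a' = A' at *
  generalize star b' = B' at *
  have i2 : Complex.I ^ 2 = -1 := Complex.I_sq
  have i3 : Complex.I ^ 3 = -Complex.I := by rw [pow_succ, i2]; ring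
  have i4 : Complex.I ^ 4 = 1 := Complex.I_pow_four
  generalize Complex.I = i at *
  field_simp
  ring_nf
  simp only [i2, i3, i4]
  ring

lemma structure_equation3 (hz : z ∈ exampleM) (hu : u ∈ tangentSpace exampleM z)
    (hv : v ∈ tangentSpace exampleM z) :
    extd (exampleCoframe 3) z u v =
        -Complex.I * wedge (formGamma2 z) (exampleCoframe 1 z) u v
        - Complex.I * wedge (formGamma1 z) (exampleCoframe 2 z) u v
        - wedge (Complex.I • ofRealForm (formRho z) + Complex.I • ofRealForm (formSigma z))
            (exampleCoframe 3 z) u v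
        + ((-1 + Complex.I) / 64 * (sqrt3 z)⁻¹ ^ 3) *
            wedge (conjForm (exampleCoframe 1 z)) (exampleCoframe 0 z) u v
        + ((1 + Complex.I) / 64 * (sqrt3 z)⁻¹ ^ 3) *
            wedge (conjForm (exampleCoframe 2 z)) (exampleCoframe 0 z) u v
        + (Complex.I / 8 * (sqrt3 z)⁻¹ ^ 2) *
            wedge (conjForm (exampleCoframe 2 z)) (exampleCoframe 1 z) u v
        + (-Complex.I / 8 * (sqrt3 z)⁻¹ ^ 2) *
            wedge (conjForm (exampleCoframe 1 z)) (exampleCoframe 2 z) u v := by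
  have hzo := octant_of_mem hz
  have qu := star_pC_of_tangent hz hu
  have qv := star_pC_of_tangent hz hv
  have hs := sqrt3_ne_zero hzo
  have hss := star_sqrt3 z
  rw [extd_eq (differentiableAt_coframe hzo 3), dC_coframe3 hzo, dC_coframe3 hzo]
  simp only [wedge, formGamma1, formGamma2, formRho, formSigma, ofRealForm_reForm, conjForm_apply,
    add_apply, smul_apply, smul_eq_mul, coframe0_apply, coframe1_apply hzo, coframe2_apply hzo,
    coframe3_apply hzo]
  generalize th1 z u = a at *
  generalize th2 z u = b at *
  generalize kap z u = k at *
  generalize pC z u = q at *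
  generalize th1 z v = a' at *
  generalize th2 z v = b' at *
  generalize kap z v = k' at *
  generalize pC z v = q' at *
  generalize sqrt3 z = s at *
  simp only [star_add, star_sub, star_mul', star_div₀, star_inv₀, star_pow, star_ofNat, hss, qu, qv,
    star_one, star_neg, show star Complex.I = -Complex.I from Complex.conj_I]
  generalize star k = K at *
  generalize star k' = K' at *
  generalize star a = A at *
  generalize star b = B at *
  generalize star a' = A' at *
  generalize star b' = B' at *
  have i2 : Complex.I ^ 2 = -1 := Complex.I_sq
  have i3 : Complex.I ^ 3 = -Complex.I := by rw [pow_succ, i2]; ring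
  have i4 : Complex.I ^ 4 = 1 := Complex.I_pow_four
  generalize Complex.I = i at *
  field_simp
  ring_nf
  simp only [i2, i4]
  ring

end StructureEquations

/-! ### The coefficients of the fundamental invariants -/

lemma hasFundamentalCoefficients_example {F1 F2 : C4 → ℂ}
    (hF : ∀ z ∈ exampleM, F1 z = exampleF1 z ∧ F2 z = exampleF2 z) :
    HasFundamentalCoefficients exampleM exampleCoframe F1 F2 := by
  refine ⟨isZeroAdapted_coframe, formTau, formRho, formSigma, formGamma1, formGamma2, 0, 0,
    fun z => (-1 + Complex.I) / 64 * (sqrt3 z)⁻¹ ^ 3,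
    fun z => (1 + Complex.I) / 64 * (sqrt3 z)⁻¹ ^ 3,
    fun z => Complex.I / 8 * (sqrt3 z)⁻¹ ^ 2, fun z => -Complex.I / 8 * (sqrt3 z)⁻¹ ^ 2,
    smoothNear_formTau, smoothNear_formRho, smoothNear_formSigma, smoothNear_formGamma1,
    smoothNear_formGamma2, ?_⟩
  intro z hz u hu v hv
  rw [(hF z hz).1, (hF z hz).2]
  refine ⟨structure_equation0 hz hu hv, structure_equation1 hz hu hv,
    structure_equation2 hz hu hv, ?_⟩
  rw [structure_equation3 hz hu hv]
  simp only [Pi.zero_apply, Complex.ofReal_zero]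
  ring

/-- The coefficients are determined by the coframing: evaluate the second and third structure
equations on vectors dual to `η¹` and `η²`, and use that multiplication by `i` separates the
coefficient of `η¹̄ ∧ η²` from that of `η¹ ∧ η²`. -/
lemma eq_of_hasFundamentalCoefficients {F1 F2 G1 G2 : C4 → ℂ}
    (hF : HasFundamentalCoefficients exampleM exampleCoframe F1 F2)
    (hG : HasFundamentalCoefficients exampleM exampleCoframe G1 G2) :
    ∀ z ∈ exampleM, F1 z = G1 z ∧ F2 z = G2 z := by
  intro z hz
  have hzo := octant_of_mem hz
  obtain ⟨u, u0, u1, u2, u3⟩ := exists_coframe_eq hzo 0 1 0 0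
  obtain ⟨v, v0, v1, v2, v3⟩ := exists_coframe_eq hzo 0 0 1 0
  have I0 : ∀ {w}, exampleCoframe 0 z w = 0 → exampleCoframe 0 z (Complex.I • w) = 0 := by
    intro w hw; rw [coframe_I_smul, hw, mul_zero]
  have T : ∀ {w}, exampleCoframe 0 z w = 0 → w ∈ tangentSpace exampleM z := fun h =>
    mem_tangentSpace_of_coframe0 hz (r := 0) (by simpa using h)
  have i2 := Complex.I_mul_I
  have key : ∀ {F1 F2 : C4 → ℂ}, HasFundamentalCoefficients exampleM exampleCoframe F1 F2 →
      2 * F1 z = extd (exampleCoframe 1) z u v +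
        Complex.I * extd (exampleCoframe 1) z (Complex.I • u) v ∧
      2 * F2 z = extd (exampleCoframe 2) z v u +
        Complex.I * extd (exampleCoframe 2) z (Complex.I • v) u := by
    intro F1 F2 hF
    obtain ⟨-, τ, ϱ, ς, γ1, γ2, f3, t3, T1, T2, F31, F32, -, -, -, -, -, h⟩ := hF
    obtain ⟨-, a1, -, -⟩ := h z hz u (T u0) v (T v0)
    obtain ⟨-, b1, -, -⟩ := h z hz _ (T (I0 u0)) v (T v0)
    obtain ⟨-, -, a2, -⟩ := h z hz v (T v0) u (T u0)
    obtain ⟨-, -, b2, -⟩ := h z hz _ (T (I0 v0)) u (T u0)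
    simp only [wedge, conjForm_apply, coframe_I_smul, u0, u1, u2, u3, v0, v1, v2, v3] at a1 a2 b1 b2
    rw [a1, b1, a2, b2]
    simp only [star_mul', star_one, star_zero, show star Complex.I = -Complex.I from Complex.conj_I]
    constructor
    · linear_combination (-(ofRealForm (τ z) + Complex.I • ofRealForm (ϱ z)) v + F1 z) * i2
    · linear_combination (-(ofRealForm (τ z) + Complex.I • ofRealForm (ς z)) u + F2 z) * i2
  obtain ⟨f1, f2⟩ := key hF
  obtain ⟨g1, g2⟩ := key hG
  exact ⟨by linear_combination (f1 - g1) / 2, by linear_combination (f2 - g2) / 2⟩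

lemma hasFundamentalCoefficients_iff (F1 F2 : C4 → ℂ) :
    HasFundamentalCoefficients exampleM exampleCoframe F1 F2 ↔
      ∀ z ∈ exampleM, F1 z = exampleF1 z ∧ F2 z = exampleF2 z :=
  ⟨fun h => eq_of_hasFundamentalCoefficients h
    (hasFundamentalCoefficients_example fun _ _ => ⟨rfl, rfl⟩),
    hasFundamentalCoefficients_example⟩

lemma exampleF_ne_zero {z : C4} (hz : z ∈ exampleM) : exampleF1 z ≠ 0 ∧ exampleF2 z ≠ 0 := by
  have hs := sqrt3_ne_zero (octant_of_mem hz)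
  constructor
  · refine div_ne_zero (fun h => ?_) (mul_ne_zero (by norm_num) hs)
    simpa using congrArg Complex.im h
  · refine div_ne_zero (fun h => ?_) (mul_ne_zero (by norm_num) hs)
    simpa using congrArg Complex.im h

/-! ### The Hermitian form and the planes of the homogeneous model -/

section Herm

variable (a b c : C4) (r : ℂ)

lemma herm_add_left : herm (a + b) c = herm a c + herm b c := by simp [herm]; ring

lemma herm_add_right : herm a (b + c) = herm a b + herm a c := by simp [herm]; ring

lemma herm_smul_left : herm (r • a) b = r * herm a b := by simp [herm]; ring

lemma herm_smul_right : herm a (r • b) = star r * herm a b := by simp [herm]; ring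

lemma herm_sub_left : herm (a - b) c = herm a c - herm b c := by simp [herm]; ring

lemma herm_zero_left : herm 0 a = 0 := by simp [herm]

lemma herm_zero_right : herm a 0 = 0 := by simp [herm]

lemma herm_symm : herm b a = star (herm a b) := by simp [herm]; ring

end Herm

/-- Linear algebra of a plane `P` of the model with basis `u1`, `u2`, where `u2` is not null and
`N = u1 + t u2` is orthogonal to `u2`: the vector `N` is orthogonal to all of `P`, the Hermitian
form is negative on `u2`, and the orthogonal complement of `P` is spanned by `N` and a unit vector
`k`. -/
lemma exists_of_mem_model {u1 u2 : C4} (hP : Submodule.span ℂ {u1, u2} ∈ model)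
    (hd : herm u2 u2 ≠ 0) {t : ℂ} (hN : herm (u1 + t • u2) u2 = 0) :
    herm (u1 + t • u2) u1 = 0 ∧ (∃ d : ℝ, d < 0 ∧ herm u2 u2 = d) ∧
      ∃ k, herm k k = 1 ∧ herm k u1 = 0 ∧ herm k u2 = 0 ∧
        ∀ ξ, herm ξ u1 = 0 → herm ξ u2 = 0 → ∃ f : ℂ, ξ = herm ξ k • k + f • (u1 + t • u2) := by
  obtain ⟨B, ⟨hdet, hB⟩, hspan⟩ := hP
  have hunit : IsUnit B.det := by rw [hdet]; exact isUnit_one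
  have hinj : ∀ y y', B.mulVec y = B.mulVec y' → y = y' := fun y y' h =>
    Matrix.mulVec_injective_of_isUnit ((Matrix.isUnit_iff_isUnit_det B).2 hunit) h
  have hsurj : ∀ ξ, ∃ y, ξ = B.mulVec y := fun ξ =>
    ⟨B⁻¹.mulVec ξ, by rw [Matrix.mulVec_mulVec, Matrix.mul_nonsing_inv B hunit, Matrix.one_mulVec]⟩
  have hco : ∀ a b : ℂ, a • B.mulVec ![1, 0, 0, 0] + b • B.mulVec ![0, 1, 0, 0] =
      B.mulVec ![a, b, 0, 0] := by
    intro a b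
    rw [← Matrix.mulVec_smul, ← Matrix.mulVec_smul, ← Matrix.mulVec_add]
    congr 1
    ext j; fin_cases j <;> simp
  have hmem : ∀ y, y ∈ Submodule.span ℂ {u1, u2} → ∃ a b : ℂ, y = B.mulVec ![a, b, 0, 0] := by
    intro y hy
    rw [hspan, Submodule.mem_span_pair] at hy
    obtain ⟨a, b, h⟩ := hy
    exact ⟨a, b, by rw [← h, hco]⟩
  obtain ⟨a1, b1, h1⟩ := hmem u1 (Submodule.subset_span (by simp))
  obtain ⟨a2, b2, h2⟩ := hmem u2 (Submodule.subset_span (by simp))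
  have hNB : u1 + t • u2 = B.mulVec ![a1 + t * a2, b1 + t * b2, 0, 0] := by
    rw [h1, h2, ← hco a1 b1, ← hco a2 b2, ← hco (a1 + t * a2)]; module
  have hd' : herm u2 u2 = -(b2 * star b2) := by
    rw [h2, hB]; simp [herm]
  have hb2 : b2 ≠ 0 := by
    rintro rfl
    exact hd (by rw [hd']; simp)
  have hbN : b1 + t * b2 = 0 := by
    rw [hNB, h2, hB] at hN
    simpa [herm, hb2] using hN
  rw [hbN] at hNB
  -- the radical is spanned by the first basis vector; it is nonzero as `u₁`, `u₂` are independent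
  have haN : a1 + t * a2 ≠ 0 := by
    intro h0
    have hm : B.mulVec ![1, 0, 0, 0] ∈ Submodule.span ℂ {u1, u2} := by
      rw [hspan]; exact Submodule.subset_span (by simp)
    obtain ⟨α, β, h⟩ := Submodule.mem_span_pair.1 hm
    have e : α • u1 + β • u2 = (β - α * t) • u2 + α • (u1 + t • u2) := by module
    rw [e, hNB, h0, h2, ← hco a2 b2, ← hco 0 0] at h
    have h' : B.mulVec ![(β - α * t) * a2, (β - α * t) * b2, 0, 0] = B.mulVec ![1, 0, 0, 0] := by
      refine (hco _ _).symm.trans (Eq.trans ?_ h)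
      module
    have h'' := hinj _ _ h'
    have k0 := congrFun h'' 0
    have k1 := congrFun h'' 1
    simp [hb2] at k0 k1
    rw [k1] at k0
    simp at k0
  refine ⟨?_, ⟨-Complex.normSq b2, neg_neg_of_pos (Complex.normSq_pos.2 hb2), ?_⟩,
    B.mulVec ![0, 0, 1, 0], ?_, ?_, ?_, ?_⟩
  · rw [hNB, h1, hB]; simp [herm]
  · rw [hd', Complex.ofReal_neg, Complex.normSq_eq_conj_mul_self, mul_comm]; rfl
  · rw [hB]; simp [herm]
  · rw [h1, hB]; simp [herm]
  · rw [h2, hB]; simp [herm]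
  · intro ξ hξ1 hξ2
    obtain ⟨y, rfl⟩ := hsurj ξ
    have hξN : herm (B.mulVec y) (u1 + t • u2) = 0 := by
      rw [herm_add_right, herm_smul_right, hξ1, hξ2]; simp
    rw [hNB, hB] at hξN
    have haN' : star (a1 + t * a2) ≠ 0 := star_ne_zero.2 haN
    have y3 : y 3 = 0 := by
      have : y 3 * star (a1 + t * a2) = 0 := by simpa [herm] using hξN
      exact (mul_eq_zero.1 this).resolve_right haN'
    rw [h2, hB] at hξ2
    have y1 : y 1 = 0 := by
      have : y 1 * star b2 = 0 := by simpa [herm, y3] using hξ2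
      exact (mul_eq_zero.1 this).resolve_right (star_ne_zero.2 hb2)
    refine ⟨y 0 / (a1 + t * a2), ?_⟩
    rw [hNB, hB, ← Matrix.mulVec_smul, ← Matrix.mulVec_smul, ← Matrix.mulVec_add]
    congr 1
    ext j
    fin_cases j
    · simp; field_simp
    · simp [y1]
    · simp [herm]
    · simp [y3]

/-- In any basis of a plane of the model, one of the basis vectors is not null. -/
lemma herm_ne_zero_of_mem_model {u1 u2 : C4} (hP : Submodule.span ℂ {u1, u2} ∈ model) :
    herm u1 u1 ≠ 0 ∨ herm u2 u2 ≠ 0 := by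
  obtain ⟨B, ⟨hdet, hB⟩, hspan⟩ := hP
  have key : ∀ y ∈ Submodule.span ℂ {u1, u2}, herm y y = 0 →
      herm y (B.mulVec ![0, 1, 0, 0]) = 0 := by
    intro y hy h0
    rw [hspan, Submodule.mem_span_pair] at hy
    obtain ⟨a, b, rfl⟩ := hy
    simp only [herm_add_left, herm_add_right, herm_smul_left, herm_smul_right, hB] at h0 ⊢
    simp [herm] at h0 ⊢
    exact h0
  by_contra! h
  have k1 := key u1 (Submodule.subset_span (by simp)) h.1
  have k2 := key u2 (Submodule.subset_span (by simp)) h.2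
  have hm : B.mulVec ![0, 1, 0, 0] ∈ Submodule.span ℂ {u1, u2} := by
    rw [hspan]; exact Submodule.subset_span (by simp)
  obtain ⟨α, β, hαβ⟩ := Submodule.mem_span_pair.1 hm
  have h1 : herm (B.mulVec ![0, 1, 0, 0]) (B.mulVec ![0, 1, 0, 0]) = 0 := by
    nth_rewrite 1 [← hαβ]
    rw [herm_add_left, herm_smul_left, herm_smul_left, k1, k2]; simp
  rw [hB] at h1
  simp [herm] at h1

/-! ### Derivatives of vector valued functions and of the Hermitian form -/

lemma hasDC_herm {F G : C4 → C4} {z : C4} {X : CVec} (hF : DifferentiableAt ℝ F z)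
    (hG : DifferentiableAt ℝ G z) :
    HasDC X (fun y => herm (F y) (G y)) z
      (herm (dV X F z) (G z) + herm (F z) (dV (cConj X) G z)) := by
  have f := fun j => HasDC.of_differentiableAt (X := X) (differentiableAt_pi.1 hF j)
  have g := fun j => (HasDC.of_differentiableAt (X := cConj X) (differentiableAt_pi.1 hG j)).star
  obtain ⟨h1, h2⟩ := ((((f 0).mul (g 3)).add ((f 3).mul (g 0))).sub ((f 1).mul (g 1))).add
    ((f 2).mul (g 2))
  refine ⟨h1, h2.trans ?_⟩
  simp only [herm, dV]
  ring

lemma dV_smul_fun {f : C4 → ℂ} {F : C4 → C4} {z : C4} (X : CVec) (hf : DifferentiableAt ℝ f z)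
    (hF : DifferentiableAt ℝ F z) :
    dV X (fun y => f y • F y) z = dC X f z • F z + f z • dV X F z := by
  ext j
  exact dC_mul X hf (differentiableAt_pi.1 hF j)

lemma dV_add_fun {F G : C4 → C4} {z : C4} (X : CVec) (hF : DifferentiableAt ℝ F z)
    (hG : DifferentiableAt ℝ G z) : dV X (fun y => F y + G y) z = dV X F z + dV X G z := by
  ext j
  exact dC_add X (differentiableAt_pi.1 hF j) (differentiableAt_pi.1 hG j)

lemma dV_congr_of_tangent {S U : Set C4} {F G : C4 → C4} {z : C4} {X : CVec}
    (hF : DifferentiableAt ℝ F z) (hG : DifferentiableAt ℝ G z) (hU : IsOpen U) (hz : z ∈ U)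
    (h : ∀ y ∈ S ∩ U, F y = G y) (hX : X ∈ CD S z) : dV X F z = dV X G z := by
  ext j
  exact dC_congr_of_tangent (differentiableAt_pi.1 hF j) (differentiableAt_pi.1 hG j) hU hz
    (fun y hy => by rw [h y hy]) hX

lemma differentiableAt_fderiv_of_contDiffAt {f : C4 → ℂ} {z : C4} (hf : ContDiffAt ℝ ∞ f z) :
    DifferentiableAt ℝ (fderiv ℝ f) z :=
  (hf.fderiv_right (m := ∞) (by simp)).differentiableAt (by simp)

lemma differentiableAt_dV {F : C4 → C4} {X : C4 → CVec} {z : C4} (hF : ContDiffAt ℝ ∞ F z)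
    (hX : DifferentiableAt ℝ X z) : DifferentiableAt ℝ (fun y => dV (X y) F y) z :=
  differentiableAt_pi.2 fun j =>
    differentiableAt_dC (differentiableAt_fderiv_of_contDiffAt (contDiffAt_pi.1 hF j)) hX

lemma dV_bracket {F : C4 → C4} {X Y : C4 → CVec} {z : C4} (hF : ContDiffAt ℝ ∞ F z)
    (hX : DifferentiableAt ℝ X z) (hY : DifferentiableAt ℝ Y z) :
    dV (bracket X Y z) F z =
      dV (X z) (fun y => dV (Y y) F y) z - dV (Y z) (fun y => dV (X y) F y) z := by
  ext j
  exact dC_bracket (contDiffAt_pi.1 hF j) hX hY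

/-! ### Planes of the model along the example -/

/-- The data obtained by pulling back to the example, along a local CR equivalence, a holomorphic
basis of the planes of the model: `u1 z`, `u2 z` span a plane of the model for `z` in `M`, they are
CR functions of `z`, their derivatives lie in a fixed complement `V` of the planes, and the map into
the Grassmannian is immersive on the CR bundle. Moreover `u2` is not null. -/
structure IsModelFrame (W : Set C4) (V : Submodule ℂ C4) (u1 u2 : C4 → C4) : Prop where
  isOpen : IsOpen W
  smooth1 : ContDiffOn ℝ ∞ u1 W
  smooth2 : ContDiffOn ℝ ∞ u2 W
  mem_model : ∀ z ∈ exampleM ∩ W, Submodule.span ℂ {u1 z, u2 z} ∈ model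
  cr : ∀ z ∈ exampleM ∩ W, ∀ X ∈ H exampleM z, dV (cConj X) u1 z = 0 ∧ dV (cConj X) u2 z = 0
  finrank_le : Module.finrank ℂ V ≤ 2
  disjoint : ∀ z ∈ exampleM ∩ W, Disjoint V (Submodule.span ℂ {u1 z, u2 z})
  deriv_mem : ∀ z ∈ exampleM ∩ W, ∀ X ∈ H exampleM z, dV X u1 z ∈ V ∧ dV X u2 z ∈ V
  immersive : ∀ z ∈ exampleM ∩ W, ∀ X ∈ H exampleM z, dV X u1 z = 0 → dV X u2 z = 0 → X = 0
  herm_ne_zero : ∀ z ∈ W, herm (u2 z) (u2 z) ≠ 0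

lemma contDiffAt_herm {F G : C4 → C4} {z : C4} (hF : ContDiffAt ℝ ∞ F z)
    (hG : ContDiffAt ℝ ∞ G z) : ContDiffAt ℝ ∞ (fun y => herm (F y) (G y)) z := by
  have f := contDiffAt_pi.1 hF
  have g : ∀ j, ContDiffAt ℝ ∞ (fun y => star (G y j)) z := fun j =>
    (Complex.conjCLE : ℂ →L[ℝ] ℂ).contDiff.contDiffAt.comp z (contDiffAt_pi.1 hG j)
  exact ((((f 0).mul (g 3)).add ((f 3).mul (g 0))).sub ((f 1).mul (g 1))).add ((f 2).mul (g 2))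

/-- The coefficient of the radical vector `u₁ + t u₂`. -/
noncomputable def radCoeff (u1 u2 : C4 → C4) (z : C4) : ℂ :=
  -herm (u1 z) (u2 z) / herm (u2 z) (u2 z)

/-- The vector `u₁ + t u₂` spanning the radical of the plane. -/
noncomputable def radVec (u1 u2 : C4 → C4) (z : C4) : C4 := u1 z + radCoeff u1 u2 z • u2 z

/-- A smooth global vector field which is a section of the CR bundle along the example. -/
def IsCRSection (X : C4 → CVec) : Prop :=
  ContDiff ℝ ∞ X ∧ ∀ z ∈ exampleM, X z ∈ H exampleM z

lemma isCRSection_E : IsCRSection fieldE := ⟨contDiff_fieldE, fun _ => fieldE_mem⟩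

lemma isCRSection_Y1 : IsCRSection fieldY1 := ⟨contDiff_fieldY1, fun _ => fieldY1_mem⟩

lemma isCRSection_Y2 : IsCRSection fieldY2 := ⟨contDiff_fieldY2, fun _ => fieldY2_mem⟩

namespace IsCRSection

variable {X : C4 → CVec} {z : C4}

lemma differentiableAt (hX : IsCRSection X) (z : C4) : DifferentiableAt ℝ X z :=
  hX.1.differentiable (by simp) z

lemma mem_CD (hX : IsCRSection X) (hz : z ∈ exampleM) : X z ∈ CD exampleM z := (hX.2 z hz).1

lemma conj_mem_CD (hX : IsCRSection X) (hz : z ∈ exampleM) : conjField X z ∈ CD exampleM z :=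
  CD_cConj (hX.mem_CD hz) hz

lemma cConj_conjField (X : C4 → CVec) (z : C4) : cConj (conjField X z) = X z := cConj_cConj _

end IsCRSection

namespace IsModelFrame

variable {W : Set C4} {V : Submodule ℂ C4} {u1 u2 : C4 → C4}

section Calculus

variable {z : C4}

lemma contDiffAt1 (h : IsModelFrame W V u1 u2) (hz : z ∈ W) : ContDiffAt ℝ ∞ u1 z :=
  h.smooth1.contDiffAt (h.isOpen.mem_nhds hz)

lemma contDiffAt2 (h : IsModelFrame W V u1 u2) (hz : z ∈ W) : ContDiffAt ℝ ∞ u2 z :=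
  h.smooth2.contDiffAt (h.isOpen.mem_nhds hz)

lemma contDiffAt_radCoeff (h : IsModelFrame W V u1 u2) (hz : z ∈ W) :
    ContDiffAt ℝ ∞ (radCoeff u1 u2) z := by
  have h1 := h.contDiffAt1 hz
  have h2 := h.contDiffAt2 hz
  have h3 := (contDiffAt_herm h1 h2).neg.mul ((contDiffAt_herm h2 h2).inv (h.herm_ne_zero z hz))
  have e : radCoeff u1 u2 =
      fun y => -herm (u1 y) (u2 y) * (herm (u2 y) (u2 y))⁻¹ := by
    funext y; rw [radCoeff, div_eq_mul_inv]
  rw [e]; exact h3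

lemma contDiffAt_radVec (h : IsModelFrame W V u1 u2) (hz : z ∈ W) :
    ContDiffAt ℝ ∞ (radVec u1 u2) z :=
  (h.contDiffAt1 hz).add ((h.contDiffAt_radCoeff hz).smul (h.contDiffAt2 hz))

lemma differentiableAt1 (h : IsModelFrame W V u1 u2) (hz : z ∈ W) : DifferentiableAt ℝ u1 z :=
  (h.contDiffAt1 hz).differentiableAt (by simp)

lemma differentiableAt2 (h : IsModelFrame W V u1 u2) (hz : z ∈ W) : DifferentiableAt ℝ u2 z :=
  (h.contDiffAt2 hz).differentiableAt (by simp)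

lemma differentiableAt_radCoeff (h : IsModelFrame W V u1 u2) (hz : z ∈ W) :
    DifferentiableAt ℝ (radCoeff u1 u2) z :=
  (h.contDiffAt_radCoeff hz).differentiableAt (by simp)

lemma differentiableAt_radVec (h : IsModelFrame W V u1 u2) (hz : z ∈ W) :
    DifferentiableAt ℝ (radVec u1 u2) z :=
  (h.contDiffAt_radVec hz).differentiableAt (by simp)

lemma herm_radVec_u2 (h : IsModelFrame W V u1 u2) (hz : z ∈ W) :
    herm (radVec u1 u2 z) (u2 z) = 0 := by
  have h0 := h.herm_ne_zero z hz
  rw [radVec, herm_add_left, herm_smul_left, radCoeff]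
  field_simp
  ring

lemma herm_radVec_u1 (h : IsModelFrame W V u1 u2) (hz : z ∈ exampleM ∩ W) :
    herm (radVec u1 u2 z) (u1 z) = 0 :=
  (exists_of_mem_model (h.mem_model z hz) (h.herm_ne_zero z hz.2) (h.herm_radVec_u2 hz.2)).1

lemma dV_radVec (h : IsModelFrame W V u1 u2) (hz : z ∈ W) (X : CVec) :
    dV X (radVec u1 u2) z =
      dV X u1 z + radCoeff u1 u2 z • dV X u2 z + dC X (radCoeff u1 u2) z • u2 z := by
  have h1 := h.differentiableAt1 hz
  have h2 := h.differentiableAt2 hz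
  have ht := h.differentiableAt_radCoeff hz
  have e : radVec u1 u2 = fun y => u1 y + radCoeff u1 u2 y • u2 y := rfl
  rw [e, dV_add_fun X h1 (ht.fun_smul h2), dV_smul_fun X ht h2]
  module

lemma dV_conj_radVec (h : IsModelFrame W V u1 u2) (hz : z ∈ exampleM ∩ W) {X : CVec}
    (hX : X ∈ H exampleM z) :
    dV (cConj X) (radVec u1 u2) z = dC (cConj X) (radCoeff u1 u2) z • u2 z := by
  obtain ⟨c1, c2⟩ := h.cr z hz X hX
  rw [h.dV_radVec hz.2, c1, c2]
  simp

/-- The `(1,0)`-derivatives of the radical vector are orthogonal to the plane. -/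
lemma herm_dV_radVec (h : IsModelFrame W V u1 u2) (hz : z ∈ exampleM ∩ W) {X : CVec}
    (hX : X ∈ H exampleM z) :
    herm (dV X (radVec u1 u2) z) (u1 z) = 0 ∧ herm (dV X (radVec u1 u2) z) (u2 z) = 0 := by
  obtain ⟨c1, c2⟩ := h.cr z hz X hX
  have hN := h.differentiableAt_radVec hz.2
  have k1 := hasDC_herm (X := X) hN (h.differentiableAt1 hz.2)
  have k2 := hasDC_herm (X := X) hN (h.differentiableAt2 hz.2)
  have e1 := dC_eq_zero_of_tangent k1.1 h.isOpen hz.2 (fun y hy => h.herm_radVec_u1 hy) hX.1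
  have e2 := dC_eq_zero_of_tangent k2.1 h.isOpen hz.2 (fun y hy => h.herm_radVec_u2 hy.2) hX.1
  rw [k1.2, c1, herm_zero_right, add_zero] at e1
  rw [k2.2, c2, herm_zero_right, add_zero] at e2
  exact ⟨e1, e2⟩

lemma herm_dV_radVec_radVec (h : IsModelFrame W V u1 u2) (hz : z ∈ exampleM ∩ W) {X : CVec}
    (hX : X ∈ H exampleM z) : herm (dV X (radVec u1 u2) z) (radVec u1 u2 z) = 0 := by
  obtain ⟨e1, e2⟩ := h.herm_dV_radVec hz hX
  conv_lhs => rw [radVec]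
  rw [herm_add_right, herm_smul_right]
  rw [show herm (dV X (radVec u1 u2) z) (u1 z) = 0 from e1, e2]
  simp

lemma herm_dV_conj_radVec_radVec (h : IsModelFrame W V u1 u2) (hz : z ∈ exampleM ∩ W) {X : CVec}
    (hX : X ∈ H exampleM z) : herm (dV (cConj X) (radVec u1 u2) z) (radVec u1 u2 z) = 0 := by
  rw [h.dV_conj_radVec hz hX, herm_smul_left, herm_symm, h.herm_radVec_u2 hz.2]
  simp

lemma herm_radVec_dV (h : IsModelFrame W V u1 u2) (hz : z ∈ exampleM ∩ W) {X : CVec}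
    (hX : X ∈ H exampleM z) :
    herm (radVec u1 u2 z) (dV X u2 z) =
      -(dC (cConj X) (radCoeff u1 u2) z * herm (u2 z) (u2 z)) := by
  have k := hasDC_herm (X := cConj X) (h.differentiableAt_radVec hz.2) (h.differentiableAt2 hz.2)
  have e := dC_eq_zero_of_tangent k.1 h.isOpen hz.2 (fun y hy => h.herm_radVec_u2 hy.2)
    (CD_cConj hX.1 hz.1)
  rw [k.2, cConj_cConj, h.dV_conj_radVec hz hX, herm_smul_left] at e
  linear_combination e

/-- The Levi form of the model, pulled back to the example: the form `V ↦ h(V N, N)`, with `N` the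
radical vector, annihilates `ℂD`, and its values on brackets are given by first derivatives
of `N`. -/
lemma herm_bracket_radVec (h : IsModelFrame W V u1 u2) (hz : z ∈ exampleM ∩ W) {X Y : C4 → CVec}
    (hX : IsCRSection X) (hY : IsCRSection Y) :
    herm (dV (bracket X (conjField Y) z) (radVec u1 u2) z) (radVec u1 u2 z) =
      herm (dV (X z) (radVec u1 u2) z) (dV (Y z) (radVec u1 u2) z) -
      herm (dV (conjField Y z) (radVec u1 u2) z) (dV (conjField X z) (radVec u1 u2) z) := by
  have hN := h.differentiableAt_radVec hz.2
  have hNs := h.contDiffAt_radVec hz.2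
  have dX := hX.differentiableAt z
  have dY := differentiableAt_conjField (hY.differentiableAt z)
  have k1 := hasDC_herm (X := X z) (differentiableAt_dV hNs dY) hN
  have k2 := hasDC_herm (X := conjField Y z) (differentiableAt_dV hNs dX) hN
  have e1 := dC_eq_zero_of_tangent k1.1 h.isOpen hz.2
    (fun y hy => h.herm_dV_conj_radVec_radVec hy (hY.2 y hy.1)) (hX.mem_CD hz.1)
  have e2 := dC_eq_zero_of_tangent k2.1 h.isOpen hz.2
    (fun y hy => h.herm_dV_radVec_radVec hy (hX.2 y hy.1)) (hY.conj_mem_CD hz.1)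
  rw [k1.2] at e1
  rw [k2.2, IsCRSection.cConj_conjField] at e2
  rw [dV_bracket hNs dX dY, herm_sub_left]
  have hc : cConj (X z) = conjField X z := rfl
  rw [hc] at e1
  linear_combination e1 - e2

/-- A unit vector `k` orthogonal to the plane, in terms of which the derivatives of the radical
vector along the CR bundle are expressed. -/
lemma exists_normal (h : IsModelFrame W V u1 u2) (hz : z ∈ exampleM ∩ W) :
    ∃ (k : C4) (d : ℝ), d < 0 ∧ herm (u2 z) (u2 z) = d ∧ herm k (u2 z) = 0 ∧
      (∀ X ∈ H exampleM z, ∃ f : ℂ, dV X (radVec u1 u2) z =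
        herm (dV X (radVec u1 u2) z) k • k + f • radVec u1 u2 z) ∧
      ∀ X ∈ H exampleM z, ∀ Y ∈ H exampleM z,
        herm (dV X (radVec u1 u2) z) (dV Y (radVec u1 u2) z) =
          herm (dV X (radVec u1 u2) z) k * star (herm (dV Y (radVec u1 u2) z) k) := by
  obtain ⟨-, ⟨d, hd, hd2⟩, k, -, -, hk2, hk⟩ :=
    exists_of_mem_model (h.mem_model z hz) (h.herm_ne_zero z hz.2) (h.herm_radVec_u2 hz.2)
  have hdec : ∀ X ∈ H exampleM z, ∃ f : ℂ, dV X (radVec u1 u2) z =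
      herm (dV X (radVec u1 u2) z) k • k + f • radVec u1 u2 z := by
    intro X hX
    obtain ⟨e1, e2⟩ := h.herm_dV_radVec hz hX
    exact hk _ e1 e2
  refine ⟨k, d, hd, hd2, hk2, hdec, fun X hX Y hY => ?_⟩
  obtain ⟨f, hf⟩ := hdec X hX
  have hYN : herm (radVec u1 u2 z) (dV Y (radVec u1 u2) z) = 0 := by
    rw [herm_symm, h.herm_dV_radVec_radVec hz hY, star_zero]
  have hYk : herm k (dV Y (radVec u1 u2) z) = star (herm (dV Y (radVec u1 u2) z) k) :=
    herm_symm _ _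
  conv_lhs => rw [hf]
  rw [herm_add_left, herm_smul_left, herm_smul_left, hYN, hYk]
  ring

/-- If `X N` is a multiple of `N`, where `N = u₁ + t u₂` is the radical vector, then
`X u₁ + t X u₂ = 0`, because this vector lies both in the plane and in its complement `V`. -/
lemma dV_add_eq_zero (h : IsModelFrame W V u1 u2) (hz : z ∈ exampleM ∩ W) {X : CVec}
    (hX : X ∈ H exampleM z) {f : ℂ} (hf : dV X (radVec u1 u2) z = f • radVec u1 u2 z) :
    dV X u1 z + radCoeff u1 u2 z • dV X u2 z = 0 := by
  obtain ⟨m1, m2⟩ := h.deriv_mem z hz X hX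
  refine Submodule.disjoint_def.1 (h.disjoint z hz) _ (V.add_mem m1 (V.smul_mem _ m2)) ?_
  rw [h.dV_radVec hz.2] at hf
  have e : dV X u1 z + radCoeff u1 u2 z • dV X u2 z =
      f • u1 z + (f * radCoeff u1 u2 z - dC X (radCoeff u1 u2) z) • u2 z := by
    rw [eq_sub_of_add_eq hf, radVec]; module
  rw [e]
  exact Submodule.mem_span_pair.2 ⟨_, _, rfl⟩

end Calculus

end IsModelFrame

/-! ### The example is not locally equivalent to the model -/

/-- Two coefficients `η₁, η₂` compatible with a definite Levi form for which `Y₁, Y₂` are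
orthogonal of equal length satisfy `η₁² + η₂² = 0`. -/
lemma sq_add_sq_eq_zero {η1 η2 μ : ℂ} {d : ℝ} (hd : d < 0)
    (h12 : η1 * μ * star (η2 * μ) - η2 * star η1 * d = 0)
    (hn : η1 * μ * star (η1 * μ) - η1 * star η1 * d = η2 * μ * star (η2 * μ) - η2 * star η2 * d) :
    η1 ^ 2 + η2 ^ 2 = 0 := by
  have hμ : μ * star μ = (Complex.normSq μ : ℂ) := Complex.mul_conj μ
  have hm0 : 0 ≤ Complex.normSq μ := Complex.normSq_nonneg μ
  generalize Complex.normSq μ = m at *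
  rw [star_mul'] at h12 hn
  rw [star_mul'] at hn
  have hmd : ((m : ℂ) - d) ≠ 0 := by
    exact_mod_cast (by linarith : (0 : ℝ) < m - d).ne'
  have e1 : (m : ℂ) * (η1 * star η2) = d * (η2 * star η1) := by
    linear_combination h12 - η1 * star η2 * hμ
  have e2 : (m : ℂ) * (η2 * star η1) = d * (η1 * star η2) := by
    have := congrArg star e1
    simp only [star_mul', star_star,
      show ∀ r : ℝ, star (r : ℂ) = r from Complex.conj_ofReal] at this
    linear_combination this
  have hs : η1 * star η2 + η2 * star η1 = 0 := by
    refine (mul_eq_zero.1 ?_).resolve_left hmd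
    linear_combination e1 + e2
  have hn' : η1 * star η1 = η2 * star η2 := by
    refine mul_left_cancel₀ hmd ?_
    linear_combination hn - (η1 * star η1 - η2 * star η2) * hμ
  by_cases h2 : η2 = 0
  · rw [h2, star_zero, mul_zero] at hn'
    have h1 : η1 = 0 := by simpa using hn'
    rw [h1, h2]; simp
  · refine (mul_eq_zero.1 ?_).resolve_right (star_ne_zero.2 h2)
    linear_combination η1 * hs - η2 * hn'

namespace IsModelFrame

variable {W : Set C4} {V : Submodule ℂ C4} {u1 u2 : C4 → C4} {z : C4}

/-- The Levi form vanishes on `E`; as the two terms of `herm_bracket_radVec` have definite signs,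
both vanish, and the radical line is constant to first order along `E`. -/
lemma dV_E_add_eq_zero (h : IsModelFrame W V u1 u2) (hz : z ∈ exampleM ∩ W) :
    dV (fieldE z) u1 z + radCoeff u1 u2 z • dV (fieldE z) u2 z = 0 := by
  obtain ⟨k, d, hd, hd2, -, hdec, hLevi⟩ := h.exists_normal hz
  have hE := fieldE_mem hz.1
  have h1 := h.herm_bracket_radVec hz isCRSection_E isCRSection_E
  have hc : conjField fieldE z = cConj (fieldE z) := rfl
  rw [bracket_E_E, dV_sub_vec, herm_sub_left, hc, h.herm_dV_conj_radVec_radVec hz hE,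
    h.herm_dV_radVec_radVec hz hE, hLevi _ hE _ hE, h.dV_conj_radVec hz hE, herm_smul_left,
    herm_smul_right, hd2] at h1
  set ξ := herm (dV (fieldE z) (radVec u1 u2) z) k
  set η := dC (cConj (fieldE z)) (radCoeff u1 u2) z
  have h2 : Complex.normSq ξ - Complex.normSq η * d = 0 := by
    have e1 : ξ * star ξ = (Complex.normSq ξ : ℂ) := Complex.mul_conj ξ
    have e2 : η * star η = (Complex.normSq η : ℂ) := Complex.mul_conj η
    have h3 : ((Complex.normSq ξ - Complex.normSq η * d : ℝ) : ℂ) = 0 := by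
      push_cast
      rw [← e1, ← e2]
      linear_combination -h1
    exact_mod_cast h3
  have h3 : Complex.normSq ξ = 0 := by
    have a1 := Complex.normSq_nonneg ξ
    have a2 := mul_nonneg (Complex.normSq_nonneg η) (neg_pos.2 hd).le
    nlinarith
  have h4 : ξ = 0 := Complex.normSq_eq_zero.1 h3
  obtain ⟨f, hf⟩ := hdec _ hE
  refine h.dV_add_eq_zero hz hE (f := f) ?_
  rw [hf, show herm (dV (fieldE z) (radVec u1 u2) z) k = 0 from h4, zero_smul, zero_add]

/-- The compatibility between the derivatives of the radical along `Y` and along `Ȳ` which comes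
from `[E, Ȳ] = Ȳ - Y`. -/
lemma herm_dV_eq (h : IsModelFrame W V u1 u2) (hz : z ∈ exampleM ∩ W) {Y : C4 → CVec}
    (hY : IsCRSection Y) (hbr : bracket fieldE (conjField Y) z = conjField Y z - Y z) {k : C4}
    (hk : herm k (u2 z) = 0) :
    herm (dV (Y z) (radVec u1 u2) z) k =
      dC (conjField Y z) (radCoeff u1 u2) z * -herm (dV (fieldE z) u2 z) k := by
  have hNs := h.contDiffAt_radVec hz.2
  have hts := h.contDiffAt_radCoeff hz.2
  have dY := differentiableAt_conjField (hY.differentiableAt z)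
  have dE := differentiable_fieldE z
  have d2 := h.differentiableAt2 hz.2
  have dYt := differentiableAt_dC (differentiableAt_fderiv_of_contDiffAt hts) dY
  have dEt := differentiableAt_dC (differentiableAt_fderiv_of_contDiffAt hts) dE
  have hku : herm (u2 z) k = 0 := by rw [herm_symm, hk, star_zero]
  have e1 : dV (fieldE z) (fun y => dV (conjField Y y) (radVec u1 u2) y) z =
      dV (fieldE z) (fun y => dC (conjField Y y) (radCoeff u1 u2) y • u2 y) z :=
    dV_congr_of_tangent (differentiableAt_dV hNs dY) (dYt.fun_smul d2) h.isOpen hz.2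
      (fun y hy => h.dV_conj_radVec hy (hY.2 y hy.1)) (isCRSection_E.mem_CD hz.1)
  have e2 : dV (conjField Y z) (fun y => dV (fieldE y) (radVec u1 u2) y) z =
      dV (conjField Y z) (fun y => dC (fieldE y) (radCoeff u1 u2) y • u2 y) z :=
    dV_congr_of_tangent (differentiableAt_dV hNs dE) (dEt.fun_smul d2) h.isOpen hz.2
      (fun y hy => by rw [h.dV_radVec hy.2, h.dV_E_add_eq_zero hy, zero_add])
      (hY.conj_mem_CD hz.1)
  have hb := dV_bracket hNs dE dY
  have hc : conjField Y z = cConj (Y z) := rfl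
  have hcr : dV (conjField Y z) u2 z = 0 := (h.cr z hz _ (hY.2 z hz.1)).2
  rw [e1, e2, dV_smul_fun _ dYt d2, dV_smul_fun _ dEt d2, hbr, dV_sub_vec, hcr] at hb
  have hN : dV (conjField Y z) (radVec u1 u2) z =
      dC (conjField Y z) (radCoeff u1 u2) z • u2 z := h.dV_conj_radVec hz (hY.2 z hz.1)
  have hb' := congrArg (fun v => herm v k) hb
  simp only [hN, herm_sub_left, herm_add_left, herm_smul_left, hku, smul_zero,
    herm_zero_left] at hb'
  linear_combination -hb'

/-- The Levi form makes `Y₁`, `Y₂` orthogonal and of equal length; with `herm_dV_eq` this says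
`(Ȳ₁t)² + (Ȳ₂t)² = 0`, where `t` is the coefficient of the radical vector. -/
lemma sq_add_sq (h : IsModelFrame W V u1 u2) (hz : z ∈ exampleM ∩ W) :
    dC (conjField fieldY1 z) (radCoeff u1 u2) z ^ 2 +
      dC (conjField fieldY2 z) (radCoeff u1 u2) z ^ 2 = 0 := by
  obtain ⟨k, d, hd, hd2, hk, -, hLevi⟩ := h.exists_normal hz
  have hY1 := fieldY1_mem hz.1
  have hY2 := fieldY2_mem hz.1
  have x1 := h.herm_dV_eq hz isCRSection_Y1 (bracket_E_Y1 z) hk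
  have x2 := h.herm_dV_eq hz isCRSection_Y2 (bracket_E_Y2 z) hk
  have b12 := h.herm_bracket_radVec hz isCRSection_Y1 isCRSection_Y2
  have b11 := h.herm_bracket_radVec hz isCRSection_Y1 isCRSection_Y1
  have b22 := h.herm_bracket_radVec hz isCRSection_Y2 isCRSection_Y2
  have n1 : dV (conjField fieldY1 z) (radVec u1 u2) z =
      dC (conjField fieldY1 z) (radCoeff u1 u2) z • u2 z := h.dV_conj_radVec hz hY1
  have n2 : dV (conjField fieldY2 z) (radVec u1 u2) z =
      dC (conjField fieldY2 z) (radCoeff u1 u2) z • u2 z := h.dV_conj_radVec hz hY2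
  have p1 := h.herm_dV_radVec_radVec hz hY1
  have p2 := h.herm_dV_radVec_radVec hz hY2
  have q1 : herm (dV (conjField fieldY1 z) (radVec u1 u2) z) (radVec u1 u2 z) = 0 :=
    h.herm_dV_conj_radVec_radVec hz hY1
  have q2 : herm (dV (conjField fieldY2 z) (radVec u1 u2) z) (radVec u1 u2 z) = 0 :=
    h.herm_dV_conj_radVec_radVec hz hY2
  have b0 : dV 0 (radVec u1 u2) z = 0 := by ext j; exact dC_zero_vec _ _
  rw [bracket_Y1_Y2, b0, herm_zero_left, hLevi _ hY1 _ hY2, x1, x2, n1, n2, herm_smul_left,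
    herm_smul_right, hd2] at b12
  rw [bracket_Y1_Y1, dV_add_vec, dV_sub_vec, herm_add_left, herm_sub_left, p1, q1,
    hLevi _ hY1 _ hY1, x1, n1, herm_smul_left, herm_smul_right, hd2] at b11
  rw [bracket_Y2_Y2, dV_add_vec, dV_sub_vec, herm_add_left, herm_sub_left, p2, q2,
    hLevi _ hY2 _ hY2, x2, n2, herm_smul_left, herm_smul_right, hd2] at b22
  exact sq_add_sq_eq_zero (μ := -herm (dV (fieldE z) u2 z) k) hd (by linear_combination -b12)
    (by linear_combination b22 - b11)

/-- The radical line varies to first order: otherwise the immersion of the three-dimensional space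
`H` would take values in a two-dimensional one. -/
lemma dC_radCoeff_ne_zero (h : IsModelFrame W V u1 u2) (hz : z ∈ exampleM ∩ W) :
    dC (conjField fieldY1 z) (radCoeff u1 u2) z ≠ 0 := by
  intro h1
  have h2 : dC (conjField fieldY2 z) (radCoeff u1 u2) z = 0 := by
    have := h.sq_add_sq hz
    rw [h1] at this
    simpa using this
  obtain ⟨k, d, hd, hd2, hk, hdec, -⟩ := h.exists_normal hz
  have hE := fieldE_mem hz.1
  have hY1 := fieldY1_mem hz.1
  have hY2 := fieldY2_mem hz.1
  have x1 := h.herm_dV_eq hz isCRSection_Y1 (bracket_E_Y1 z) hk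
  have x2 := h.herm_dV_eq hz isCRSection_Y2 (bracket_E_Y2 z) hk
  rw [h1, zero_mul] at x1
  rw [h2, zero_mul] at x2
  obtain ⟨f1, g1⟩ := hdec _ hY1
  obtain ⟨f2, g2⟩ := hdec _ hY2
  rw [x1, zero_smul, zero_add] at g1
  rw [x2, zero_smul, zero_add] at g2
  have a0 := h.dV_E_add_eq_zero hz
  have a1 := h.dV_add_eq_zero hz hY1 g1
  have a2 := h.dV_add_eq_zero hz hY2 g2
  let w : Fin 3 → V := ![⟨_, (h.deriv_mem z hz _ hE).2⟩, ⟨_, (h.deriv_mem z hz _ hY1).2⟩,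
    ⟨_, (h.deriv_mem z hz _ hY2).2⟩]
  have hw : ¬ LinearIndependent ℂ w := by
    intro hli
    have h3 := hli.fintype_card_le_finrank
    rw [Fintype.card_fin] at h3
    have := h.finrank_le
    omega
  obtain ⟨c, hc, i, hi⟩ := Fintype.not_linearIndependent_iff.1 hw
  have hc' : c 0 • dV (fieldE z) u2 z + c 1 • dV (fieldY1 z) u2 z +
      c 2 • dV (fieldY2 z) u2 z = 0 := by
    have := congrArg (Subtype.val) hc
    simpa [Fin.sum_univ_three, w] using this
  set X := c 0 • fieldE z + c 1 • fieldY1 z + c 2 • fieldY2 z with hXdef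
  have hX : X ∈ H exampleM z := by
    rw [mem_H_iff hz.1] at hE hY1 hY2 ⊢
    simp [hXdef, pC_add, pC_smul, hE, hY1, hY2]
  have hX2 : dV X u2 z = 0 := by
    rw [hXdef, dV_add_vec, dV_add_vec, dV_smul_vec, dV_smul_vec, dV_smul_vec, hc']
  have hX1 : dV X u1 z = 0 := by
    rw [hXdef, dV_add_vec, dV_add_vec, dV_smul_vec, dV_smul_vec, dV_smul_vec,
      eq_neg_of_add_eq_zero_left a0, eq_neg_of_add_eq_zero_left a1,
      eq_neg_of_add_eq_zero_left a2]
    have : -(radCoeff u1 u2 z) • (c 0 • dV (fieldE z) u2 z + c 1 • dV (fieldY1 z) u2 z +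
      c 2 • dV (fieldY2 z) u2 z) = 0 := by rw [hc', smul_zero]
    rw [← this]; module
  have hX0 := h.immersive z hz X hX hX1 hX2
  have hzo := octant_of_mem hz.1
  obtain ⟨k0, k1, k2⟩ := x_ne_zero hzo
  have hv := fun j => congrFun (congrArg Prod.fst hX0) j
  have v0 := hv 0
  have v1 := hv 1
  have v2 := hv 2
  simp [hXdef, fieldE, fieldY1, fieldY2] at v0 v1 v2
  have c0 : c 0 = 0 := by
    rcases v2 with h' | h'
    · exact h'
    · exact absurd (by exact_mod_cast h') k2
  rw [c0] at v0 v1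
  have c1 : c 1 = 0 := by
    have : c 1 * (x 0 z : ℂ) = 0 := by simpa using v0
    exact (mul_eq_zero.1 this).resolve_right k0
  have c2 : c 2 = 0 := by
    have : c 2 * (x 1 z : ℂ) = 0 := by simpa using v1
    exact (mul_eq_zero.1 this).resolve_right k1
  fin_cases i
  exacts [hi c0, hi c1, hi c2]

/-- The pairing of `[Y, Z̄] N` with `u₂`, which carries the second derivatives of the coefficient
`t` of the radical vector `N`. -/
lemma herm_bracket_u2 (h : IsModelFrame W V u1 u2) (hz : z ∈ exampleM ∩ W) {Y Z : C4 → CVec}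
    (hY : IsCRSection Y) (hZ : IsCRSection Z) :
    herm (dV (bracket Y (conjField Z) z) (radVec u1 u2) z) (u2 z) =
      dC (Y z) (fun y => dC (conjField Z y) (radCoeff u1 u2) y) z * herm (u2 z) (u2 z) +
      dC (conjField Z z) (radCoeff u1 u2) z * herm (dV (Y z) u2 z) (u2 z) +
      herm (dV (Y z) (radVec u1 u2) z) (dV (Z z) u2 z) := by
  have hNs := h.contDiffAt_radVec hz.2
  have hts := h.contDiffAt_radCoeff hz.2
  have dZ := differentiableAt_conjField (hZ.differentiableAt z)
  have dY := hY.differentiableAt z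
  have d2 := h.differentiableAt2 hz.2
  have dZt := differentiableAt_dC (differentiableAt_fderiv_of_contDiffAt hts) dZ
  have e1 : dV (Y z) (fun y => dV (conjField Z y) (radVec u1 u2) y) z =
      dV (Y z) (fun y => dC (conjField Z y) (radCoeff u1 u2) y • u2 y) z :=
    dV_congr_of_tangent (differentiableAt_dV hNs dZ) (dZt.fun_smul d2) h.isOpen hz.2
      (fun y hy => h.dV_conj_radVec hy (hZ.2 y hy.1)) (hY.mem_CD hz.1)
  have k2 := hasDC_herm (X := conjField Z z) (differentiableAt_dV hNs dY) d2
  have e2 := dC_eq_zero_of_tangent k2.1 h.isOpen hz.2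
    (fun y hy => (h.herm_dV_radVec hy (hY.2 y hy.1)).2) (hZ.conj_mem_CD hz.1)
  rw [k2.2, IsCRSection.cConj_conjField] at e2
  rw [dV_bracket hNs dY dZ, e1, dV_smul_fun _ dZt d2, herm_sub_left, herm_add_left,
    herm_smul_left, herm_smul_left]
  linear_combination -e2

/-- A nonempty piece of the example carries no model frame. Put `ηⱼ = Ȳⱼ t`. With `w = ±i` such that
`η₁ + w η₂ = 0` at a point, the bracket of `Y₁ + w Y₂` and `Ȳ₁ + w Ȳ₂` gives `η₁ = η₂` there, which
is incompatible with `η₁ ≠ 0`. -/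
lemma not_mem (h : IsModelFrame W V u1 u2) (hz : z ∈ exampleM ∩ W) : False := by
  obtain ⟨k, d, hd, hd2, hk, hdec, -⟩ := h.exists_normal hz
  have hY1 := fieldY1_mem hz.1
  have hY2 := fieldY2_mem hz.1
  have hts := h.contDiffAt_radCoeff hz.2
  have dY1 := differentiableAt_conjField (differentiable_fieldY1 z)
  have dY2 := differentiableAt_conjField (differentiable_fieldY2 z)
  have dt1 := differentiableAt_dC (differentiableAt_fderiv_of_contDiffAt hts) dY1
  have dt2 := differentiableAt_dC (differentiableAt_fderiv_of_contDiffAt hts) dY2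
  have hne := h.dC_radCoeff_ne_zero hz
  have hsq := h.sq_add_sq hz
  have x1 := h.herm_dV_eq hz isCRSection_Y1 (bracket_E_Y1 z) hk
  have x2 := h.herm_dV_eq hz isCRSection_Y2 (bracket_E_Y2 z) hk
  obtain ⟨f1, g1⟩ := hdec _ hY1
  obtain ⟨f2, g2⟩ := hdec _ hY2
  have m1 : herm (radVec u1 u2 z) (dV (fieldY1 z) u2 z) =
      -(dC (conjField fieldY1 z) (radCoeff u1 u2) z * herm (u2 z) (u2 z)) :=
    h.herm_radVec_dV hz hY1
  have m2 : herm (radVec u1 u2 z) (dV (fieldY2 z) u2 z) =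
      -(dC (conjField fieldY2 z) (radCoeff u1 u2) z * herm (u2 z) (u2 z)) :=
    h.herm_radVec_dV hz hY2
  have B11 := h.herm_bracket_u2 hz isCRSection_Y1 isCRSection_Y1
  have B12 := h.herm_bracket_u2 hz isCRSection_Y1 isCRSection_Y2
  have B21 := h.herm_bracket_u2 hz isCRSection_Y2 isCRSection_Y1
  have B22 := h.herm_bracket_u2 hz isCRSection_Y2 isCRSection_Y2
  have n1 : dV (conjField fieldY1 z) (radVec u1 u2) z =
      dC (conjField fieldY1 z) (radCoeff u1 u2) z • u2 z := h.dV_conj_radVec hz hY1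
  have n2 : dV (conjField fieldY2 z) (radVec u1 u2) z =
      dC (conjField fieldY2 z) (radCoeff u1 u2) z • u2 z := h.dV_conj_radVec hz hY2
  have b0 : dV 0 (radVec u1 u2) z = 0 := by ext j; exact dC_zero_vec _ _
  have o1 := (h.herm_dV_radVec hz hY1).2
  have o2 := (h.herm_dV_radVec hz hY2).2
  -- the derivative of `η₁² + η₂² = 0` along the field `Y`
  have hder : ∀ Y ∈ CD exampleM z,
      dC (conjField fieldY1 z) (radCoeff u1 u2) z *
        dC Y (fun y => dC (conjField fieldY1 y) (radCoeff u1 u2) y) z +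
      dC (conjField fieldY2 z) (radCoeff u1 u2) z *
        dC Y (fun y => dC (conjField fieldY2 y) (radCoeff u1 u2) y) z = 0 := by
    intro Y hY
    have k1 := HasDC.of_differentiableAt (X := Y) dt1
    have k2 := HasDC.of_differentiableAt (X := Y) dt2
    have k3 := (k1.mul k1).add (k2.mul k2)
    have := dC_eq_zero_of_tangent k3.1 h.isOpen hz.2
      (fun y hy => by linear_combination h.sq_add_sq hy) hY
    rw [k3.2] at this
    linear_combination this / 2
  have D1 := hder _ hY1.1
  have D2 := hder _ hY2.1
  rw [bracket_Y1_Y1, dV_add_vec, dV_sub_vec, herm_add_left, herm_sub_left, o1, n1, g1,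
    herm_smul_left, herm_add_left, herm_smul_left, herm_smul_left, x1, m1] at B11
  rw [bracket_Y2_Y2, dV_add_vec, dV_sub_vec, herm_add_left, herm_sub_left, o2, n2, g2,
    herm_smul_left, herm_add_left, herm_smul_left, herm_smul_left, x2, m2] at B22
  rw [bracket_Y1_Y2, b0, herm_zero_left, g1, herm_add_left, herm_smul_left, herm_smul_left,
    x1, m2] at B12
  rw [bracket_Y2_Y1, b0, herm_zero_left, g2, herm_add_left, herm_smul_left, herm_smul_left,
    x2, m1] at B21
  rw [hd2] at B11 B12 B21 B22
  have hd0 : (d : ℂ) ≠ 0 := by exact_mod_cast hd.ne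
  set g := herm (dV (fieldE z) u2 z) k
  set h1 := herm (dV (fieldY1 z) u2 z) (u2 z)
  set h2 := herm (dV (fieldY2 z) u2 z) (u2 z)
  set κ1 := herm k (dV (fieldY1 z) u2 z)
  set κ2 := herm k (dV (fieldY2 z) u2 z)
  set T := herm (dV (fieldT z) (radVec u1 u2) z) (u2 z)
  generalize dC (conjField fieldY1 z) (radCoeff u1 u2) z = η1 at *
  generalize dC (conjField fieldY2 z) (radCoeff u1 u2) z = η2 at *
  generalize dC (fieldY1 z) (fun y => dC (conjField fieldY1 y) (radCoeff u1 u2) y) z = P11 at *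
  generalize dC (fieldY1 z) (fun y => dC (conjField fieldY2 y) (radCoeff u1 u2) y) z = P12 at *
  generalize dC (fieldY2 z) (fun y => dC (conjField fieldY1 y) (radCoeff u1 u2) y) z = P21 at *
  generalize dC (fieldY2 z) (fun y => dC (conjField fieldY2 y) (radCoeff u1 u2) y) z = P22 at *
  have key : ∀ w : ℂ, w ^ 2 = -1 → η1 + w * η2 = 0 → False := by
    intro w hw hη
    have e1 : P11 + w * P12 = 0 := by
      refine mul_left_cancel₀ hne ?_
      linear_combination D1 + P12 * w * hη - P12 * η2 * hw
    have e2 : P21 + w * P22 = 0 := by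
      refine mul_left_cancel₀ hne ?_
      linear_combination D2 + P22 * w * hη - P22 * η2 * hw
    have e3 : (η1 - η2) * d = 0 := by
      linear_combination B11 + w * B12 + w * B21 + w ^ 2 * B22 + d * e1 + d * w * e2 +
        (h1 + w * h2 - g * (κ1 + w * κ2) - d * (f1 + w * f2)) * hη - (η2 * d + T) * hw
    have e4 : η1 = η2 := by
      have := (mul_eq_zero.1 e3).resolve_right hd0
      linear_combination this
    rw [e4] at hη hne
    have e5 : 1 + w = 0 := by
      refine (mul_eq_zero.1 (?_ : (1 + w) * η2 = 0)).resolve_right hne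
      linear_combination hη
    have e6 : w = -1 := by linear_combination e5
    rw [e6] at hw
    norm_num at hw
  have hfac : (η1 + Complex.I * η2) * (η1 + -Complex.I * η2) = 0 := by
    linear_combination hsq - η2 ^ 2 * Complex.I_sq
  rcases mul_eq_zero.1 hfac with h' | h'
  · exact key _ Complex.I_sq h'
  · exact key _ (by rw [neg_sq]; exact Complex.I_sq) h'

end IsModelFrame

/-! ### Model frames from local CR equivalences -/

/-- The vector `A(a + w e₃ + w' e₄)`, the form in which the standard charts of the Grassmannian
parametrize bases of planes. -/
noncomputable def chartVec (A : Matrix (Fin 4) (Fin 4) ℂ) (a b w w' : ℂ) : C4 :=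
  A.mulVec ![a, b, w, w']

lemma chartVec_apply (A : Matrix (Fin 4) (Fin 4) ℂ) (a b w w' : ℂ) (i : Fin 4) :
    chartVec A a b w w' i = (A i 0 * a + A i 1 * b) + A i 2 * w + A i 3 * w' := by
  simp [chartVec, Matrix.mulVec, dotProduct, Fin.sum_univ_four]

lemma dV_chartVec (A : Matrix (Fin 4) (Fin 4) ℂ) (a b : ℂ) {f g : C4 → ℂ} {z : C4} (X : CVec)
    (hf : DifferentiableAt ℝ f z) (hg : DifferentiableAt ℝ g z) :
    dV X (fun y => chartVec A a b (f y) (g y)) z = chartVec A 0 0 (dC X f z) (dC X g z) := by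
  ext i
  have h := ((HasDC.const (X := X) (z := z) (A i 0 * a + A i 1 * b)).add
    ((HasDC.of_differentiableAt hf).const_mul (A i 2))).add
    ((HasDC.of_differentiableAt hg).const_mul (A i 3))
  have e : (fun y => chartVec A a b (f y) (g y) i) =
      fun y => (A i 0 * a + A i 1 * b) + A i 2 * f y + A i 3 * g y :=
    funext fun y => chartVec_apply A a b (f y) (g y) i
  rw [dV, e, h.2, chartVec_apply]
  ring

lemma contDiffOn_chartVec (A : Matrix (Fin 4) (Fin 4) ℂ) (a b : ℂ) {f g : C4 → ℂ} {U : Set C4}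
    (hf : ContDiffOn ℝ ∞ f U) (hg : ContDiffOn ℝ ∞ g U) :
    ContDiffOn ℝ ∞ (fun y => chartVec A a b (f y) (g y)) U := by
  refine contDiffOn_pi.2 fun i => ?_
  have e : (fun y => chartVec A a b (f y) (g y) i) =
      fun y => (A i 0 * a + A i 1 * b) + A i 2 * f y + A i 3 * g y :=
    funext fun y => chartVec_apply A a b (f y) (g y) i
  rw [e]
  exact (contDiffOn_const.add (contDiffOn_const.mul hf)).add (contDiffOn_const.mul hg)

lemma chartVec_injective (A : GL (Fin 4) ℂ) {a b w w' a' b' v v' : ℂ}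
    (h : chartVec A a b w w' = chartVec A a' b' v v') : a = a' ∧ b = b' ∧ w = v ∧ w' = v' := by
  have h1 := Matrix.mulVec_injective_of_isUnit (Units.isUnit A) h
  exact ⟨congrFun h1 0, congrFun h1 1, congrFun h1 2, congrFun h1 3⟩

/-- The tangent directions of the charts: the span of `A e₃` and `A e₄`. -/
noncomputable def chartDir (A : Matrix (Fin 4) (Fin 4) ℂ) : Submodule ℂ C4 :=
  Submodule.span ℂ {chartVec A 0 0 1 0, chartVec A 0 0 0 1}

lemma chartVec_add_smul (A : Matrix (Fin 4) (Fin 4) ℂ) (r s a b c d a' b' c' d' : ℂ) :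
    r • chartVec A a b c d + s • chartVec A a' b' c' d' =
      chartVec A (r * a + s * a') (r * b + s * b') (r * c + s * c') (r * d + s * d') := by
  ext i
  simp only [Pi.add_apply, Pi.smul_apply, chartVec_apply, smul_eq_mul]
  ring

lemma mem_chartDir_iff (A : Matrix (Fin 4) (Fin 4) ℂ) (v : C4) :
    v ∈ chartDir A ↔ ∃ a b, chartVec A 0 0 a b = v := by
  simp [chartDir, Submodule.mem_span_pair, chartVec_add_smul]

lemma finrank_chartDir_le (A : Matrix (Fin 4) (Fin 4) ℂ) :
    Module.finrank ℂ (chartDir A) ≤ 2 := by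
  classical
  have h := finrank_span_finset_le_card (R := ℂ)
    ({chartVec A 0 0 1 0, chartVec A 0 0 0 1} : Finset C4)
  rw [Finset.coe_pair] at h
  exact h.trans Finset.card_le_two

lemma disjoint_chartDir (A : GL (Fin 4) ℂ) (w : C4) :
    Disjoint (chartDir A) (Submodule.span ℂ {chartVec A 1 0 (w 0) (w 1),
      chartVec A 0 1 (w 2) (w 3)}) := by
  rw [Submodule.disjoint_def]
  intro v hv1 hv2
  obtain ⟨a, b, hab⟩ := (mem_chartDir_iff _ v).1 hv1
  obtain ⟨r, s, hrs⟩ := Submodule.mem_span_pair.1 hv2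
  have e := hab.trans hrs.symm
  rw [chartVec_add_smul] at e
  obtain ⟨h0, h1, -, -⟩ := chartVec_injective A e
  simp at h0 h1
  rw [← hrs, ← h0, ← h1]; simp

/-- Derivatives of a CR map along the CR bundle. -/
lemma dC_of_commutes {Φ : C4 → C4} {z : C4} (hd : DifferentiableAt ℝ Φ z)
    (hI : ∀ v ∈ D exampleM z,
      fderiv ℝ Φ z (Complex.I • v) = Complex.I • fderiv ℝ Φ z v)
    (hz : z ∈ exampleM) {X : CVec} (hX : X ∈ H exampleM z) (j : Fin 4) :
    dC (cConj X) (fun y => Φ y j) z = 0 ∧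
      dC X (fun y => Φ y j) z = fderiv ℝ Φ z X.1 j := by
  obtain ⟨hp, hX2⟩ := (mem_H_iff hz X).1 hX
  have hf : ∀ v, fderiv ℝ (fun y => Φ y j) z v = fderiv ℝ Φ z v j := by
    intro v
    rw [(hasFDerivAt_pi'.1 hd.hasFDerivAt j).fderiv]; rfl
  have hD : cRe X ∈ D exampleM z := hX.1.1
  have e1 : cIm X = -(Complex.I • cRe X) := by
    ext i; simp [cRe_apply, cIm_apply, hX2]; ring
  have e2 : X.1 = cRe X + cRe X := by
    ext i; simp [cRe_apply, hX2]; ring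
  have e3 := hI _ hD
  constructor
  · rw [dC, evalC, cRe_cConj, cIm_cConj, e1, neg_neg, hf, hf, e3]
    simp only [Pi.smul_apply, smul_eq_mul]
    linear_combination (fderiv ℝ Φ z (cRe X) j) * Complex.I_mul_I
  · rw [dC, evalC, e1, hf, hf, map_neg, e3]
    conv_rhs => rw [e2, map_add]
    simp only [Pi.smul_apply, Pi.neg_apply, Pi.add_apply, smul_eq_mul]
    linear_combination -(fderiv ℝ Φ z (cRe X) j) * Complex.I_mul_I

/-- Data as in `IsModelFrame` cannot exist near a point where `u2` is not null: on the open set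
where `u2` stays non-null they form a model frame. -/
lemma IsModelFrame.false_of_herm_ne_zero {U : Set C4} {V : Submodule ℂ C4} {u1 u2 : C4 → C4}
    {p : C4}
    (hU : IsOpen U) (s1 : ContDiffOn ℝ ∞ u1 U) (s2 : ContDiffOn ℝ ∞ u2 U)
    (hm : ∀ z ∈ exampleM ∩ U, Submodule.span ℂ {u1 z, u2 z} ∈ model)
    (hcr : ∀ z ∈ exampleM ∩ U, ∀ X ∈ H exampleM z,
      dV (cConj X) u1 z = 0 ∧ dV (cConj X) u2 z = 0)
    (hV : Module.finrank ℂ V ≤ 2)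
    (hdis : ∀ z ∈ exampleM ∩ U, Disjoint V (Submodule.span ℂ {u1 z, u2 z}))
    (hder : ∀ z ∈ exampleM ∩ U, ∀ X ∈ H exampleM z, dV X u1 z ∈ V ∧ dV X u2 z ∈ V)
    (himm : ∀ z ∈ exampleM ∩ U, ∀ X ∈ H exampleM z, dV X u1 z = 0 → dV X u2 z = 0 → X = 0)
    (hp : p ∈ exampleM ∩ U) (h2 : herm (u2 p) (u2 p) ≠ 0) : False := by
  have hcont : ContinuousOn (fun z => herm (u2 z) (u2 z)) U := fun z hz =>
    (contDiffAt_herm (s2.contDiffAt (hU.mem_nhds hz))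
      (s2.contDiffAt (hU.mem_nhds hz))).continuousAt.continuousWithinAt
  set W := U ∩ (fun z => herm (u2 z) (u2 z)) ⁻¹' {0}ᶜ with hW
  have hWU : W ⊆ U := Set.inter_subset_left
  have sub : ∀ z ∈ exampleM ∩ W, z ∈ exampleM ∩ U := fun z hz => ⟨hz.1, hWU hz.2⟩
  have hframe : IsModelFrame W V u1 u2 :=
    { isOpen := hcont.isOpen_inter_preimage hU isOpen_compl_singleton
      smooth1 := s1.mono hWU
      smooth2 := s2.mono hWU
      mem_model := fun z hz => hm z (sub z hz)
      cr := fun z hz => hcr z (sub z hz)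
      finrank_le := hV
      disjoint := fun z hz => hdis z (sub z hz)
      deriv_mem := fun z hz => hder z (sub z hz)
      immersive := fun z hz => himm z (sub z hz)
      herm_ne_zero := fun z hz => hz.2 }
  exact hframe.not_mem (z := p) ⟨hp.1, hp.2, h2⟩

theorem not_locallyCREquivalentToModelAt (p : C4) :
    ¬ LocallyCREquivalentToModelAt exampleM p := by
  rintro ⟨A, w, -, U, U', Φ, Ψ, hU, hU', hp, -, hΦ, hΨ, -, hΦΨ, -, hCR⟩
  set u1 : C4 → C4 := fun z => chartVec A 1 0 (Φ z 0) (Φ z 1) with hu1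
  set u2 : C4 → C4 := fun z => chartVec A 0 1 (Φ z 2) (Φ z 3) with hu2
  have hΦj := fun j => contDiffOn_pi.1 hΦ j
  have hd : ∀ z ∈ U, DifferentiableAt ℝ Φ z := fun z hz =>
    (hΦ.contDiffAt (hU.mem_nhds hz)).differentiableAt (by simp)
  have hdj : ∀ z ∈ U, ∀ j, DifferentiableAt ℝ (fun y => Φ y j) z := fun z hz j =>
    differentiableAt_pi.1 (hd z hz) j
  have s1 : ContDiffOn ℝ ∞ u1 U := contDiffOn_chartVec _ _ _ (hΦj 0) (hΦj 1)
  have s2 : ContDiffOn ℝ ∞ u2 U := contDiffOn_chartVec _ _ _ (hΦj 2) (hΦj 3)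
  have hm : ∀ z ∈ exampleM ∩ U, Submodule.span ℂ {u1 z, u2 z} ∈ model :=
    fun z hz => (hΦΨ z hz).1.1
  have D1 : ∀ z ∈ U, ∀ X, dV X u1 z =
      chartVec A 0 0 (dC X (fun y => Φ y 0) z) (dC X (fun y => Φ y 1) z) := fun z hz X =>
    dV_chartVec _ _ _ X (hdj z hz 0) (hdj z hz 1)
  have D2 : ∀ z ∈ U, ∀ X, dV X u2 z =
      chartVec A 0 0 (dC X (fun y => Φ y 2) z) (dC X (fun y => Φ y 3) z) := fun z hz X =>
    dV_chartVec _ _ _ X (hdj z hz 2) (hdj z hz 3)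
  have h00 : chartVec (A : Matrix (Fin 4) (Fin 4) ℂ) 0 0 0 0 = 0 := by
    ext i; rw [chartVec_apply]; simp
  have hdC : ∀ z ∈ exampleM ∩ U, ∀ X ∈ H exampleM z, ∀ j,
      dC (cConj X) (fun y => Φ y j) z = 0 ∧ dC X (fun y => Φ y j) z = fderiv ℝ Φ z X.1 j :=
    fun z hz X hX j => dC_of_commutes (hd z hz.2) (fun v hv => (hCR z hz v hv).2) hz.1 hX j
  have hcr : ∀ z ∈ exampleM ∩ U, ∀ X ∈ H exampleM z,
      dV (cConj X) u1 z = 0 ∧ dV (cConj X) u2 z = 0 := by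
    intro z hz X hX
    have h := fun j => (hdC z hz X hX j).1
    rw [D1 z hz.2, D2 z hz.2, h, h, h, h, h00]
    exact ⟨rfl, rfl⟩
  have hdis : ∀ z ∈ exampleM ∩ U, Disjoint (chartDir A) (Submodule.span ℂ {u1 z, u2 z}) :=
    fun z _ => disjoint_chartDir A (Φ z)
  have hder : ∀ z ∈ exampleM ∩ U, ∀ X ∈ H exampleM z,
      dV X u1 z ∈ chartDir A ∧ dV X u2 z ∈ chartDir A := by
    intro z hz X _
    rw [D1 z hz.2, D2 z hz.2, mem_chartDir_iff, mem_chartDir_iff]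
    exact ⟨⟨_, _, rfl⟩, ⟨_, _, rfl⟩⟩
  have himm : ∀ z ∈ exampleM ∩ U, ∀ X ∈ H exampleM z,
      dV X u1 z = 0 → dV X u2 z = 0 → X = 0 := by
    intro z hz X hX h1 h2
    rw [D1 z hz.2, ← h00] at h1
    rw [D2 z hz.2, ← h00] at h2
    obtain ⟨-, -, k0, k1⟩ := chartVec_injective A h1
    obtain ⟨-, -, k2, k3⟩ := chartVec_injective A h2
    have hv : fderiv ℝ Φ z X.1 = 0 := by
      ext j
      rw [← (hdC z hz X hX j).2]
      fin_cases j <;> assumption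
    obtain ⟨hpX, hX2⟩ := (mem_H_iff hz.1 X).1 hX
    have hT : X.1 ∈ tangentSpace exampleM z := by
      rw [mem_tangentSpace_iff hz.1, hpX]; simp
    -- differentiate `Ψ ∘ Φ = id` along the tangent vector `X`
    have hΨd : DifferentiableAt ℝ Ψ (Φ z) :=
      (hΨ.contDiffAt (hU'.mem_nhds (hΦΨ z hz).1.2)).differentiableAt (by simp)
    have hcomp := (hΨd.hasFDerivAt.comp z (hd z hz.2).hasFDerivAt).sub (hasFDerivAt_id z)
    have h3 := fderiv_eq_zero_of_tangent hcomp.differentiableAt hU hz.2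
      (fun y hy => by simp [(hΦΨ y hy).2]) hT
    rw [hcomp.fderiv] at h3
    have h4 : X.1 = 0 := by simpa [hv] using h3
    exact Prod.ext h4 hX2
  rcases herm_ne_zero_of_mem_model (hm p hp) with h | h
  · refine IsModelFrame.false_of_herm_ne_zero hU s2 s1 (fun z hz => ?_)
      (fun z hz X hX => (hcr z hz X hX).symm)
      (finrank_chartDir_le A) (fun z hz => ?_) (fun z hz X hX => (hder z hz X hX).symm)
      (fun z hz X hX k2 k1 => himm z hz X hX k1 k2) hp h
    · rw [Set.pair_comm]; exact hm z hz
    · rw [Set.pair_comm]; exact hdis z hz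
  · exact IsModelFrame.false_of_herm_ne_zero hU s1 s2 hm hcr (finrank_chartDir_le A) hdis hder
      himm hp h

end CR7

theorem mainTheorem5 :
    CR7.IsDefiniteConformalUnitaryCR CR7.exampleM ∧
    (∀ F1 F2 : CR7.C4 → ℂ,
      CR7.HasFundamentalCoefficients CR7.exampleM CR7.exampleCoframe F1 F2 ↔
        ∀ z ∈ CR7.exampleM, F1 z = CR7.exampleF1 z ∧ F2 z = CR7.exampleF2 z) ∧
    (∀ z ∈ CR7.exampleM, CR7.exampleF1 z ≠ 0 ∧ CR7.exampleF2 z ≠ 0) ∧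
    (∀ p ∈ CR7.exampleM, ¬ CR7.LocallyCREquivalentToModelAt CR7.exampleM p) :=
  ⟨CR7.isDefiniteConformalUnitaryCR_exampleM, CR7.hasFundamentalCoefficients_iff,
    fun _ hz => CR7.exampleF_ne_zero hz, fun p _ => CR7.not_locallyCREquivalentToModelAt p⟩
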